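/- Consider the following decision problem $1\,|\,\sum U_j^{(1)}\le A_1,\ \sum w_j^{(2)}C_j^{(2)}\le A_2\,|$. An instance consists of $n$ jobs of agent 1, with positive integer processing times $p_j^{(1)}$ and due dates $d_j^{(1)}$ ($1\le j\le n$), of $k\le n$ jobs of agent 2, with positive integer processing times $p_j^{(2)}$ and weights $w_j^{(2)}$ ($1\le j\le k$), and of two non-negative integer bounds $A_1,A_2$. A schedule assigns to every job a real completion time $C_j^{(i)}\ge p_j^{(i)}$ such that the $n+k$ intervals $(C_j^{(i)}-p_j^{(i)},C_j^{(i)}]$ are pairwise disjoint (one machine, no preemption). The question is whether there is a schedule in which at most $A_1$ jobs of agent 1 are tardy (that is, $C_j^{(1)}>d_j^{(1)}$) and $\sum_{j=1}^k w_j^{(2)}C_j^{(2)}\le A_2$. Theorem. There is an algorithm (a single program for a random access machine with unit-cost addition, truncated subtraction, multiplication, integer division, comparison with zero, and memory access) that decides this problem in $O(k!\,n^{2k+1}\log n)$ steps: there is an absolute constant $K$ such that on every instance with $n\ge 2$ it takes at most $K\,k!\,n^{2k+1}\log n$ steps, and the program halts with the correct answer on every instance. All numbers and addresses that it handles have $O(\ell)$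 bits, where $\ell$ is the bit length of the largest number among the entries and the length of the input. Consequently the problem, parameterized by $k$, lies in the class XP: for some computable function $f$ there is a program that, on every input word $x$ and parameter $k$, decides whether $x$ encodes a yes-instance in which agent 2 has $k$ jobs, and does so in at most $f(k)\,|\langle x,k\rangle|^{f(k)}$ bit operations (logarithmic-cost time), where $|\langle x,k\rangle|$ is the length of the input in bits. -/

import Mathlib

/-! ### A random access machine with a step count

Structured programs over finitely many registers (those that the program names) and a memory of
cells indexed by the natural numbers. -/

namespace RAM

/-- The arithmetic operations; subtraction is truncated, division is rounded down. -/
inductive Op where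
  | add | sub | mul | div

def Op.eval : Op → ℕ → ℕ → ℕ
  | .add, x, y => x + y
  | .sub, x, y => x - y
  | .mul, x, y => x * y
  | .div, x, y => x / y

/-- Programs. `const a c` is `R[a] := c`; `op o a b c` is `R[a] := R[b] o R[c]`;
`load a b` is `R[a] := M[R[b]]`; `store a b` is `M[R[a]] := R[b]`; the tests of `ite a` and of
`loop a` are `R[a] ≠ 0`. -/
inductive Prog where
  | const (a c : ℕ)
  | op (o : Op) (a b c : ℕ)
  | load (a b : ℕ)
  | store (a b : ℕ)
  | seq (P Q : Prog)
  | ite (a : ℕ) (P Q : Prog)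
  | loop (a : ℕ) (P : Prog)

structure State where
  reg : ℕ → ℕ
  mem : ℕ → ℕ

def State.setReg (s : State) (a v : ℕ) : State := ⟨Function.update s.reg a v, s.mem⟩

def State.setMem (s : State) (a v : ℕ) : State := ⟨s.reg, Function.update s.mem a v⟩

/-- What an execution costs: the number of elementary instructions and tests (uniform cost), the
logarithmic cost, and the largest number that is read, written or used as an address. -/
structure Cost where
  steps : ℕ
  bits : ℕ
  word : ℕ

/-- The cost of one elementary instruction or test which handles the numbers in `l`. -/
def Cost.unit (l : List ℕ) : Cost := ⟨1, 1 + (l.map Nat.size).sum, l.foldr max 0⟩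

/-- The cost of two executions, one after the other. -/
def Cost.append (c d : Cost) : Cost := ⟨c.steps + d.steps, c.bits + d.bits, max c.word d.word⟩

/-- `Exec P s c t`: started in the state `s`, the program `P` halts in the state `t`, at cost `c`. -/
inductive Exec : Prog → State → Cost → State → Prop
  | const (a c : ℕ) (s : State) :
      Exec (.const a c) s (.unit [c]) (s.setReg a c)
  | op (o : Op) (a b c : ℕ) (s : State) :
      Exec (.op o a b c) s (.unit [s.reg b, s.reg c, o.eval (s.reg b) (s.reg c)])
        (s.setReg a (o.eval (s.reg b) (s.reg c)))
  | load (a b : ℕ) (s : State) :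
      Exec (.load a b) s (.unit [s.reg b, s.mem (s.reg b)]) (s.setReg a (s.mem (s.reg b)))
  | store (a b : ℕ) (s : State) :
      Exec (.store a b) s (.unit [s.reg a, s.reg b]) (s.setMem (s.reg a) (s.reg b))
  | seq {P Q : Prog} {s t u : State} {c d : Cost} (hP : Exec P s c t) (hQ : Exec Q t d u) :
      Exec (.seq P Q) s (c.append d) u
  | iteTrue {a : ℕ} {P Q : Prog} {s t : State} {c : Cost} (ha : s.reg a ≠ 0)
      (hP : Exec P s c t) : Exec (.ite a P Q) s ((Cost.unit [s.reg a]).append c) t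
  | iteFalse {a : ℕ} {P Q : Prog} {s t : State} {c : Cost} (ha : s.reg a = 0)
      (hQ : Exec Q s c t) : Exec (.ite a P Q) s ((Cost.unit [s.reg a]).append c) t
  | loopTrue {a : ℕ} {P : Prog} {s t u : State} {c d : Cost} (ha : s.reg a ≠ 0)
      (hP : Exec P s c t) (hL : Exec (.loop a P) t d u) :
      Exec (.loop a P) s ((Cost.unit [s.reg a]).append (c.append d)) u
  | loopFalse {a : ℕ} {P : Prog} {s : State} (ha : s.reg a = 0) :
      Exec (.loop a P) s (Cost.unit [s.reg a]) s

/-- The initial state on input `x`: the input stands in the memory from address `0` on, its length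
in register `0`, and everything else is zero. -/
def init (x : List ℕ) : State := ⟨Function.update 0 0 x.length, fun i => x.getD i 0⟩

/-- A halting state accepts if register `0` is nonzero. -/
def State.Accepts (s : State) : Prop := s.reg 0 ≠ 0

/-- On input `x` the program `P` halts at cost `c`, and it accepts if and only if `φ` holds. -/
def Decides (P : Prog) (x : List ℕ) (c : Cost) (φ : Prop) : Prop :=
  ∃ t : State, Exec P (init x) c t ∧ (t.Accepts ↔ φ)

/-- The number of bits of an input, with one separator for every entry. -/
def inputSize (x : List ℕ) : ℕ := (x.map fun a => a.size + 1).sum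

/-- The largest among the length and the entries of an input. -/
def maxNumber (x : List ℕ) : ℕ := (x.length :: x).foldr max 0

end RAM

/-- The (strongly uniform) parameterized class XP: one program decides the parameterized language
`L` and runs, on an input `x` with parameter `k`, for at most `f k * |⟨x, k⟩| ^ f k` bit operations
(logarithmic cost), for some computable function `f`. -/
def InXP (L : Set (List ℕ × ℕ)) : Prop :=
  ∃ (P : RAM.Prog) (f : ℕ → ℕ), Computable f ∧
    ∀ (x : List ℕ) (k : ℕ), ∃ c : RAM.Cost,
      RAM.Decides P (k :: x) c ((x, k) ∈ L) ∧ c.bits ≤ f k * RAM.inputSize (k :: x) ^ f k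

/-! ### Two-agent scheduling on a single machine -/

/-- Instances: agent 1 has `n` jobs with processing times `p₁` and due dates `d₁`, agent 2 has
`k ≤ n` jobs with processing times `p₂` and weights `w₂`, and `A₁`, `A₂` are the bounds. -/
structure TwoAgentInstance where
  n : ℕ
  k : ℕ
  k_le_n : k ≤ n
  p₁ : Fin n → ℕ
  d₁ : Fin n → ℕ
  p₂ : Fin k → ℕ
  w₂ : Fin k → ℕ
  A₁ : ℕ
  A₂ : ℕ
  p₁_pos : ∀ j, 0 < p₁ j
  d₁_pos : ∀ j, 0 < d₁ j
  p₂_pos : ∀ j, 0 < p₂ j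
  w₂_pos : ∀ j, 0 < w₂ j

namespace TwoAgentInstance

/-- The processing times of the jobs of both agents. -/
def p (I : TwoAgentInstance) : Fin I.n ⊕ Fin I.k → ℕ := Sum.elim I.p₁ I.p₂

/-- A schedule, given by the completion times `C`: the jobs are processed without preemption in
pairwise disjoint intervals `(C j - p j, C j]`, and none starts before time `0`. -/
structure Schedule (I : TwoAgentInstance) where
  C : Fin I.n ⊕ Fin I.k → ℝ
  start_nonneg : ∀ j, 0 ≤ C j - I.p j
  disjoint : ∀ i j, i ≠ j → Disjoint (Set.Ioc (C i - I.p i) (C i)) (Set.Ioc (C j - I.p j) (C j))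

variable {I : TwoAgentInstance}

/-- The indicator of tardiness of a job of agent 1. -/
noncomputable def Schedule.U₁ (σ : I.Schedule) (j : Fin I.n) : ℕ :=
  if (I.d₁ j : ℝ) < σ.C (Sum.inl j) then 1 else 0

/-- Both bounds are met: agent 1 has at most `A₁` tardy jobs, and the weighted sum of completion
times of agent 2 is at most `A₂`. -/
def Schedule.Feasible (σ : I.Schedule) : Prop :=
  ∑ j, σ.U₁ j ≤ I.A₁ ∧ ∑ j, (I.w₂ j : ℝ) * σ.C (Sum.inr j) ≤ I.A₂

/-- The question of the decision problem. -/
def IsYes (I : TwoAgentInstance) : Prop := ∃ σ : I.Schedule, σ.Feasible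

/-- An instance as a list of numbers; the parameter `k` is given separately. -/
def encode (I : TwoAgentInstance) : List ℕ :=
  [I.n, I.A₁, I.A₂] ++ List.ofFn I.p₁ ++ List.ofFn I.d₁ ++ List.ofFn I.p₂ ++ List.ofFn I.w₂

/-- The input of the machine. -/
def input (I : TwoAgentInstance) : List ℕ := I.k :: I.encode

end TwoAgentInstance

/-- The decision problem as a parameterized language; the parameter is the number of jobs of
agent 2. -/
def twoAgentProblem : Set (List ℕ × ℕ) :=
  {y | ∃ I : TwoAgentInstance, y = (I.encode, I.k) ∧ I.IsYes}

/-! Normal form. Fix a feasible schedule, let `E` be the set of the jobs of agent 1 that are in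
time, and number the jobs of agent 1 by due date. Tardy jobs can be moved to the end, so only `E`
and the `k` jobs of agent 2 matter. For a job `j` of agent 2 let `gap j` be the least number of a
job of `E` that is completed after `j` (`n` if there is none). Reorder: keep the order of agent 2,
process `E` by due date, and put before `j` exactly the jobs of `E` with number below `gap j`.
Whatever now precedes `j` preceded it before, so `j` ends no later. For `x` in `E`, let `z` be the
job of `E` with number at most `x` that was completed last. Each job `j` of agent 2 that now
precedes `x` has `gap j ≤ x`, and the job `gap j` was completed after `j`. So everything up to `x`
was completed by the time `C z ≤ d z ≤ d x`, and `x` is in time. This is `exists_guess`; it uses of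
the schedule only that a set of jobs completed by some time has at most that total length
(`sum_p_le`).

Guess and greedy. The normal form is coded by `n + k` slots, some for the jobs of agent 2, the
others for the jobs of agent 1 by due date. The jobs of agent 2 cut it into `k + 1` blocks. A guess
consists of the `k` slots of agent 2 and the numbers of jobs of `E` in the first `k` blocks. It does
not give `E`: in each block the algorithm of Moore and Hodgson selects jobs and discards the longest
one whenever the new job would be tardy or the guessed number would be exceeded. By `sim_dominates`,
the selection of a block always contains as many jobs as `E` has had in this block, of no larger
total length. At the end of the block the guessed number leaves room for no others, so the selection
takes no longer than `E` does, and agent 2 is not delayed. Conversely, by `sim_sound`, the selection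
is in time for every guess, so that acceptance yields a schedule. Together: `exists_accepts_iff`.

Time. There are `(n + k) ^ (2 k)` guesses. A tournament tree gives insertion and removal of the
longest job in `O(log n)` steps; it is cleared in `O(n)` steps at the start and after each job of
agent 2, so a test takes `O((n + k) log n + k n)` steps. As `k ≤ n`, the product is at most a
constant times `(k + 1) 4 ^ k n ^ (2 k + 1) log n`, and `(k + 1) 4 ^ k ≤ 8 ^ k ≤ e ^ 8 k!`.

Machine. The program is written in a small language whose compilation is verified once, with rules
that bound steps and numbers. All variables stay below `M ^ 4`, where `M` is the largest number of
the input, and intermediate results below a fixed power of that; hence words of `O(ℓ)` bits, and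
membership in XP by `Exec.bits_le`. -/

set_option linter.constructorNameAsVariable false

/-! ### Hoare rules for the machine -/

namespace RAM

theorem Cost.unit_word_le {l : List ℕ} {B : ℕ} (h : ∀ a ∈ l, a ≤ B) : (Cost.unit l).word ≤ B := by
  induction l with
  | nil => simp [Cost.unit]
  | cons a l ih =>
    simp only [Cost.unit, List.foldr_cons] at *
    exact max_le (h a (by simp)) (ih fun b hb => h b (by simp [hb]))

/-- Started in `s`, the program halts in at most `T` steps, handling only numbers up to `B`, in a
state that satisfies `Q`. -/
def Halts (P : Prog) (s : State) (T B : ℕ) (Q : State → Prop) : Prop :=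
  ∃ κ t, Exec P s κ t ∧ κ.steps ≤ T ∧ κ.word ≤ B ∧ Q t

namespace Halts

variable {P P' : Prog} {s : State} {T T' B B' a b c : ℕ} {Q Q' : State → Prop}

theorem mono (h : Halts P s T B Q) (hT : T ≤ T') (hB : B ≤ B') (hQ : ∀ t, Q t → Q' t) :
    Halts P s T' B' Q' := by
  obtain ⟨κ, t, h1, h2, h3, h4⟩ := h
  exact ⟨κ, t, h1, h2.trans hT, h3.trans hB, hQ t h4⟩

theorem const (h : c ≤ B) (hQ : Q (s.setReg a c)) : Halts (.const a c) s 1 B Q :=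
  ⟨_, _, .const a c s, le_rfl, Cost.unit_word_le (by simpa using h), hQ⟩

theorem op {o : Op} (hb : s.reg b ≤ B) (hc : s.reg c ≤ B)
    (h : o.eval (s.reg b) (s.reg c) ≤ B)
    (hQ : Q (s.setReg a (o.eval (s.reg b) (s.reg c)))) : Halts (.op o a b c) s 1 B Q :=
  ⟨_, _, .op o a b c s, le_rfl, Cost.unit_word_le (by simp [*]), hQ⟩

theorem load (hb : s.reg b ≤ B) (h : s.mem (s.reg b) ≤ B)
    (hQ : Q (s.setReg a (s.mem (s.reg b)))) : Halts (.load a b) s 1 B Q :=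
  ⟨_, _, .load a b s, le_rfl, Cost.unit_word_le (by simp [*]), hQ⟩

theorem store (ha : s.reg a ≤ B) (hb : s.reg b ≤ B)
    (hQ : Q (s.setMem (s.reg a) (s.reg b))) : Halts (.store a b) s 1 B Q :=
  ⟨_, _, .store a b s, le_rfl, Cost.unit_word_le (by simp [*]), hQ⟩

theorem seq (h : Halts P s T B fun t => Halts P' t T' B Q) :
    Halts (.seq P P') s (T + T') B Q := by
  obtain ⟨κ, t, h1, h2, h3, κ', t', h1', h2', h3', h4⟩ := h
  exact ⟨_, _, .seq h1 h1', add_le_add h2 h2', max_le h3 h3', h4⟩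

theorem ite (ha : s.reg a ≤ B) (h : s.reg a ≠ 0 → Halts P s T B Q)
    (h' : s.reg a = 0 → Halts P' s T B Q) : Halts (.ite a P P') s (T + 1) B Q := by
  have hu : (Cost.unit [s.reg a]).word ≤ B := Cost.unit_word_le (by simpa using ha)
  by_cases h0 : s.reg a = 0
  · obtain ⟨κ, t, h1, h2, h3, h4⟩ := h' h0
    exact ⟨_, _, .iteFalse h0 h1, by simp only [Cost.append, Cost.unit]; omega,
      max_le hu h3, h4⟩
  · obtain ⟨κ, t, h1, h2, h3, h4⟩ := h h0
    exact ⟨_, _, .iteTrue h0 h1, by simp only [Cost.append, Cost.unit]; omega,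
      max_le hu h3, h4⟩

theorem loop_zero (ha : s.reg a = 0) (hQ : Q s) : Halts (.loop a P) s 1 B Q :=
  ⟨_, _, .loopFalse ha, le_rfl, Cost.unit_word_le (by simp [ha]), hQ⟩

theorem loop_step (ha : s.reg a ≠ 0) (hB : s.reg a ≤ B)
    (h : Halts P s T B fun t => Halts (.loop a P) t T' B Q) :
    Halts (.loop a P) s (T + T' + 1) B Q := by
  obtain ⟨κ, t, h1, h2, h3, κ', t', h1', h2', h3', h4⟩ := h
  have hu : (Cost.unit [s.reg a]).word ≤ B := Cost.unit_word_le (by simpa using hB)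
  exact ⟨_, _, .loopTrue ha h1 h1', by simp only [Cost.append, Cost.unit]; omega,
    max_le hu (max_le h3 h3'), h4⟩

end Halts

/-- Logarithmic cost in terms of uniform cost and the size of the words. -/
theorem Exec.bits_le {P : Prog} {s t : State} {κ : Cost} (h : Exec P s κ t) {B : ℕ}
    (hB : κ.word.size ≤ B) : κ.bits ≤ κ.steps * (1 + 3 * B) := by
  -- An elementary instruction or test handles at most three numbers, hence the factor 3.
  have hu : ∀ l : List ℕ, l.length ≤ 3 → (Cost.unit l).word.size ≤ B →
      (Cost.unit l).bits ≤ (Cost.unit l).steps * (1 + 3 * B) := by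
    intro l hl hw
    have : ∀ l : List ℕ, (l.foldr max 0).size ≤ B → (l.map Nat.size).sum ≤ l.length * B := by
      intro l
      induction l with
      | nil => simp
      | cons a l ih =>
        intro h
        simp only [List.foldr_cons, List.map_cons, List.sum_cons, List.length_cons] at *
        have h1 := ih (le_trans (Nat.size_le_size (le_max_right _ _)) h)
        have h2 := le_trans (Nat.size_le_size (le_max_left a (l.foldr max 0))) h
        linarith
    have h1 := this l hw
    have h2 : l.length * B ≤ 3 * B := Nat.mul_le_mul_right _ hl
    simp only [Cost.unit]
    omega
  have happ : ∀ c d : Cost, c.bits ≤ c.steps * (1 + 3 * B) → d.bits ≤ d.steps * (1 + 3 * B) →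
      (c.append d).bits ≤ (c.append d).steps * (1 + 3 * B) := by
    intro c d hc hd
    simp only [Cost.append]
    linarith
  have hl : ∀ c d : Cost, (c.append d).word.size ≤ B → c.word.size ≤ B := fun c d h =>
    (Nat.size_le_size (le_max_left _ _)).trans h
  have hr : ∀ c d : Cost, (c.append d).word.size ≤ B → d.word.size ≤ B := fun c d h =>
    (Nat.size_le_size (le_max_right _ _)).trans h
  induction h with
  | const | op | load | store | loopFalse => exact hu _ (by simp) hB
  | seq _ _ ih1 ih2 => exact happ _ _ (ih1 (hl _ _ hB)) (ih2 (hr _ _ hB))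
  | iteTrue _ _ ih | iteFalse _ _ ih =>
    exact happ _ _ (hu _ (by simp) (hl _ _ hB)) (ih (hr _ _ hB))
  | loopTrue _ _ _ ih1 ih2 =>
    exact happ _ _ (hu _ (by simp) (hl _ _ hB))
      (happ _ _ (ih1 (hl _ _ (hr _ _ hB))) (ih2 (hr _ _ (hr _ _ hB))))

end RAM

/-! ### A small language with named variables and arrays, compiled to the machine -/

namespace Sched

open RAM

/-- The variables of the program. -/
inductive Var where
  | n | k | A₁ | A₂ | ok | res | i | j | v | x | p | carry | more
  | t | cost | tot | q | cnt | s | z | u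
  deriving DecidableEq

/-- The arrays of the program: the tournament tree, the processing times and the due dates of
agent 1 in the order of the due dates, the slots of the jobs of agent 2, and the guess. -/
inductive Arr where
  | tree | sp | sd | slot | dig
  deriving DecidableEq

/-- Register 0 is left out because it keeps the length of the input; the registers from 22 on are
scratch space for expressions. -/
def Var.reg : Var → ℕ
  | n => 1 | k => 2 | A₁ => 3 | A₂ => 4 | ok => 5 | res => 6 | i => 7 | j => 8 | v => 9 | x => 10
  | p => 11 | carry => 12 | more => 13 | t => 14 | cost => 15 | tot => 16 | q => 17 | cnt => 18
  | s => 19 | z => 20 | u => 21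

/-- The arrays are interleaved behind the input with stride 5. So none needs a declared size, and
addresses are linear in the indices. -/
def Arr.offset : Arr → ℕ
  | tree => 0 | sp => 1 | sd => 2 | slot => 3 | dig => 4

theorem Var.reg_injective : Function.Injective Var.reg := by
  intro a b h
  cases a <;> cases b <;> first | rfl | exact absurd h (by decide)

theorem Var.reg_pos (x : Var) : 0 < x.reg := by cases x <;> decide

theorem Var.reg_lt (x : Var) : x.reg < 22 := by cases x <;> decide

theorem Arr.offset_injective : Function.Injective Arr.offset := by
  intro a b h
  cases a <;> cases b <;> first | rfl | exact absurd h (by decide)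

theorem Arr.offset_lt (r : Arr) : r.offset < 5 := by cases r <;> decide

inductive Expr where
  | const (c : ℕ)
  | len
  | var (x : Var)
  | op (o : Op) (a b : Expr)
  | arr (r : Arr) (i : Expr)

instance (c : ℕ) : OfNat Expr c := ⟨.const c⟩
instance : HAdd Expr Expr Expr := ⟨.op .add⟩
instance : HSub Expr Expr Expr := ⟨.op .sub⟩
instance : HMul Expr Expr Expr := ⟨.op .mul⟩
instance : HDiv Expr Expr Expr := ⟨.op .div⟩

/-- Commands; `input x e` reads the entry number `e` of the input. -/
inductive Cmd where
  | assign (x : Var) (e : Expr)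
  | input (x : Var) (e : Expr)
  | store (r : Arr) (i e : Expr)
  | seq (c d : Cmd)
  | ite (e : Expr) (c d : Cmd)
  | loop (e : Expr) (c : Cmd)

infixl:60 " ≔ " => Cmd.assign
infixr:50 " ⨾ " => Cmd.seq

/-- The values of the variables and the contents of the arrays. -/
structure Sto where
  val : Var → ℕ
  arr : Arr → ℕ → ℕ

def Sto.set (σ : Sto) (x : Var) (a : ℕ) : Sto := ⟨Function.update σ.val x a, σ.arr⟩

def Sto.setArr (σ : Sto) (r : Arr) (f : ℕ → ℕ) : Sto := ⟨σ.val, Function.update σ.arr r f⟩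

section StoLemmas

variable (σ : Sto) (x y : Var) (r r' : Arr) (a b : ℕ) (f g : ℕ → ℕ)

@[simp] theorem Sto.set_val_self : (σ.set x a).val x = a := by simp [Sto.set]

@[simp] theorem Sto.set_val_of_ne (h : y ≠ x) : (σ.set x a).val y = σ.val y := by
  simp [Sto.set, h]

@[simp] theorem Sto.set_arr : (σ.set x a).arr = σ.arr := rfl

@[simp] theorem Sto.setArr_val : (σ.setArr r f).val = σ.val := rfl

@[simp] theorem Sto.setArr_arr_self : (σ.setArr r f).arr r = f := by simp [Sto.setArr]

@[simp] theorem Sto.setArr_arr_of_ne (h : r' ≠ r) : (σ.setArr r f).arr r' = σ.arr r' := by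
  simp [Sto.setArr, h]

end StoLemmas

/-- The length of the input is `m`. -/
def Expr.eval (m : ℕ) (σ : Sto) : Expr → ℕ
  | const c => c
  | len => m
  | var x => σ.val x
  | op o a b => o.eval (a.eval m σ) (b.eval m σ)
  | arr r i => σ.arr r (i.eval m σ)

section EvalLemmas

variable (m : ℕ) (σ : Sto) (a b : Expr) (c : ℕ) (x : Var) (r : Arr)

@[simp] theorem Expr.eval_two : (2 : Expr).eval m σ = 2 := rfl
@[simp] theorem Expr.eval_three : (3 : Expr).eval m σ = 3 := rfl
@[simp] theorem Expr.eval_four : (4 : Expr).eval m σ = 4 := rfl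
@[simp] theorem Expr.eval_zero : (0 : Expr).eval m σ = 0 := rfl
@[simp] theorem Expr.eval_one : (1 : Expr).eval m σ = 1 := rfl
@[simp] theorem Expr.eval_const : (Expr.const c).eval m σ = c := rfl
@[simp] theorem Expr.eval_len : Expr.len.eval m σ = m := rfl
@[simp] theorem Expr.eval_var : (Expr.var x).eval m σ = σ.val x := rfl
@[simp] theorem Expr.eval_add : (a + b).eval m σ = a.eval m σ + b.eval m σ := rfl
@[simp] theorem Expr.eval_sub : (a - b).eval m σ = a.eval m σ - b.eval m σ := rfl
@[simp] theorem Expr.eval_mul : (a * b).eval m σ = a.eval m σ * b.eval m σ := rfl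
@[simp] theorem Expr.eval_div : (a / b).eval m σ = a.eval m σ / b.eval m σ := rfl
@[simp] theorem Expr.eval_arr : (Expr.arr r a).eval m σ = σ.arr r (a.eval m σ) := rfl

end EvalLemmas

/-! ### Compilation and its correctness for expressions -/

/-- The value of the expression goes to register `d`, and registers from `d` on are used. -/
def Expr.compile : Expr → ℕ → Prog
  | const c, d => .const d c
  | len, d => .seq (.const d 0) (.op .add d 0 d)
  | var x, d => .seq (.const d 0) (.op .add d x.reg d)
  | op o a b, d => .seq (a.compile d) (.seq (b.compile (d + 1)) (.op o d d (d + 1)))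
  | arr r i, d => .seq (i.compile d) (.seq (.const (d + 1) 5) (.seq (.op .mul d d (d + 1))
      (.seq (.op .add d d 0) (.seq (.const (d + 1) r.offset) (.seq (.op .add d d (d + 1))
        (.load d d))))))

def Expr.steps : Expr → ℕ
  | const _ => 1
  | len => 2
  | var _ => 2
  | op _ a b => a.steps + (b.steps + 1)
  | arr _ i => i.steps + 6

/-- The numbers handled are bounded by this power of the bound on the variables. -/
def Expr.width : Expr → ℕ
  | const c => c + 1
  | len => 1
  | var _ => 1
  | op _ a b => a.width + b.width
  | arr _ i => i.width + 4

def Cmd.compile : Cmd → Prog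
  | assign x e => .seq (e.compile 22) (.seq (.const 23 0) (.op .add x.reg 22 23))
  | input x e => .seq (e.compile 22) (.load x.reg 22)
  | store r i e => .seq (e.compile 22) (.seq (i.compile 23) (.seq (.const 24 5)
      (.seq (.op .mul 23 23 24) (.seq (.op .add 23 23 0) (.seq (.const 24 r.offset)
        (.seq (.op .add 23 23 24) (.store 23 22)))))))
  | seq c d => .seq c.compile d.compile
  | ite e c d => .seq (e.compile 22) (.ite 22 c.compile d.compile)
  | loop e c => .seq (e.compile 22) (.loop 22 (.seq c.compile (e.compile 22)))

/-- The number of steps of a command without loops. -/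
def Cmd.steps : Cmd → ℕ
  | assign _ e => e.steps + 2
  | input _ e => e.steps + 1
  | store _ i e => e.steps + i.steps + 6
  | seq c d => c.steps + d.steps
  | ite e c d => e.steps + 1 + (c.steps + d.steps)
  | loop e _ => e.steps + 1

/-- It depends on the program text only. Thus the numbers handled have a constant factor more bits
than the bound on the variables. -/
def Cmd.width : Cmd → ℕ
  | assign _ e => e.width
  | input _ e => e.width
  | store _ i e => e.width + (i.width + 4)
  | seq c d => c.width + d.width
  | ite e c d => e.width + (c.width + d.width)
  | loop e c => e.width + c.width

theorem Expr.width_pos (e : Expr) : 0 < e.width := by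
  cases e with
  | op o a b => simp only [width]; have := a.width_pos; omega
  | _ => simp [width]

/-- The state `s` of the machine represents `σ`, on input `x`. -/
structure Rep (x : List ℕ) (σ : Sto) (s : State) : Prop where
  len : s.reg 0 = x.length
  val : ∀ y : Var, s.reg y.reg = σ.val y
  arr : ∀ (r : Arr) (i : ℕ), s.mem (x.length + 5 * i + r.offset) = σ.arr r i
  input : ∀ i < x.length, s.mem i = x.getD i 0

/-- All the numbers are bounded by `W`. -/
structure Bdd (x : List ℕ) (W : ℕ) (σ : Sto) : Prop where
  len : x.length ≤ W
  val : ∀ y, σ.val y ≤ W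
  arr : ∀ r i, σ.arr r i ≤ W
  input : ∀ i, x.getD i 0 ≤ W

theorem Rep.of_eq {x : List ℕ} {σ : Sto} {s t : State} (h : Rep x σ s) (hm : t.mem = s.mem)
    (hr : ∀ a < 22, t.reg a = s.reg a) : Rep x σ t :=
  ⟨by rw [hr 0 (by norm_num), h.len], fun y => by rw [hr _ y.reg_lt, h.val],
    fun r i => by rw [hm, h.arr], fun i hi => by rw [hm, h.input i hi]⟩

/-- Both powers are at least 2, so even the sum of the operands is at most the product of the
powers. -/
theorem Op.eval_le {o : Op} {a b W u v : ℕ} (ha : a ≤ (W + 2) ^ u) (hb : b ≤ (W + 2) ^ v)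
    (hu : 0 < u) (hv : 0 < v) : o.eval a b ≤ (W + 2) ^ (u + v) := by
  have h1 : 2 ≤ (W + 2) ^ u := (by omega : 2 ≤ W + 2).trans (Nat.le_self_pow hu.ne' _)
  have h2 : 2 ≤ (W + 2) ^ v := (by omega : 2 ≤ W + 2).trans (Nat.le_self_pow hv.ne' _)
  rw [pow_add]
  cases o with
  | add => simp only [Op.eval]; nlinarith
  | sub => simp only [Op.eval]; have := Nat.sub_le a b; nlinarith
  | mul => exact Nat.mul_le_mul ha hb
  | div => simp only [Op.eval]; have := Nat.div_le_self a b; nlinarith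

theorem pow_le_pow_width {W a b : ℕ} (h : a ≤ b) : (W + 2) ^ a ≤ (W + 2) ^ b :=
  Nat.pow_le_pow_right (by omega) h

theorem Expr.eval_le {x : List ℕ} {W : ℕ} {σ : Sto} (h : Bdd x W σ) (e : Expr) :
    e.eval x.length σ ≤ (W + 2) ^ e.width := by
  have h0 : ∀ {a}, a ≤ W → ∀ {w}, 0 < w → a ≤ (W + 2) ^ w := fun ha _ hw =>
    (by omega : _ ≤ W + 2).trans (Nat.le_self_pow hw.ne' _)
  induction e with
  | const c =>
    -- The base is at least 2 whatever `W` is, so the exponent `c + 1` is enough; the `+ 1` keeps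
    -- widths positive.
    exact (Nat.lt_two_pow_self (n := c)).le.trans
      ((Nat.pow_le_pow_right (by norm_num) c.le_succ).trans (Nat.pow_le_pow_left (by omega) _))
  | len => exact h0 h.len (by simp [width])
  | var y => exact h0 (h.val y) (by simp [width])
  | op o a b iha ihb => exact Op.eval_le iha ihb a.width_pos b.width_pos
  | arr r i _ => exact h0 (h.arr _ _) (by simp [width])

@[simp] theorem setReg_reg_self (s : State) (a b : ℕ) : (s.setReg a b).reg a = b := by
  simp [State.setReg]

theorem setReg_reg_of_ne (s : State) {a b c : ℕ} (h : c ≠ a) :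
    (s.setReg a b).reg c = s.reg c := by
  simp [State.setReg, h]

@[simp] theorem setReg_mem (s : State) (a b : ℕ) : (s.setReg a b).mem = s.mem := rfl

/-- The address is less than 16 times the larger of the index bound and the base, and four more
factors `W + 2 ≥ 2` pay for the 16. -/
theorem address_le {W w i m o : ℕ} (hi : i ≤ (W + 2) ^ w) (hw : 0 < w) (hm : m ≤ W) (ho : o < 5) :
    5 ≤ (W + 2) ^ (w + 4) ∧ i * 5 ≤ (W + 2) ^ (w + 4) ∧ i * 5 + m ≤ (W + 2) ^ (w + 4) ∧
      i * 5 + m + o ≤ (W + 2) ^ (w + 4) := by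
  have h1 : W + 2 ≤ (W + 2) ^ w := Nat.le_self_pow hw.ne' _
  have h2 : 2 ^ 4 ≤ (W + 2) ^ 4 := Nat.pow_le_pow_left (by omega) 4
  rw [pow_add]
  have h3 : (W + 2) ^ w * 2 ^ 4 ≤ (W + 2) ^ w * (W + 2) ^ 4 := Nat.mul_le_mul_left _ h2
  omega

/-- The evaluation leaves the memory and all registers below `d` alone. So the left operand in `d`
survives the evaluation of the right one in `d + 1`, and the variables and the length are never
touched. -/
theorem Expr.halts_compile {x : List ℕ} {W : ℕ} {σ : Sto} (hb : Bdd x W σ) (e : Expr) :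
    ∀ (s : State) (d : ℕ), Rep x σ s → 22 ≤ d →
      Halts (e.compile d) s e.steps ((W + 2) ^ e.width) fun t =>
        t.mem = s.mem ∧ (∀ a < d, t.reg a = s.reg a) ∧ t.reg d = e.eval x.length σ := by
  have hW : ∀ {a}, a ≤ W → ∀ {w}, 0 < w → a ≤ (W + 2) ^ w := fun ha _ hw =>
    (by omega : _ ≤ W + 2).trans (Nat.le_self_pow hw.ne' _)
  induction e with
  | const c =>
    intro s d hs hd
    exact .const ((Expr.const c).eval_le hb)
      ⟨rfl, fun a ha => setReg_reg_of_ne _ ha.ne, by simp⟩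
  | len =>
    intro s d hs hd
    refine Halts.seq (T := 1) (T' := 1) (.const (Nat.zero_le _) ?_)
    have h1 : (s.setReg d 0).reg 0 = x.length := by
      rw [setReg_reg_of_ne _ (by omega), hs.len]
    have := Expr.len.eval_le hb
    refine .op (by simpa [h1] using this) (by simp) (by simpa [h1, Op.eval] using this) ?_
    refine ⟨rfl, fun a ha => ?_, by simp [h1, Op.eval]⟩
    rw [setReg_reg_of_ne _ ha.ne, setReg_reg_of_ne _ ha.ne]
  | var y =>
    intro s d hs hd
    refine Halts.seq (T := 1) (T' := 1) (.const (Nat.zero_le _) ?_)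
    have h1 : (s.setReg d 0).reg y.reg = σ.val y := by
      rw [setReg_reg_of_ne _ (by have := y.reg_lt; omega), hs.val]
    have := (Expr.var y).eval_le hb
    refine .op (by simpa [h1] using this) (by simp) (by simpa [h1, Op.eval] using this) ?_
    refine ⟨rfl, fun a ha => ?_, by simp [h1, Op.eval]⟩
    rw [setReg_reg_of_ne _ ha.ne, setReg_reg_of_ne _ ha.ne]
  | op o a b iha ihb =>
    intro s d hs hd
    have ha0 := a.eval_le hb
    have hb0 := b.eval_le hb
    have hle := (Expr.op o a b).eval_le hb
    refine Halts.seq ((iha s d hs hd).mono le_rfl (pow_le_pow_width (by simp [width])) ?_)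
    rintro s1 ⟨hm1, hr1, hv1⟩
    have hs1 : Rep x σ s1 := hs.of_eq hm1 fun a ha => hr1 a (by omega)
    refine Halts.seq ((ihb s1 (d + 1) hs1 (by omega)).mono le_rfl
      (pow_le_pow_width (by simp [width])) ?_)
    rintro s2 ⟨hm2, hr2, hv2⟩
    have hv2' : s2.reg d = a.eval x.length σ := by rw [hr2 d (by omega), hv1]
    refine .op ?_ ?_ ?_ ⟨by simp [hm1, hm2], fun c hc => ?_, by
      rw [setReg_reg_self, hv2, hv2']; rfl⟩
    · rw [hv2']; exact ha0.trans (pow_le_pow_width (by simp [width]))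
    · rw [hv2]; exact hb0.trans (pow_le_pow_width (by simp [width]))
    · rw [hv2, hv2']; exact hle
    · rw [setReg_reg_of_ne _ hc.ne, hr2 c (by omega), hr1 c hc]
  | arr r i ih =>
    intro s d hs hd
    obtain ⟨h1, h2, h3, h4⟩ := address_le (i.eval_le hb) i.width_pos hb.len r.offset_lt
    refine Halts.seq (T' := 6) ((ih s d hs hd).mono le_rfl (pow_le_pow_width (by simp [width])) ?_)
    rintro s1 ⟨hm1, hr1, hv1⟩
    have hl : s1.reg 0 = x.length := by rw [hr1 0 (by omega), hs.len]
    have hi := i.eval_le hb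
    have hi' := hi.trans (pow_le_pow_width (W := W) (show i.width ≤ i.width + 4 by omega))
    have hmem : s1.mem (i.eval x.length σ * 5 + x.length + r.offset) =
        σ.arr r (i.eval x.length σ) := by
      rw [hm1, ← hs.arr]; congr 1; ring
    have hB := hW (hb.arr r (i.eval x.length σ)) (show 0 < i.width + 4 by omega)
    have n1 : d ≠ d + 1 := by omega
    have n2 : d + 1 ≠ d := by omega
    have n3 : 0 ≠ d := by omega
    have n4 : 0 ≠ d + 1 := by omega
    simp only [width]
    generalize (W + 2) ^ (i.width + 4) = B at *
    refine Halts.seq (T := 1) (T' := 5) (.const h1 ?_)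
    refine Halts.seq (T := 1) (T' := 4) (.op ?_ ?_ ?_ ?_)
    · simpa [setReg_reg_of_ne, n1, hv1] using hi'
    · simpa using h1
    · simpa [setReg_reg_of_ne, n1, hv1, Op.eval] using h2
    refine Halts.seq (T := 1) (T' := 3) (.op ?_ ?_ ?_ ?_)
    · simpa [setReg_reg_of_ne, n1, hv1, Op.eval] using h2
    · simp [setReg_reg_of_ne, n3, hl]; omega
    · simpa [setReg_reg_of_ne, n1, n3, n4, hl, hv1, Op.eval] using h3
    refine Halts.seq (T := 1) (T' := 2) (.const (by omega) ?_)
    refine Halts.seq (T := 1) (T' := 1) (.op ?_ ?_ ?_ ?_)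
    · simpa [setReg_reg_of_ne, n1, n3, n4, hl, hv1, Op.eval] using h3
    · simp; omega
    · simpa [setReg_reg_of_ne, n1, n3, n4, hl, hv1, Op.eval] using h4
    refine .load ?_ ?_ ⟨?_, fun c hc => ?_, ?_⟩
    · simpa [setReg_reg_of_ne, n1, n3, n4, hl, hv1, Op.eval] using h4
    · simpa [setReg_reg_of_ne, n1, n3, n4, hl, hv1, Op.eval, hmem] using hB
    · simpa using hm1
    · simp [setReg_reg_of_ne, hc.ne, show c ≠ d + 1 by omega, hr1 c hc]
    · simpa [setReg_reg_of_ne, n1, n3, n4, hl, hv1, Op.eval] using hmem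

/-! ### Rules for commands, with bounds on steps and numbers -/

/-- In the state `σ`, on input `x`, the command halts in at most `T` steps in a state that
satisfies `Q`, provided that `W` bounds the numbers in `σ`; and then it also bounds those in the
final state. -/
def Runs (x : List ℕ) (W : ℕ) (c : Cmd) (σ : Sto) (T : ℕ) (Q : Sto → Prop) : Prop :=
  Bdd x W σ → ∀ s, Rep x σ s → Halts c.compile s T ((W + 2) ^ c.width) fun t =>
    ∃ τ, Rep x τ t ∧ Bdd x W τ ∧ Q τ

namespace Runs

variable {x : List ℕ} {W T T' : ℕ} {c d : Cmd} {σ : Sto} {Q Q' : Sto → Prop} {e i : Expr}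

theorem mono (h : Runs x W c σ T Q) (hT : T ≤ T') (hQ : ∀ τ, Q τ → Q' τ) :
    Runs x W c σ T' Q' := fun hb s hs =>
  (h hb s hs).mono hT le_rfl fun _ ⟨τ, h1, h2, h3⟩ => ⟨τ, h1, h2, hQ τ h3⟩

theorem of_bdd (h : Bdd x W σ → Runs x W c σ T Q) : Runs x W c σ T Q := fun hb => h hb hb

theorem seq (h : Runs x W c σ T fun τ => Runs x W d τ T' Q) :
    Runs x W (c ⨾ d) σ (T + T') Q := fun hb s hs =>
  .seq ((h hb s hs).mono le_rfl (pow_le_pow_width (by simp [Cmd.width])) fun t ⟨τ, h1, h2, h3⟩ =>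
    (h3 h2 t h1).mono le_rfl (pow_le_pow_width (by simp [Cmd.width])) fun _ h => h)

theorem bdd_set (hb : Bdd x W σ) {y : Var} {a : ℕ} (ha : a ≤ W) : Bdd x W (σ.set y a) :=
  ⟨hb.len, fun z => by
    by_cases h : z = y
    · subst h; simpa using ha
    · simpa [h] using hb.val z, hb.arr, hb.input⟩

theorem rep_set {s : State} (hs : Rep x σ s) {y : Var} {a : ℕ} :
    Rep x (σ.set y a) (s.setReg y.reg a) := by
  refine ⟨?_, fun z => ?_, hs.arr, hs.input⟩
  · rw [setReg_reg_of_ne _ y.reg_pos.ne, hs.len]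
  · by_cases h : z = y
    · subst h; simp
    · rw [setReg_reg_of_ne _ (fun h' => h (Var.reg_injective h')), hs.val]; simp [h]

theorem assign {y : Var} (he : e.eval x.length σ ≤ W) (hQ : Q (σ.set y (e.eval x.length σ))) :
    Runs x W (y ≔ e) σ (e.steps + 2) Q := fun hb s hs => by
  refine .seq ((e.halts_compile hb s 22 hs le_rfl).mono le_rfl le_rfl ?_)
  rintro s1 ⟨hm1, hr1, hv1⟩
  have hs1 := hs.of_eq hm1 hr1
  have hle := e.eval_le hb
  refine Halts.seq (T := 1) (T' := 1) (.const (Nat.zero_le _) ?_)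
  have h22 : (s1.setReg 23 0).reg 22 = e.eval x.length σ := by
    rw [setReg_reg_of_ne _ (by omega), hv1]
  refine .op ?_ ?_ ?_ ⟨_, ?_, bdd_set hb he, hQ⟩
  · rw [h22]; exact hle
  · simp
  · rw [h22]; simpa [Op.eval, Cmd.width] using hle
  · rw [h22, setReg_reg_self]
    exact rep_set (s := s1.setReg 23 0) (hs1.of_eq rfl fun a (ha : a < 22) =>
      setReg_reg_of_ne s1 (show a ≠ 23 by omega))

theorem input {y : Var} (he : e.eval x.length σ < x.length)
    (hQ : Q (σ.set y (x.getD (e.eval x.length σ) 0))) :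
    Runs x W (.input y e) σ (e.steps + 1) Q := fun hb s hs => by
  refine .seq ((e.halts_compile hb s 22 hs le_rfl).mono le_rfl le_rfl ?_)
  rintro s1 ⟨hm1, hr1, hv1⟩
  have hs1 := hs.of_eq hm1 hr1
  refine .load ?_ ?_ ⟨_, ?_, bdd_set hb (hb.input _), hQ⟩
  · rw [hv1]; exact e.eval_le hb
  · rw [hv1, hs1.input _ he]
    exact (by have := hb.input (e.eval x.length σ); omega : _ ≤ W + 2).trans
      (Nat.le_self_pow e.width_pos.ne' _)
  · rw [hv1, hs1.input _ he]
    exact rep_set hs1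

theorem store {r : Arr} (he : e.eval x.length σ ≤ W)
    (hQ : Q (σ.setArr r
      (Function.update (σ.arr r) (i.eval x.length σ) (e.eval x.length σ)))) :
    Runs x W (.store r i e) σ (e.steps + i.steps + 6) Q := fun hb s hs => by
  obtain ⟨h1, h2, h3, h4⟩ := address_le (i.eval_le hb) i.width_pos hb.len r.offset_lt
  have hi' := (i.eval_le hb).trans
    (pow_le_pow_width (W := W) (show i.width ≤ i.width + 4 by omega))
  have hB : (W + 2) ^ (i.width + 4) ≤ (W + 2) ^ (e.width + (i.width + 4)) :=
    pow_le_pow_width (by omega)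
  have hB' : (W + 2) ^ e.width ≤ (W + 2) ^ (e.width + (i.width + 4)) :=
    pow_le_pow_width (by omega)
  have hi0 := i.halts_compile hb
  have hev := e.eval_le hb
  have hl0 := hb.len
  have hWp : W + 2 ≤ (W + 2) ^ (e.width + (i.width + 4)) := Nat.le_self_pow (by omega) _
  simp only [Cmd.width]
  generalize hBB : (W + 2) ^ (e.width + (i.width + 4)) = B at *
  rw [add_assoc]
  refine .seq ((e.halts_compile hb s 22 hs le_rfl).mono le_rfl hB' ?_)
  rintro s1 ⟨hm1, hr1, hv1⟩
  have hs1 := hs.of_eq hm1 hr1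
  refine .seq ((hi0 s1 23 hs1 (by norm_num)).mono le_rfl
    ((pow_le_pow_width (by omega)).trans hB) ?_)
  rintro s2 ⟨hm2, hr2, hv2⟩
  have hs2 := hs1.of_eq hm2 fun a ha => hr2 a (by omega)
  have hl := hs2.len
  have hv22 : s2.reg 22 = e.eval x.length σ := by rw [hr2 22 (by omega), hv1]
  generalize hE : e.eval x.length σ = E at *
  generalize hI : i.eval x.length σ = J at *
  -- Addresses of different arrays differ modulo 5, those of one array differ with the index, and
  -- all lie behind the input; one write therefore changes one entry only.
  have fin : Rep x (σ.setArr r (Function.update (σ.arr r) J E))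
      (s2.setMem (J * 5 + x.length + r.offset) E) := by
    refine ⟨hs2.len, hs2.val, fun r' j => ?_, fun j hj => ?_⟩
    · simp only [State.setMem]
      have ho := r.offset_lt
      have ho' := r'.offset_lt
      by_cases h : r' = r
      · subst h
        by_cases hj : j = J
        · subst hj
          rw [show x.length + 5 * j + r'.offset = j * 5 + x.length + r'.offset by ring]
          simp
        · rw [Function.update_of_ne (by omega)]
          simpa [hj] using hs2.arr r' j
      · have : r'.offset ≠ r.offset := fun h' => h (Arr.offset_injective h')
        rw [Function.update_of_ne (by omega)]
        simpa [h] using hs2.arr r' j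
    · simp only [State.setMem]
      rw [Function.update_of_ne (by omega)]
      exact hs2.input j hj
  refine Halts.seq (T := 1) (T' := 5) (.const (by omega) ?_)
  refine Halts.seq (T := 1) (T' := 4) (.op ?_ ?_ ?_ ?_)
  · rw [setReg_reg_of_ne _ (by omega), hv2]; omega
  · rw [setReg_reg_self]; omega
  · rw [setReg_reg_of_ne _ (by omega), hv2, setReg_reg_self]; simp only [Op.eval]; omega
  refine Halts.seq (T := 1) (T' := 3) (.op ?_ ?_ ?_ ?_)
  · simp [setReg_reg_of_ne, hv2, Op.eval]; omega
  · simp [setReg_reg_of_ne, hl]; omega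
  · simp [setReg_reg_of_ne, hv2, hl, Op.eval]; omega
  refine Halts.seq (T := 1) (T' := 2) (.const (by have := r.offset_lt; omega) ?_)
  refine Halts.seq (T := 1) (T' := 1) (.op ?_ ?_ ?_ ?_)
  · simp [setReg_reg_of_ne, hv2, hl, Op.eval]; omega
  · simp; omega
  · simp [setReg_reg_of_ne, hv2, hl, Op.eval]; omega
  refine .store ?_ ?_ ⟨_, ?_, ?_, hQ⟩
  · simp [setReg_reg_of_ne, hv2, hl, Op.eval]; omega
  · simp [setReg_reg_of_ne, hv22]; omega
  · simp only [setReg_reg_of_ne, hv2, hl, hv22, Op.eval, setReg_reg_self, ne_eq, Nat.reduceEqDiff,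
      not_false_eq_true, OfNat.zero_ne_ofNat]
    exact fin.of_eq rfl fun a ha => by simp [State.setMem, State.setReg, Function.update,
      show a ≠ 23 by omega, show a ≠ 24 by omega]
  · refine ⟨hb.len, hb.val, fun r' j => ?_, hb.input⟩
    by_cases h : r' = r
    · subst h
      by_cases hj : j = J
      · subst hj; simpa using he
      · simpa [hj] using hb.arr r' j
    · simpa [h] using hb.arr r' j

theorem ite (h : e.eval x.length σ ≠ 0 → Runs x W c σ T Q)
    (h' : e.eval x.length σ = 0 → Runs x W d σ T Q) :
    Runs x W (.ite e c d) σ (e.steps + (T + 1)) Q := fun hb s hs => by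
  refine .seq ((e.halts_compile hb s 22 hs le_rfl).mono le_rfl
    (pow_le_pow_width (by simp [Cmd.width])) ?_)
  rintro s1 ⟨hm1, hr1, hv1⟩
  have hs1 := hs.of_eq hm1 hr1
  refine .ite ?_ (fun h0 => ?_) fun h0 => ?_
  · rw [hv1]; exact (e.eval_le hb).trans (pow_le_pow_width (by simp [Cmd.width]))
  · exact (h (hv1 ▸ h0) hb s1 hs1).mono le_rfl
      (pow_le_pow_width (by simp only [Cmd.width]; omega)) fun _ h => h
  · exact (h' (hv1 ▸ h0) hb s1 hs1).mono le_rfl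
      (pow_le_pow_width (by simp only [Cmd.width]; omega)) fun _ h => h

/-- A loop with the invariant `I`, whose iteration number `i < m` takes at most `f i` steps. -/
theorem loop (I : ℕ → Sto → Prop) (m : ℕ) (f : ℕ → ℕ) (h0 : I 0 σ)
    (hstep : ∀ i σ, I i σ → (e.eval x.length σ = 0 ∧ Q σ) ∨
      (e.eval x.length σ ≠ 0 ∧ i < m ∧ Runs x W c σ (f i) (I (i + 1)))) :
    Runs x W (.loop e c) σ (∑ i ∈ Finset.range m, (f i + e.steps + 1) + e.steps + 1) Q := by
  intro hb s hs
  have hwe : (W + 2) ^ e.width ≤ (W + 2) ^ (Cmd.loop e c).width :=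
    pow_le_pow_width (by simp [Cmd.width])
  have hwc : (W + 2) ^ c.width ≤ (W + 2) ^ (Cmd.loop e c).width :=
    pow_le_pow_width (by simp [Cmd.width])
  -- Induction on the number `r` of rounds that are still allowed. Register 22 holds the value of
  -- the condition at each test, since the compiled body ends by evaluating it again.
  have key : ∀ r i, r + i = m → ∀ (σ : Sto) (s : State), I i σ → Bdd x W σ → Rep x σ s →
      s.reg 22 = e.eval x.length σ →
      Halts (.loop 22 (.seq c.compile (e.compile 22))) s
        (∑ l ∈ Finset.range r, (f (i + l) + e.steps + 1) + 1) ((W + 2) ^ (Cmd.loop e c).width)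
        fun t => ∃ τ, Rep x τ t ∧ Bdd x W τ ∧ Q τ := by
    intro r
    induction r with
    | zero =>
      intro i hi σ s hI hb hs h22
      rcases hstep i σ hI with ⟨h, hQ⟩ | ⟨_, h, _⟩
      · simpa using Halts.loop_zero (h22.trans h) ⟨σ, hs, hb, hQ⟩
      · omega
    | succ r ih =>
      intro i hi σ s hI hb hs h22
      rcases hstep i σ hI with ⟨h, hQ⟩ | ⟨h, _, hR⟩
      · exact (Halts.loop_zero (h22.trans h) ⟨σ, hs, hb, hQ⟩).mono (by omega) le_rfl fun _ h => h
      · rw [Finset.sum_range_succ']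
        have : ∀ A : ℕ, A + (f (i + 0) + e.steps + 1) + 1 = (f i + e.steps) + (A + 1) + 1 := by
          intro A; simp only [add_zero]; omega
        rw [this]
        refine .loop_step (h22 ▸ h) (h22 ▸ (e.eval_le hb).trans hwe) (.seq ?_)
        refine (hR hb s hs).mono le_rfl hwc ?_
        rintro t ⟨τ, ht, hbτ, hIτ⟩
        refine (e.halts_compile hbτ t 22 ht le_rfl).mono le_rfl hwe ?_
        rintro t' ⟨hm, hr, hv⟩
        have := ih (i + 1) (by omega) τ t' hIτ hbτ (ht.of_eq hm hr) hv
        simpa only [add_assoc, add_comm 1] using this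
  have : ∀ A : ℕ, A + e.steps + 1 = e.steps + (A + 1) := by intro A; omega
  rw [this]
  refine .seq ((e.halts_compile hb s 22 hs le_rfl).mono le_rfl hwe ?_)
  rintro s1 ⟨hm1, hr1, hv1⟩
  have := key m 0 (by omega) σ s1 h0 hb (hs.of_eq hm1 hr1) hv1
  simpa only [zero_add] using this

theorem loop_const (I : ℕ → Sto → Prop) (m N : ℕ) (h0 : I 0 σ)
    (hstep : ∀ i σ, I i σ → (e.eval x.length σ = 0 ∧ Q σ) ∨
      (e.eval x.length σ ≠ 0 ∧ i < m ∧ Runs x W c σ N (I (i + 1)))) :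
    Runs x W (.loop e c) σ (m * (N + e.steps + 1) + e.steps + 1) Q := by
  simpa using loop I m (fun _ => N) h0 hstep

end Runs

/-- The weakest precondition of a command without loops. -/
def Cmd.wp (x : List ℕ) (W : ℕ) : Cmd → (Sto → Prop) → Sto → Prop
  | assign y e, Q, σ => e.eval x.length σ ≤ W ∧ Q (σ.set y (e.eval x.length σ))
  | input y e, Q, σ => e.eval x.length σ < x.length ∧ Q (σ.set y (x.getD (e.eval x.length σ) 0))
  | store r i e, Q, σ => e.eval x.length σ ≤ W ∧
      Q (σ.setArr r (Function.update (σ.arr r) (i.eval x.length σ) (e.eval x.length σ)))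
  | seq c d, Q, σ => c.wp x W (d.wp x W Q) σ
  | ite e c d, Q, σ => (e.eval x.length σ ≠ 0 → c.wp x W Q σ) ∧
      (e.eval x.length σ = 0 → d.wp x W Q σ)
  | loop _ _, _, _ => False

theorem Runs.of_wp {x : List ℕ} {W : ℕ} {c : Cmd} {σ : Sto} {Q : Sto → Prop}
    (h : c.wp x W Q σ) : Runs x W c σ c.steps Q := by
  induction c generalizing σ Q with
  | assign y e => exact .assign h.1 h.2
  | input y e => exact .input h.1 h.2
  | store r i e => exact .store h.1 h.2
  | seq c d ihc ihd => exact .seq ((ihc h).mono le_rfl fun τ => ihd)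
  | ite e c d ihc ihd =>
    refine (Runs.ite (T := c.steps + d.steps) (fun h0 => (ihc (h.1 h0)).mono (by omega) fun _ => id)
      fun h0 => (ihd (h.2 h0)).mono (by omega) fun _ => id).mono ?_ fun _ => id
    simp only [Cmd.steps]; omega
  | loop => exact h.elim

end Sched

/-! ### The greedy algorithm for a guess -/

namespace Sched

/-- The total processing time of a list of jobs. -/
def total {α : Type*} (p : α → ℕ) (L : List α) : ℕ := (L.map p).sum

@[simp] theorem total_nil {α : Type*} (p : α → ℕ) : total p [] = 0 := rfl

@[simp] theorem total_cons {α : Type*} (p : α → ℕ) (a : α) (L : List α) :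
    total p (a :: L) = p a + total p L := by simp [total]

@[simp] theorem total_append {α : Type*} (p : α → ℕ) (L L' : List α) :
    total p (L ++ L') = total p L + total p L' := by simp [total]

/-- The data of the jobs: agent 1 has `n` jobs, in the order of their due dates. -/
structure Data where
  n : ℕ
  sp : ℕ → ℕ
  sd : ℕ → ℕ
  p₂ : ℕ → ℕ
  w₂ : ℕ → ℕ

namespace Data

variable (D : Data)

/-- The processing times of the jobs of both agents. -/
def p : ℕ ⊕ ℕ → ℕ := Sum.elim D.sp D.p₂

@[simp] theorem p_inl (x : ℕ) : D.p (Sum.inl x) = D.sp x := rfl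
@[simp] theorem p_inr (x : ℕ) : D.p (Sum.inr x) = D.p₂ x := rfl

/-- If the jobs of the list are processed without pauses, the last one in the list first, no job
of agent 1 is tardy. -/
def InTime : List (ℕ ⊕ ℕ) → Prop
  | [] => True
  | .inl x :: L => InTime L ∧ D.sp x + total D.p L ≤ D.sd x
  | .inr _ :: L => InTime L

/-- The weighted sum of the completion times of agent 2 when the jobs of the list are processed
without pauses, the last one in the list first. -/
def weighted : List (ℕ ⊕ ℕ) → ℕ
  | [] => 0
  | .inl _ :: L => weighted L
  | .inr j :: L => weighted L + D.w₂ j * (D.p₂ j + total D.p L)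

theorem weighted_map_inl_append (l : List ℕ) (L : List (ℕ ⊕ ℕ)) :
    D.weighted (l.map Sum.inl ++ L) = D.weighted L := by
  induction l with
  | nil => rfl
  | cons a l ih => exact ih

theorem total_map_inl (l : List ℕ) : total D.p (l.map Sum.inl) = (l.map D.sp).sum := by
  induction l with
  | nil => rfl
  | cons a l ih => simp [ih]

/-- When jobs are dropped, the remaining ones only start earlier. -/
theorem InTime.of_sublist {l l' : List ℕ} {L : List (ℕ ⊕ ℕ)} (h : l'.Sublist l)
    (hl : D.InTime (l.map Sum.inl ++ L)) : D.InTime (l'.map Sum.inl ++ L) := by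
  induction h with
  | slnil => exact hl
  | cons a _ ih => exact ih hl.1
  | @cons_cons l₁ l₂ a hs ih =>
    refine ⟨ih hl.1, le_trans ?_ hl.2⟩
    have := (hs.map D.sp).sum_le_sum (by simp)
    change D.sp a + total D.p (l₁.map Sum.inl ++ L) ≤ D.sp a + total D.p (l₂.map Sum.inl ++ L)
    simp only [total_append, total_map_inl]
    omega

end Data

/-- The state of the greedy algorithm: the time, the weighted sum of completion times, the number
of jobs of agent 1 in time, the number of jobs of agent 2 so far, the next job of agent 1, and the
processing times of the selected jobs of agent 1 since the last job of agent 2. -/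
structure SimState where
  t : ℕ
  cost : ℕ
  tot : ℕ
  q : ℕ
  i : ℕ
  S : Multiset ℕ

/-- The content `z` of a slot stands for the job `z - 1` of agent 2 or, if `z = 0`, for the next
job of agent 1. Between two jobs of agent 2 this is the algorithm of Moore and Hodgson, with at
most `cap q` selected jobs. -/
def simStep (D : Data) (cap : ℕ → ℕ) (z : ℕ) (a : SimState) : SimState :=
  if z ≠ 0 then
    ⟨a.t + D.p₂ (z - 1), a.cost + D.w₂ (z - 1) * (a.t + D.p₂ (z - 1)), a.tot, a.q + 1, a.i, 0⟩
  else if a.i < D.n then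
    if a.t + D.sp a.i ≤ D.sd a.i ∧ a.S.card + 1 ≤ cap a.q then
      ⟨a.t + D.sp a.i, a.cost, a.tot + 1, a.q, a.i + 1, D.sp a.i ::ₘ a.S⟩
    else
      ⟨a.t + D.sp a.i - (D.sp a.i ::ₘ a.S).sup, a.cost, a.tot, a.q, a.i + 1,
        (D.sp a.i ::ₘ a.S).erase (D.sp a.i ::ₘ a.S).sup⟩
  else a

def sim (D : Data) (slot cap : ℕ → ℕ) : ℕ → SimState
  | 0 => ⟨0, 0, 0, 0, 0, 0⟩
  | s + 1 => simStep D cap (slot s) (sim D slot cap s)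

/-- The supremum is attained, so `erase` in `simStep` really removes a job. -/
theorem sup_mem_cons (a : ℕ) (S : Multiset ℕ) : (a ::ₘ S).sup ∈ a ::ₘ S := by
  induction S using Multiset.induction with
  | empty => simp
  | cons b S ih =>
    rw [Multiset.cons_swap, Multiset.sup_cons]
    rcases le_total (a ::ₘ S).sup b with h | h
    · rw [sup_eq_left.2 h]; exact Multiset.mem_cons_self _ _
    · rw [sup_eq_right.2 h]; exact Multiset.mem_cons_of_mem ih

/-- What the greedy algorithm selects is in time. -/
structure SimSound (D : Data) (slot : ℕ → ℕ) (s : ℕ) (a : SimState) (l : List ℕ)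
    (L : List (ℕ ⊕ ℕ)) : Prop where
  inTime : D.InTime (l.map Sum.inl ++ L)
  t_eq : total D.p (l.map Sum.inl ++ L) = a.t
  cost_eq : D.weighted L = a.cost
  nodup : (l.map Sum.inl ++ L).Nodup
  lt : ∀ x, Sum.inl x ∈ l.map Sum.inl ++ L → x < a.i
  i_le : a.i ≤ D.n
  S_eq : (l.map D.sp : Multiset ℕ) = a.S
  tot_eq : (l.map Sum.inl ++ L).countP Sum.isLeft = a.tot
  q_eq : L.countP Sum.isRight = a.q
  inr : ∀ j, Sum.inr j ∈ L → ∃ s' < s, slot s' = j + 1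

theorem countP_isLeft_map_inl (l : List ℕ) :
    (l.map (Sum.inl : ℕ → ℕ ⊕ ℕ)).countP Sum.isLeft = l.length := by
  rw [List.countP_eq_length.2 (by simp), List.length_map]

theorem countP_isRight_map_inl (l : List ℕ) :
    (l.map (Sum.inl : ℕ → ℕ ⊕ ℕ)).countP Sum.isRight = 0 := by
  rw [List.countP_eq_zero]; simp

/-- The list `l` holds the selected jobs of the current block and `L` all that is processed up to
the last job of agent 2. Discarding affects `l` only, so the accumulated cost of agent 2 remains
correct. Nothing is assumed about the caps: they matter for optimality, not for soundness. -/
theorem sim_sound {D : Data} {slot cap : ℕ → ℕ} (hsd : ∀ x y, x ≤ y → y < D.n → D.sd x ≤ D.sd y)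
    (hslot : ∀ s s', slot s ≠ 0 → slot s = slot s' → s = s') (s : ℕ) :
    ∃ l L, SimSound D slot s (sim D slot cap s) l L := by
  induction s with
  | zero => exact ⟨[], [], by constructor <;> simp [sim, Data.InTime, Data.weighted]⟩
  | succ s ih =>
    obtain ⟨l, L, h⟩ := ih
    rw [sim]
    generalize ha : sim D slot cap s = a at *
    unfold simStep
    split_ifs with hz hi hc
    · obtain ⟨j, hj⟩ : ∃ j, slot s = j + 1 := ⟨slot s - 1, by omega⟩
      refine ⟨[], Sum.inr j :: (l.map Sum.inl ++ L), ?_⟩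
      -- A job of agent 2 occurs in one slot only, so it has not been processed before.
      have hnot : Sum.inr j ∉ l.map Sum.inl ++ L := by
        intro hm
        obtain ⟨s', hs', hs''⟩ := h.inr j (by simpa using hm)
        have := hslot s s' hz (by omega)
        omega
      refine ⟨h.inTime, ?_, ?_, ?_, ?_, h.i_le, by simp, ?_, ?_, ?_⟩
      · simp only [List.map_nil, List.nil_append, total_cons, Data.p_inr, h.t_eq, hj]
        simp [add_comm]
      · simp only [Data.weighted, Data.weighted_map_inl_append, h.cost_eq, h.t_eq, hj]
        simp [add_comm]
      · exact List.nodup_cons.2 ⟨hnot, h.nodup⟩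
      · intro x hx; exact h.lt x (by simpa using hx)
      · simpa using h.tot_eq
      · simp only [List.countP_cons, List.countP_append, countP_isRight_map_inl, h.q_eq]
        simp
      · intro j' hj'
        rcases List.mem_cons.1 hj' with hh | hh
        · cases hh; exact ⟨s, by omega, hj⟩
        · obtain ⟨s', h1, h2⟩ := h.inr j' (by simpa using hh)
          exact ⟨s', by omega, h2⟩
    · refine ⟨a.i :: l, L, ?_⟩
      have hnot : Sum.inl a.i ∉ l.map Sum.inl ++ L := fun hm => (h.lt _ hm).ne rfl
      refine ⟨⟨h.inTime, ?_⟩, ?_, h.cost_eq, ?_, ?_, hi, ?_, ?_, h.q_eq, ?_⟩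
      · change D.sp a.i + total D.p (l.map Sum.inl ++ L) ≤ _
        rw [h.t_eq]; omega
      · simp only [List.map_cons, List.cons_append, total_cons, h.t_eq, Data.p_inl, add_comm]
      · exact List.nodup_cons.2 ⟨hnot, h.nodup⟩
      · intro x hx
        rcases List.mem_cons.1 hx with hh | hh
        · cases hh; simp
        · exact (h.lt x hh).trans (by simp)
      · simp [← h.S_eq]
      · simp only [List.map_cons, List.cons_append, List.countP_cons, h.tot_eq]
        simp
      · intro j hj
        obtain ⟨s', h1, h2⟩ := h.inr j hj
        exact ⟨s', by omega, h2⟩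
    · have hinr : ∀ j, Sum.inr j ∈ L → ∃ s' < s + 1, slot s' = j + 1 := fun j hj => by
        obtain ⟨s', h1, h2⟩ := h.inr j hj
        exact ⟨s', by omega, h2⟩
      -- If the new job has the maximal length, it counts as the discarded one and the selection is
      -- unchanged; otherwise a longer job `b` of the block makes room for it.
      by_cases hm : (D.sp a.i ::ₘ a.S).sup = D.sp a.i
      · refine ⟨l, L, h.inTime, ?_, h.cost_eq, h.nodup, fun x hx => (h.lt x hx).trans (by simp),
          hi, ?_, h.tot_eq, h.q_eq, hinr⟩
        · simp [hm, h.t_eq]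
        · simp only [hm]; simp [h.S_eq]
      · have hmem := sup_mem_cons (D.sp a.i) a.S
        have hle : D.sp a.i ≤ (D.sp a.i ::ₘ a.S).sup := Multiset.le_sup (by simp)
        generalize hM : (D.sp a.i ::ₘ a.S).sup = M at *
        have hmem' : M ∈ l.map D.sp := by
          rcases Multiset.mem_cons.1 hmem with hh | hh
          · exact absurd hh hm
          · rw [← h.S_eq] at hh; simpa using hh
        obtain ⟨b, hb, hbM⟩ := List.mem_map.1 hmem'
        have hsum : (l.map D.sp).sum = M + ((l.erase b).map D.sp).sum := by
          rw [← hbM, ← List.sum_cons, ← List.map_cons]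
          exact ((List.perm_cons_erase hb).map _).sum_eq
        have ht : a.t = M + (((l.erase b).map D.sp).sum + total D.p L) := by
          rw [← h.t_eq, total_append, Data.total_map_inl, hsum, add_assoc]
        -- The job selected last ends at `a.t`, in time, and has no later due date than the new job.
        -- Exchanging a longer job for the new one ends no later than `a.t`.
        have hsd' : a.t ≤ D.sd a.i := by
          cases hl : l with
          | nil => simp [hl] at hb
          | cons y l' =>
            have h1 := h.inTime
            have h2 := h.t_eq
            have h3 := h.lt
            simp only [hl, List.map_cons, List.cons_append, Data.InTime, total_cons,
              Data.p_inl] at h1 h2 h3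
            have := hsd y a.i (h3 y (by simp)).le hi
            omega
        refine ⟨a.i :: l.erase b, L, ⟨⟨h.inTime.of_sublist D List.erase_sublist, ?_⟩, ?_,
          h.cost_eq, ?_, ?_, hi, ?_, ?_, h.q_eq, hinr⟩⟩
        · change D.sp a.i + total D.p ((l.erase b).map Sum.inl ++ L) ≤ _
          rw [total_append, Data.total_map_inl]; omega
        · simp only [List.map_cons, List.cons_append, total_cons, total_append, Data.total_map_inl,
            Data.p_inl]
          omega
        · refine List.nodup_cons.2 ⟨fun hx => (h.lt _ ?_).ne rfl, h.nodup.sublist ?_⟩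
          · exact ((List.erase_sublist.map _).append_right _).subset hx
          · exact (List.erase_sublist.map _).append_right _
        · intro x hx
          rcases List.mem_cons.1 hx with hh | hh
          · cases hh; simp
          · exact (h.lt x (((List.erase_sublist.map _).append_right _).subset hh)).trans (by simp)
        · have e : (↑(l.map D.sp) : Multiset ℕ) = M ::ₘ ↑((l.erase b).map D.sp) := by
            rw [Multiset.cons_coe, ← hbM, ← List.map_cons]
            exact Multiset.coe_eq_coe.2 ((List.perm_cons_erase hb).map _)
          simp only [← h.S_eq, e]
          rw [Multiset.cons_swap, Multiset.erase_cons_head]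
          rfl
        · have h1 := h.tot_eq
          have h2 := List.length_erase_of_mem hb
          have h3 := List.length_pos_of_mem hb
          simp only [List.countP_append, countP_isLeft_map_inl, List.length_cons] at h1 ⊢
          omega
    · exact ⟨l, L, h.inTime, h.t_eq, h.cost_eq, h.nodup, h.lt, h.i_le, h.S_eq, h.tot_eq, h.q_eq,
        fun j hj => by
          obtain ⟨s', h1, h2⟩ := h.inr j hj
          exact ⟨s', by omega, h2⟩⟩

/-! ### The greedy algorithm is optimal -/

/-- The list of the jobs that have been processed after some slots, when exactly the jobs in `E` of
agent 1 are processed; those since the last job of agent 2 are in `cur`. -/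
structure Run where
  cur : List ℕ
  old : List (ℕ ⊕ ℕ)
  i : ℕ
  q : ℕ

def Run.all (r : Run) : List (ℕ ⊕ ℕ) := r.cur.map Sum.inl ++ r.old

-- The competitor of the greedy algorithm, with the same slots. The index advances past jobs outside
-- `E` too, so both sides always look at the same job.
open Classical in
noncomputable def run (E : Set ℕ) (slot : ℕ → ℕ) : ℕ → Run
  | 0 => ⟨[], [], 0, 0⟩
  | s + 1 =>
    let r := run E slot s
    if slot s ≠ 0 then ⟨[], Sum.inr (slot s - 1) :: r.all, r.i, r.q + 1⟩
    else if r.i ∈ E then ⟨r.i :: r.cur, r.old, r.i + 1, r.q⟩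
    else ⟨r.cur, r.old, r.i + 1, r.q⟩

/-- If `V` uses `m`, exchange it for an element of `S` outside `V`; there is one because `V` is
smaller, and it is at most `m`. This is why discarding the longest job is safe. -/
theorem exists_le_erase {V S : Multiset ℕ} {m : ℕ} (hV : V ≤ S) (hc : V.card < S.card)
    (hm : ∀ b ∈ S, b ≤ m) (hmS : m ∈ S) :
    ∃ V' ≤ S.erase m, V'.card = V.card ∧ V'.sum ≤ V.sum := by
  by_cases h : V ≤ S.erase m
  · exact ⟨V, h, rfl, le_rfl⟩
  have hmV : m ∈ V := by
    by_contra hmV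
    exact h (by simpa [Multiset.erase_of_notMem hmV] using Multiset.erase_le_erase m hV)
  obtain ⟨T, rfl⟩ := Multiset.le_iff_exists_add.1 hV
  have hT : T ≠ 0 := by rintro rfl; simp at hc
  obtain ⟨b, hb⟩ := Multiset.exists_mem_of_ne_zero hT
  refine ⟨V.erase m + {b}, ?_, ?_, ?_⟩
  · rw [Multiset.erase_add_left_pos _ hmV]
    exact add_le_add_right (Multiset.singleton_le.2 hb) _
  · rw [Multiset.card_add, Multiset.card_singleton, Multiset.card_erase_add_one hmV]
  · have h1 := hm b (Multiset.mem_add.2 (.inr hb))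
    have h2 : V.sum = m + (V.erase m).sum := by
      rw [← Multiset.sum_cons, Multiset.cons_erase hmV]
    simp only [Multiset.sum_add, Multiset.sum_singleton]
    omega

/-- The greedy algorithm is at least as good as the run of any set of jobs in time. -/
structure Dominates (D : Data) (cap : ℕ → ℕ) (a : SimState) (r : Run) : Prop where
  i_eq : a.i = r.i
  q_eq : a.q = r.q
  cost_le : a.cost ≤ D.weighted r.old
  card_le : a.S.card ≤ cap a.q
  sum_le : ∃ t₀, a.t = t₀ + a.S.sum ∧ t₀ ≤ total D.p r.old
  tot_le : ∃ u, a.tot = u + a.S.card ∧ r.old.countP Sum.isLeft ≤ u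
  sub : ∃ U ≤ a.S, U.card = r.cur.length ∧ U.sum ≤ (r.cur.map D.sp).sum

/-- The invariant `sub` compares only as many selected jobs as the run has; the greedy algorithm may
hold more during a block. At a job of agent 2, `hcap'` excludes a surplus, and the comparison
becomes one of the whole elapsed time. -/
theorem sim_dominates {D : Data} {E : Set ℕ} {slot cap : ℕ → ℕ} {m : ℕ}
    (hi : ∀ s < m, slot s = 0 → (run E slot s).i < D.n)
    (hE : ∀ s < m, slot s = 0 → (run E slot s).i ∈ E →
      D.sp (run E slot s).i + total D.p (run E slot s).all ≤ D.sd (run E slot s).i)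
    (hcap : ∀ s ≤ m, (run E slot s).cur.length ≤ cap (run E slot s).q)
    (hcap' : ∀ s < m, slot s ≠ 0 → cap (run E slot s).q ≤ (run E slot s).cur.length) :
    ∀ s ≤ m, Dominates D cap (sim D slot cap s) (run E slot s) := by
  intro s
  induction s with
  | zero =>
    intro _
    exact ⟨rfl, rfl, by simp [sim], by simp [sim], ⟨0, by simp [sim]⟩, ⟨0, by simp [sim, run]⟩,
      ⟨0, by simp [run]⟩⟩
  | succ s ih =>
    intro hs
    have h := ih (by omega)
    have hi' := hi s (by omega)
    have hE' := hE s (by omega)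
    have hc0 := hcap (s + 1) hs
    have hc' := hcap' s (by omega)
    rw [run] at hc0
    rw [sim, run]
    generalize sim D slot cap s = a at *
    generalize run E slot s = r at *
    obtain ⟨h1, h2, h3, h4, ⟨t₀, h5, h5'⟩, ⟨u, h6, h6'⟩, U, h7, h8, h9⟩ := h
    unfold simStep
    by_cases hz : slot s ≠ 0
    · simp only [hz, if_true, ne_eq, not_false_eq_true] at hc0 ⊢
      -- The cap at the end of a block is at most the number of jobs of the run in it, so `U` is the
      -- whole selection.
      have hUS : U = a.S := Multiset.eq_of_le_of_card_le h7 (by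
        rw [h8]; exact h4.trans (h2 ▸ hc' hz))
      subst hUS
      have ht : a.t ≤ total D.p r.all := by
        rw [Run.all, total_append, Data.total_map_inl]; omega
      refine ⟨h1, by simp [h2], ?_, by simp, ⟨a.t + D.p₂ (slot s - 1), by simp, ?_⟩,
        ⟨a.tot, by simp, ?_⟩, ⟨0, by simp⟩⟩
      · simp only [Data.weighted, Run.all, Data.weighted_map_inl_append]
        have : a.t + D.p₂ (slot s - 1) ≤ D.p₂ (slot s - 1) + total D.p r.all := by omega
        have := Nat.mul_le_mul_left (D.w₂ (slot s - 1)) this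
        simp only [Run.all] at this
        omega
      · simp only [total_cons, Data.p_inr]; omega
      · simp only [List.countP_cons, Run.all, List.countP_append, countP_isLeft_map_inl]
        simp; omega
    · have hz' : slot s = 0 := by simpa using hz
      have hin : a.i < D.n := h1 ▸ hi' hz'
      simp only [hz', ne_eq, not_true_eq_false, if_false, hin, if_true] at hc0 ⊢
      have hUle : U ≤ D.sp a.i ::ₘ a.S := h7.trans (Multiset.le_cons_self _ _)
      have hM := sup_mem_cons (D.sp a.i) a.S
      have hMle : ∀ b ∈ D.sp a.i ::ₘ a.S, b ≤ (D.sp a.i ::ₘ a.S).sup := fun b hb =>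
        Multiset.le_sup hb
      have hcard : (D.sp a.i ::ₘ a.S).card = a.S.card + 1 := Multiset.card_cons _ _
      have hsumc : (D.sp a.i ::ₘ a.S).sum = D.sp a.i + a.S.sum := Multiset.sum_cons _ _
      have hUc := Multiset.card_le_card h7
      split_ifs with hcond hrE hrE
      · refine ⟨by simp [h1], h2, h3, ?_, ⟨t₀, by simp; omega, h5'⟩, ⟨u, by simp; omega, h6'⟩,
          ⟨D.sp a.i ::ₘ U, Multiset.cons_le_cons _ h7, by simp [h8], by simp [← h1, h9]⟩⟩
        simpa using hcond.2
      · refine ⟨by simp [h1], h2, h3, ?_, ⟨t₀, by simp; omega, h5'⟩, ⟨u, by simp; omega, h6'⟩,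
          ⟨U, hUle, h8, h9⟩⟩
        simpa using hcond.2
      all_goals
        generalize (D.sp a.i ::ₘ a.S).sup = M at *
        have hc2 := Multiset.card_erase_add_one hM
        have hs2 : (D.sp a.i ::ₘ a.S).sum = M + ((D.sp a.i ::ₘ a.S).erase M).sum := by
          rw [← Multiset.sum_cons, Multiset.cons_erase hM]
      · rw [if_pos hrE] at hc0
        have hVle : D.sp a.i ::ₘ U ≤ D.sp a.i ::ₘ a.S := Multiset.cons_le_cons _ h7
        have hVc : (D.sp a.i ::ₘ U).card < (D.sp a.i ::ₘ a.S).card := by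
          -- If `U` were the whole selection, the greedy algorithm would be no later than the run;
          -- the new job would be in time and within the cap, and nothing would have been discarded.
          by_contra hcon
          have hUS : U = a.S := Multiset.eq_of_le_of_card_le h7 (by simpa using hcon)
          refine hcond ⟨?_, ?_⟩
          · have := hE' hz' hrE
            rw [← h1, Run.all, total_append, Data.total_map_inl] at this
            rw [hUS] at h9
            omega
          · rw [← hUS, h8, h2]; simpa using hc0
        obtain ⟨V, hV1, hV2, hV3⟩ := exists_le_erase hVle hVc hMle hM
        refine ⟨by simp [h1], h2, h3, by simp only; omega, ⟨t₀, by simp only; omega, h5'⟩,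
          ⟨u, by simp only; omega, h6'⟩, ⟨V, hV1, by simp [hV2, h8], ?_⟩⟩
        simp only [Multiset.sum_cons] at hV3
        simp only [List.map_cons, List.sum_cons, ← h1]
        omega
      · obtain ⟨V, hV1, hV2, hV3⟩ := exists_le_erase hUle (by omega) hMle hM
        refine ⟨by simp [h1], h2, h3, by simp only; omega, ⟨t₀, by simp only; omega, h5'⟩,
          ⟨u, by simp only; omega, h6'⟩, ⟨V, hV1, by simp [hV2, h8], hV3.trans h9⟩⟩

end Sched

/-! ### Guesses and schedules -/

namespace Sched

/-- The slots of the jobs of agent 2, when job `j < k` is put into the slot `g j`. -/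
def slotOf (g : ℕ → ℕ) : ℕ → ℕ → ℕ
  | 0 => fun _ => 0
  | j + 1 => Function.update (slotOf g j) (g j) (j + 1)

theorem slotOf_spec {g : ℕ → ℕ} {k s : ℕ} (h : slotOf g k s ≠ 0) :
    slotOf g k s ≤ k ∧ g (slotOf g k s - 1) = s := by
  induction k with
  | zero => exact absurd rfl h
  | succ k ih =>
    by_cases hs : s = g k
    · subst hs; simp [slotOf]
    · simp only [slotOf, Function.update_of_ne hs] at h ⊢
      exact ⟨(ih h).1.trans (by omega), (ih h).2⟩

/-- This needs no injectivity of `g`: when two jobs are given the same slot, the later one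
overwrites the other. Such a guess fails the condition `k ≤ a.q` of `Accepts`, because a job is
lost. -/
theorem slotOf_inj {g : ℕ → ℕ} {k s s' : ℕ} (h : slotOf g k s ≠ 0)
    (hs : slotOf g k s = slotOf g k s') : s = s' := by
  have h1 := (slotOf_spec h).2
  have h2 := (slotOf_spec (s := s') (hs ▸ h)).2
  rw [← hs] at h2
  exact h1.symm.trans h2

theorem slotOf_eq_iff {g : ℕ → ℕ} {k s j : ℕ} (hg : ∀ j < k, ∀ j' < k, g j = g j' → j = j') :
    slotOf g k s = j + 1 ↔ j < k ∧ g j = s := by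
  constructor
  · intro h
    have := slotOf_spec (g := g) (k := k) (s := s) (by omega)
    rw [h] at this
    exact ⟨by omega, this.2⟩
  · rintro ⟨hj, rfl⟩
    induction k with
    | zero => omega
    | succ k ih =>
      by_cases hjk : j = k
      · subst hjk; simp [slotOf]
      · have : g j ≠ g k := fun h => hjk (hg j hj k (by omega) h)
        simp only [slotOf, Function.update_of_ne this]
        exact ih (fun a ha b hb => hg a (by omega) b (by omega)) (by omega)

theorem slotOf_congr {g g' : ℕ → ℕ} {k : ℕ} (h : ∀ j < k, g j = g' j) :
    slotOf g k = slotOf g' k := by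
  induction k with
  | zero => rfl
  | succ k ih =>
    simp only [slotOf]
    rw [ih fun j hj => h j (by omega), h k (by omega)]

/-- The greedy algorithm is successful for the guess `g`: job `j < k` of agent 2 has the slot
`g j`, and `g (k + q)` bounds the number of selected jobs of agent 1 after `q` jobs of agent 2. -/
def Accepts (D : Data) (k A₁ A₂ : ℕ) (g : ℕ → ℕ) : Prop :=
  let a := sim D (slotOf g k) (fun q => g (k + q)) (D.n + k)
  k ≤ a.q ∧ D.n ≤ a.tot + A₁ ∧ a.cost ≤ A₂

/-! #### From a list of jobs to a schedule -/

section Completion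

variable {α : Type*} [DecidableEq α] (p : α → ℕ)

/-- The completion times when the jobs of a list are processed, the last one first. -/
def completion : List α → α → ℕ
  | [], _ => 0
  | a :: L, b => if b = a then p a + total p L else completion L b

theorem completion_bounds {L : List α} {a : α} (h : a ∈ L) :
    p a ≤ completion p L a ∧ completion p L a ≤ total p L := by
  induction L with
  | nil => simp at h
  | cons b L ih =>
    by_cases hab : a = b
    · subst hab; simp [completion]
    · have := ih (by simpa [hab] using h)
      simp only [completion, hab, if_false, total_cons]
      omega

theorem completion_disjoint {L : List α} {a b : α} (ha : a ∈ L) (hb : b ∈ L) (hab : a ≠ b) :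
    completion p L a + p b ≤ completion p L b ∨ completion p L b + p a ≤ completion p L a := by
  induction L with
  | nil => simp at ha
  | cons c L ih =>
    by_cases hac : a = c
    · subst hac
      have := (completion_bounds p (by simpa [hab.symm] using hb : b ∈ L)).2
      simp only [completion, if_true, hab.symm, if_false]
      omega
    · have ha' : a ∈ L := by simpa [hac] using ha
      by_cases hbc : b = c
      · subst hbc
        have := (completion_bounds p ha').2
        simp only [completion, if_true, hac, if_false]
        omega
      · have := ih ha' (by simpa [hbc] using hb)
        simpa only [completion, hac, hbc, if_false] using this

theorem completion_append {L L' : List α} {a : α} (h : a ∉ L') :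
    completion p (L' ++ L) a = completion p L a := by
  induction L' with
  | nil => rfl
  | cons b L' ih =>
    simp only [List.mem_cons, not_or] at h
    simp [completion, h.1, ih h.2]

end Completion

theorem InTime.completion_le {D : Data} {L : List (ℕ ⊕ ℕ)} (h : D.InTime L) {x : ℕ}
    (hx : Sum.inl x ∈ L) : completion D.p L (Sum.inl x) ≤ D.sd x := by
  induction L with
  | nil => simp at hx
  | cons a L ih =>
    cases a with
    | inl y =>
      by_cases hxy : x = y
      · subst hxy; simpa [completion] using h.2
      · simpa [completion, hxy] using ih h.1 (by simpa [hxy] using hx)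
    | inr j => simpa [completion] using ih h (by simpa using hx)

/-- The set `F` is arbitrary because in the induction the job at the head of the list has to leave
it. -/
theorem sum_completion_le {D : Data} {L : List (ℕ ⊕ ℕ)} {F : Finset ℕ}
    (hF : ∀ j ∈ F, Sum.inr j ∈ L) :
    ∑ j ∈ F, D.w₂ j * completion D.p L (Sum.inr j) ≤ D.weighted L := by
  induction L generalizing F with
  | nil =>
    have : F = ∅ := Finset.eq_empty_of_forall_notMem fun j hj => by simpa using hF j hj
    simp [this]
  | cons a L ih =>
    cases a with
    | inl y => simpa [completion, Data.weighted] using ih fun j hj => by simpa using hF j hj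
    | inr i =>
      have h1 := ih (F := F.erase i) fun j hj => by
        have := hF j (Finset.mem_of_mem_erase hj)
        simpa [Finset.ne_of_mem_erase hj] using this
      have h2 : ∑ j ∈ F.erase i, D.w₂ j * completion D.p (Sum.inr i :: L) (Sum.inr j) =
          ∑ j ∈ F.erase i, D.w₂ j * completion D.p L (Sum.inr j) :=
        Finset.sum_congr rfl fun j hj => by simp [completion, Finset.ne_of_mem_erase hj]
      by_cases hi : i ∈ F
      · rw [← Finset.add_sum_erase _ _ hi, h2]
        simp only [completion, if_true, Data.weighted, Data.p_inr]
        omega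
      · rw [Finset.erase_eq_of_notMem hi] at h1 h2
        rw [h2]
        exact h1.trans (by simp [Data.weighted])

/-- The data belong to the instance; `ρ` is the order of the due dates. -/
structure Fits (I : TwoAgentInstance) (D : Data) (ρ : Equiv.Perm (Fin I.n)) : Prop where
  n_eq : D.n = I.n
  sp : ∀ j : Fin I.n, D.sp j = I.p₁ (ρ j)
  sd : ∀ j : Fin I.n, D.sd j = I.d₁ (ρ j)
  p₂ : ∀ j : Fin I.k, D.p₂ j = I.p₂ j
  w₂ : ∀ j : Fin I.k, D.w₂ j = I.w₂ j
  mono : ∀ x y, x ≤ y → y < D.n → D.sd x ≤ D.sd y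

/-- The number of a job in the order of the due dates. -/
def number {I : TwoAgentInstance} (ρ : Equiv.Perm (Fin I.n)) : Fin I.n ⊕ Fin I.k → ℕ ⊕ ℕ :=
  Sum.map (fun j => (ρ.symm j : ℕ)) (fun j => (j : ℕ))

theorem number_injective {I : TwoAgentInstance} (ρ : Equiv.Perm (Fin I.n)) :
    Function.Injective (number ρ (I := I)) :=
  Function.Injective.sumMap (Fin.val_injective.comp ρ.symm.injective) Fin.val_injective

theorem Fits.p_number {I : TwoAgentInstance} {D : Data} {ρ : Equiv.Perm (Fin I.n)}
    (h : Fits I D ρ) (j : Fin I.n ⊕ Fin I.k) : D.p (number ρ j) = I.p j := by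
  cases j with
  | inl j => simp [number, TwoAgentInstance.p, h.sp]
  | inr j => simp [number, TwoAgentInstance.p, h.p₂]

/-- The jobs of agent 1 missing from `L` are processed after all others (they stand in front, as
lists are processed from their end). There they delay nobody, and at worst all of them are tardy. -/
theorem isYes_of_list {I : TwoAgentInstance} {D : Data} {ρ : Equiv.Perm (Fin I.n)}
    (h : Fits I D ρ) {L : List (ℕ ⊕ ℕ)} (hL : L.Nodup) (ht : D.InTime L)
    (hw : D.weighted L ≤ I.A₂) (hr : ∀ j < I.k, Sum.inr j ∈ L)
    (hl : ∀ x, Sum.inl x ∈ L → x < I.n) (hc : I.n ≤ L.countP Sum.isLeft + I.A₁) : I.IsYes := by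
  classical
  set R : List (ℕ ⊕ ℕ) := ((List.range I.n).map Sum.inl).filter (· ∉ L) with hR
  have hRL : ∀ a ∈ L, a ∉ R := fun a ha h => by simp [hR] at h; exact h.2 ha
  have hmem : ∀ j, number ρ j ∈ R ++ L := by
    intro j
    by_cases hj : number ρ j ∈ L
    · simp [hj]
    · cases j with
      | inl j => simp [hR, hj]; simp [number]
      | inr j => exact absurd (hr j j.2) hj
  have hcomp : ∀ a ∈ L, completion D.p (R ++ L) a = completion D.p L a := fun a ha =>
    completion_append _ (hRL a ha)
  let σ : I.Schedule :=
    { C := fun j => completion D.p (R ++ L) (number ρ j)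
      start_nonneg := fun j => by
        rw [← h.p_number, sub_nonneg]
        exact_mod_cast (completion_bounds D.p (hmem j)).1
      disjoint := fun i j hij => by
        rw [← h.p_number, ← h.p_number, Set.Ioc_disjoint_Ioc]
        rcases completion_disjoint D.p (hmem i) (hmem j) fun hh => hij (number_injective ρ hh) with
          hh | hh
        · refine (min_le_left _ _).trans (le_trans ?_ (le_max_right _ _))
          rw [le_sub_iff_add_le]; exact_mod_cast hh
        · refine (min_le_right _ _).trans (le_trans ?_ (le_max_left _ _))
          rw [le_sub_iff_add_le]; exact_mod_cast hh }
  refine ⟨σ, ?_, ?_⟩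
  · set T : Finset (Fin I.n) := Finset.univ.filter fun j => number ρ (Sum.inl j) ∈ L with hT
    have h1 : ∑ j, σ.U₁ j ≤ ∑ j, if j ∉ T then 1 else 0 := by
      refine Finset.sum_le_sum fun j _ => ?_
      by_cases hj : j ∈ T
      · have hj' : number ρ (Sum.inl j) ∈ L := by simpa [hT] using hj
        have h2 : completion D.p L (number ρ (Sum.inl j)) ≤ D.sd (ρ.symm j) :=
          InTime.completion_le ht hj'
        rw [h.sd, Equiv.apply_symm_apply] at h2
        have h3 : ¬ (I.d₁ j : ℝ) < completion D.p (R ++ L) (number ρ (Sum.inl j)) := by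
          rw [hcomp _ hj', not_lt]; exact_mod_cast h2
        simp only [TwoAgentInstance.Schedule.U₁, σ, h3, if_false]
        exact Nat.zero_le _
      · simp only [TwoAgentInstance.Schedule.U₁, hj, not_false_eq_true, if_true]
        split_ifs <;> simp
    have h2 : ∑ j, (if j ∉ T then 1 else 0) = I.n - T.card := by
      rw [← Finset.card_filter, show Finset.univ.filter (fun j => j ∉ T) = Tᶜ by ext; simp,
        Finset.card_compl, Fintype.card_fin]
    have h3 : L.countP Sum.isLeft ≤ T.card := by
      rw [List.countP_eq_length_filter, ← List.toFinset_card_of_nodup (hL.filter _)]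
      refine (Finset.card_le_card (t := T.image fun j => number ρ (Sum.inl j)) ?_).trans
        Finset.card_image_le
      intro a ha
      simp only [List.mem_toFinset, List.mem_filter] at ha
      obtain ⟨x, rfl⟩ := Sum.isLeft_iff.1 ha.2
      have hx := hl x ha.1
      simp only [Finset.mem_image, hT, Finset.mem_filter, Finset.mem_univ, true_and]
      refine ⟨ρ ⟨x, hx⟩, ?_, ?_⟩ <;> simp [number, ha.1]
    omega
  · have h1 := sum_completion_le (D := D) (L := L) (F := Finset.range I.k) fun j hj =>
      hr j (by simpa using hj)
    rw [Finset.sum_range] at h1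
    have h2 : ∑ j, (I.w₂ j : ℝ) * σ.C (Sum.inr j) =
        ((∑ j : Fin I.k, D.w₂ j * completion D.p L (Sum.inr (j : ℕ)) : ℕ) : ℝ) := by
      push_cast
      refine Finset.sum_congr rfl fun j _ => ?_
      rw [h.w₂, ← hcomp _ (hr j j.2)]
      rfl
    rw [h2]
    exact_mod_cast h1.trans hw

/-- The processed jobs of agent 2 are distinct and have numbers below `k`; as there are at least `k`
of them, none is missing. -/
theorem Accepts.isYes {I : TwoAgentInstance} {D : Data} {ρ : Equiv.Perm (Fin I.n)}
    (h : Fits I D ρ) {g : ℕ → ℕ} (hg : Accepts D I.k I.A₁ I.A₂ g) : I.IsYes := by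
  obtain ⟨l, L, hs⟩ := sim_sound (cap := fun q => g (I.k + q)) h.mono
    (fun s s' => slotOf_inj (g := g) (k := I.k)) (D.n + I.k)
  obtain ⟨h1, h2, h3⟩ := hg
  refine isYes_of_list h hs.nodup hs.inTime ?_ ?_ ?_ ?_
  · rw [Data.weighted_map_inl_append, hs.cost_eq]; exact h3
  · have hsub : (L.filter Sum.isRight).toFinset ⊆ (Finset.range I.k).image Sum.inr := by
      intro a ha
      simp only [List.mem_toFinset, List.mem_filter] at ha
      obtain ⟨j, rfl⟩ := Sum.isRight_iff.1 ha.2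
      obtain ⟨s', _, hs'⟩ := hs.inr j ha.1
      have := (slotOf_spec (g := g) (k := I.k) (s := s') (by omega)).1
      simp only [Finset.mem_image, Finset.mem_range]
      exact ⟨j, by omega, rfl⟩
    have heq := Finset.eq_of_subset_of_card_le hsub (by
      rw [List.toFinset_card_of_nodup ((hs.nodup.sublist (List.sublist_append_right _ _)).filter _),
        ← List.countP_eq_length_filter, hs.q_eq]
      exact Finset.card_image_le.trans (by simpa using h1))
    intro j hj
    have : (Sum.inr j : ℕ ⊕ ℕ) ∈ (L.filter Sum.isRight).toFinset := by
      rw [heq]; exact Finset.mem_image_of_mem _ (by simpa using hj)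
    simp only [List.mem_toFinset, List.mem_filter] at this
    exact List.mem_append_right _ this.1
  · intro x hx
    exact (hs.lt x hx).trans_le (hs.i_le.trans_eq h.n_eq)
  · rw [hs.tot_eq, ← h.n_eq]; exact h2

/-! #### From a schedule to a guess -/

/-- The slots contain the jobs that the run has processed. -/
structure RunSpec (E : Set ℕ) (slot : ℕ → ℕ) (s : ℕ) (r : Run) : Prop where
  add_eq : r.q + r.i = s
  inl : ∀ y, Sum.inl y ∈ r.all → y ∈ E ∧ y < r.i
  inr : ∀ j, Sum.inr j ∈ r.all → ∃ s' < s, slot s' = j + 1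
  nodup : r.all.Nodup
  mem : ∀ y ∈ E, y < r.i → Sum.inl y ∈ r.all
  cur_le : r.cur.length ≤ r.i

theorem run_spec (E : Set ℕ) {slot : ℕ → ℕ}
    (hslot : ∀ s s', slot s ≠ 0 → slot s = slot s' → s = s') (s : ℕ) :
    RunSpec E slot s (run E slot s) := by
  induction s with
  | zero => constructor <;> simp [run, Run.all]
  | succ s ih =>
    rw [run]
    generalize run E slot s = r at *
    obtain ⟨h1, h2, h3, h4, h5, h6⟩ := ih
    have h3' : ∀ j, Sum.inr j ∈ r.all → ∃ s' < s + 1, slot s' = j + 1 := fun j hj => by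
      obtain ⟨s', ha, hb⟩ := h3 j hj
      exact ⟨s', by omega, hb⟩
    by_cases hz : slot s ≠ 0
    · simp only [hz, ne_eq, not_false_eq_true, if_true]
      obtain ⟨j, hj⟩ : ∃ j, slot s = j + 1 := ⟨slot s - 1, by omega⟩
      simp only [hj, Nat.add_sub_cancel]
      refine ⟨by simp only; omega, ?_, ?_, ?_, ?_, by simp⟩
      · intro y hy; exact h2 y (by simpa [Run.all] using hy)
      · intro j' hj'
        rcases List.mem_cons.1 (show Sum.inr j' ∈ Sum.inr j :: r.all from hj') with hh | hh
        · cases hh; exact ⟨s, by omega, hj⟩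
        · exact h3' j' hh
      · refine List.nodup_cons.2 ⟨fun hm => ?_, h4⟩
        obtain ⟨s', ha, hb⟩ := h3 j hm
        have := hslot s s' hz (by omega)
        omega
      · intro y hy hlt
        exact List.mem_cons_of_mem _ (h5 y hy hlt)
    · simp only [hz, if_false]
      split_ifs with hE
      · refine ⟨by simp only; omega, ?_, ?_, ?_, ?_, by simpa using h6⟩
        · intro y hy
          rcases List.mem_cons.1 (show Sum.inl y ∈ Sum.inl r.i :: r.all from hy) with hh | hh
          · cases hh; exact ⟨hE, by simp⟩
          · exact ⟨(h2 y hh).1, (h2 y hh).2.trans (by simp)⟩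
        · intro j hj
          rcases List.mem_cons.1 (show Sum.inr j ∈ Sum.inl r.i :: r.all from hj) with hh | hh
          · cases hh
          · exact h3' j hh
        · exact List.nodup_cons.2 ⟨fun hm => (h2 _ hm).2.ne rfl, h4⟩
        · intro y hy hlt
          rcases Nat.lt_succ_iff_lt_or_eq.1 (show y < r.i + 1 from hlt) with hh | hh
          · exact List.mem_cons_of_mem _ (h5 y hy hh)
          · subst hh; exact List.mem_cons_self
      · refine ⟨by simp only; omega, ?_, h3', h4, ?_, by simp only; omega⟩
        · intro y hy
          exact ⟨(h2 y hy).1, (h2 y hy).2.trans (by simp)⟩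
        · intro y hy hlt
          rcases Nat.lt_succ_iff_lt_or_eq.1 (show y < r.i + 1 from hlt) with hh | hh
          · exact h5 y hy hh
          · subst hh; exact absurd hy hE

theorem run_i_mono (E : Set ℕ) (slot : ℕ → ℕ) : Monotone fun s => (run E slot s).i := by
  refine monotone_nat_of_le_succ fun s => ?_
  simp only [run]
  split_ifs <;> simp

theorem run_q_mono (E : Set ℕ) (slot : ℕ → ℕ) : Monotone fun s => (run E slot s).q := by
  refine monotone_nat_of_le_succ fun s => ?_
  simp only [run]
  split_ifs <;> simp

theorem run_q_succ {E : Set ℕ} {slot : ℕ → ℕ} {s : ℕ} (h : slot s ≠ 0) :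
    (run E slot (s + 1)).q = (run E slot s).q + 1 := by
  simp [run, h]

theorem run_i_succ {E : Set ℕ} {slot : ℕ → ℕ} {s : ℕ} (h : slot s = 0) :
    (run E slot (s + 1)).i = (run E slot s).i + 1 := by
  simp only [run, h]
  split_ifs <;> simp_all

-- The slots of the current block are recognized by the value of `q`. In this form a partial block
-- can be compared with the whole block, which is what the guessed caps count.
open Classical in
theorem run_cur_length (E : Set ℕ) (slot : ℕ → ℕ) (s : ℕ) :
    (run E slot s).cur.length = ((Finset.range s).filter fun s' => slot s' = 0 ∧
      (run E slot s').i ∈ E ∧ (run E slot s').q = (run E slot s).q).card := by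
  induction s with
  | zero => rfl
  | succ s ih =>
    by_cases hz : slot s ≠ 0
    · have h1 := run_q_succ (E := E) hz
      have h2 : (run E slot (s + 1)).cur = [] := by simp [run, hz]
      rw [h2, List.length_nil, eq_comm, Finset.card_eq_zero, Finset.filter_eq_empty_iff]
      rintro s' hs' ⟨_, _, h⟩
      have := run_q_mono E slot (Nat.lt_succ_iff.1 (Finset.mem_range.1 hs'))
      simp only at this
      omega
    · have hz' : slot s = 0 := by simpa using hz
      have hq : (run E slot (s + 1)).q = (run E slot s).q := by
        simp only [run, hz, if_false]; split_ifs <;> rfl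
      rw [hq, Finset.range_add_one, Finset.filter_insert]
      by_cases hE : (run E slot s).i ∈ E
      · rw [if_pos ⟨hz', hE, rfl⟩, Finset.card_insert_of_notMem (by simp), ← ih]
        simp [run, hz', hE]
      · rw [if_neg (by tauto), ← ih]
        simp [run, hz', hE]

theorem run_q_eq {E : Set ℕ} {g : ℕ → ℕ} {k : ℕ} (hg : ∀ j < k, ∀ j' < k, g j = g j' → j = j')
    (s : ℕ) : (run E (slotOf g k) s).q = ((Finset.range k).filter fun j => g j < s).card := by
  induction s with
  | zero => simp [run]
  | succ s ih =>
    by_cases hz : slotOf g k s ≠ 0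
    · obtain ⟨j, hj⟩ : ∃ j, slotOf g k s = j + 1 := ⟨slotOf g k s - 1, by omega⟩
      obtain ⟨hjk, hjs⟩ := (slotOf_eq_iff hg).1 hj
      rw [run_q_succ hz, ih, show (Finset.range k).filter (fun j => g j < s + 1) =
        insert j ((Finset.range k).filter fun j => g j < s) from ?_,
        Finset.card_insert_of_notMem (by simp [hjs])]
      ext i
      simp only [Finset.mem_filter, Finset.mem_insert, Finset.mem_range]
      constructor
      · rintro ⟨h1, h2⟩
        rcases Nat.lt_succ_iff_lt_or_eq.1 h2 with h | h
        · exact .inr ⟨h1, h⟩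
        · exact .inl (hg i h1 j hjk (h.trans hjs.symm))
      · rintro (rfl | h)
        · exact ⟨hjk, by omega⟩
        · exact ⟨h.1, by omega⟩
    · have hq : (run E (slotOf g k) (s + 1)).q = (run E (slotOf g k) s).q := by
        simp only [run, hz, if_false]; split_ifs <;> rfl
      rw [hq, ih]
      congr 1
      ext i
      simp only [Finset.mem_filter, Finset.mem_range, and_congr_right_iff]
      intro hi
      have : g i ≠ s := fun h => hz (by rw [(slotOf_eq_iff hg).2 ⟨hi, h⟩]; omega)
      omega

/-- The jobs: `n` of agent 1 and `k` of agent 2. -/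
def IsJob (n k : ℕ) : ℕ ⊕ ℕ → Prop := Sum.elim (· < n) (· < k)

/-- The guess is read off the completion times `c`: the slots from `gap` and the rank within agent
2, the caps from the number of jobs of `E` in each block. Only the first `2 k` entries are
prescribed; the entry `2 k`, the cap of the last block, is `n`. -/
theorem exists_guess {D : Data} {k A₁ A₂ : ℕ} {c : ℕ ⊕ ℕ → ℝ}
    (hmono : ∀ x y, x ≤ y → y < D.n → D.sd x ≤ D.sd y)
    (hinj : ∀ a b, IsJob D.n k a → IsJob D.n k b → c a = c b → a = b)
    (htot : ∀ (L : List (ℕ ⊕ ℕ)) (b : ℕ ⊕ ℕ), L.Nodup → b ∈ L →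
      (∀ a ∈ L, IsJob D.n k a ∧ c a ≤ c b) → (total D.p L : ℝ) ≤ c b)
    (hA₁ : ((Finset.range D.n).filter fun x => (D.sd x : ℝ) < c (Sum.inl x)).card ≤ A₁)
    (hA₂ : ∑ j ∈ Finset.range k, (D.w₂ j : ℝ) * c (Sum.inr j) ≤ A₂) :
    ∃ g : ℕ → ℕ, (∀ p < 2 * k, g p < D.n + k) ∧
      ∀ g' : ℕ → ℕ, (∀ p < 2 * k, g' p = g p) → g' (2 * k) = D.n → Accepts D k A₁ A₂ g' := by
  classical
  set E : Set ℕ := {x | x < D.n ∧ c (Sum.inl x) ≤ D.sd x} with hEdef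
  -- The numbers `x ≥ D.n` are included so that the infimum exists and is `D.n` when no job of `E`
  -- comes after `j`.
  set G : ℕ → Set ℕ := fun j => {x | D.n ≤ x ∨ (x ∈ E ∧ c (Sum.inr j) < c (Sum.inl x))} with hG
  set gap : ℕ → ℕ := fun j => sInf (G j) with hgap
  have hGn : ∀ j, D.n ∈ G j := fun j => .inl le_rfl
  have gap_mem : ∀ j, gap j ∈ G j := fun j => Nat.sInf_mem ⟨_, hGn j⟩
  have gap_le : ∀ j, gap j ≤ D.n := fun j => Nat.sInf_le (hGn j)
  set rank : ℕ → ℕ := fun j =>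
    ((Finset.range k).filter fun j' => c (Sum.inr j') < c (Sum.inr j)).card with hrank
  have rank_lt : ∀ j < k, rank j < k := fun j hj => by
    rw [hrank]
    refine (Finset.card_lt_card (t := Finset.range k) ?_).trans_eq (Finset.card_range k)
    refine (Finset.filter_ssubset).2 ⟨j, by simpa using hj, by simp⟩
  -- Before the slot of `j` there must be room for `gap j` jobs of agent 1 and for the `rank j` jobs
  -- of agent 2 that are completed earlier.
  set a : ℕ → ℕ := fun j => gap j + rank j with ha
  have a_lt : ∀ j < k, a j < D.n + k := fun j hj => by
    have := gap_le j; have := rank_lt j hj; simp only [ha]; omega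
  have a_mono : ∀ j < k, ∀ j' < k, c (Sum.inr j) < c (Sum.inr j') → a j < a j' := by
    intro j hj j' hj' h
    have h1 : gap j ≤ gap j' := by
      refine Nat.sInf_le ?_
      rcases gap_mem j' with hh | hh
      · exact .inl hh
      · exact .inr ⟨hh.1, h.trans hh.2⟩
    have h2 : rank j < rank j' := by
      refine Finset.card_lt_card (Finset.ssubset_iff_of_subset ?_ |>.2 ⟨j, ?_, ?_⟩)
      · intro i hi
        simp only [Finset.mem_filter] at hi ⊢
        exact ⟨hi.1, hi.2.trans h⟩
      · simpa using ⟨hj, h⟩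
      · simp
    simp only [ha]; omega
  have a_lt_iff : ∀ j < k, ∀ j' < k, (a j < a j' ↔ c (Sum.inr j) < c (Sum.inr j')) := by
    intro j hj j' hj'
    refine ⟨fun h => ?_, a_mono j hj j' hj'⟩
    by_contra hcon
    rcases (not_lt.1 hcon).lt_or_eq with hh | hh
    · exact absurd (a_mono j' hj' j hj hh) (by omega)
    · have := hinj (.inr j') (.inr j) hj' hj hh
      cases this; omega
  have a_inj : ∀ j < k, ∀ j' < k, a j = a j' → j = j' := by
    intro j hj j' hj' h
    by_contra hne
    rcases lt_trichotomy (c (Sum.inr j)) (c (Sum.inr j')) with hh | hh | hh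
    · have := a_mono j hj j' hj' hh; omega
    · have := hinj (.inr j) (.inr j') hj hj' hh
      cases this; omega
    · have := a_mono j' hj' j hj hh; omega
  set slot := slotOf a k with hslot
  have slot_inj : ∀ s s', slot s ≠ 0 → slot s = slot s' → s = s' := fun s s' => slotOf_inj
  have slot_iff : ∀ {s j}, slot s = j + 1 ↔ j < k ∧ a j = s := slotOf_eq_iff a_inj
  set r := run E slot with hr
  have spec : ∀ s, RunSpec E slot s (r s) := run_spec E slot_inj
  have q_eq : ∀ s, (r s).q = ((Finset.range k).filter fun j => a j < s).card := run_q_eq a_inj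
  have q_rank : ∀ j < k, (r (a j)).q = rank j := fun j hj => by
    rw [q_eq, hrank]
    congr 1
    ext j'
    simp only [Finset.mem_filter, Finset.mem_range, and_congr_right_iff]
    exact fun hj' => a_lt_iff j' hj' j hj
  have i_gap : ∀ j < k, (r (a j)).i = gap j := fun j hj => by
    have h1 := (spec (a j)).add_eq
    have h2 := q_rank j hj
    have h3 : a j = gap j + rank j := rfl
    omega
  have q_end : (r (D.n + k)).q = k := by
    rw [q_eq, Finset.filter_true_of_mem fun j hj => a_lt j (by simpa using hj), Finset.card_range]
  have i_end : (r (D.n + k)).i = D.n := by have := (spec (D.n + k)).add_eq; omega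
  have i_lt : ∀ s < D.n + k, slot s = 0 → (r s).i < D.n := fun s hs h => by
    have h1 := run_i_succ (E := E) h
    have h2 := run_i_mono E slot (show s + 1 ≤ D.n + k by omega)
    simp only [← hr] at h1 h2
    omega
  have q_lt : ∀ s < D.n + k, slot s ≠ 0 → (r s).q < k := fun s hs h => by
    have h1 := run_q_succ (E := E) h
    have h2 := run_q_mono E slot (show s + 1 ≤ D.n + k by omega)
    simp only [← hr] at h1 h2
    omega
  have job : ∀ s ≤ D.n + k, ∀ b ∈ (r s).all, IsJob D.n k b := by
    intro s hs b hb
    cases b with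
    | inl y => exact ((spec s).inl y hb).1.1
    | inr j =>
      obtain ⟨s', _, h⟩ := (spec s).inr j hb
      exact (slot_iff.1 h).1
  set cap : ℕ → ℕ := fun q => ((Finset.range (D.n + k)).filter fun s' => slot s' = 0 ∧
      (r s').i ∈ E ∧ (r s').q = q).card with hcap
  set g : ℕ → ℕ := fun p => if p < k then a p else if p < 2 * k then cap (p - k) else D.n with hg
  refine ⟨g, fun p hp => ?_, fun g' hg' hg'n => ?_⟩
  · simp only [hg, hp, if_true]
    split_ifs with h
    · exact a_lt p h
    · have h0 : 0 < k := by omega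
      -- The slot of job `0` of agent 2 is not counted, so a cap is less than `n + k` and fits into
      -- a digit.
      refine (Finset.card_lt_card (t := Finset.range (D.n + k)) ?_).trans_eq (Finset.card_range _)
      refine Finset.filter_ssubset.2 ⟨a 0, by simpa using a_lt 0 h0, ?_⟩
      rw [slot_iff.2 ⟨h0, rfl⟩]
      simp
  have hslot' : slotOf g' k = slot := slotOf_congr fun j hj => by
    rw [hg' j (by omega)]; simp [hg, hj]
  have hcap1 : ∀ q < k, g' (k + q) = cap q := fun q hq => by
    rw [hg' _ (by omega)]
    simp only [hg]
    rw [if_neg (by omega), if_pos (by omega), Nat.add_sub_cancel_left]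
  have hcap2 : g' (k + k) = D.n := by rw [← two_mul]; exact hg'n
  have tot_slot : ∀ s < D.n + k, ∀ j, slot s = j + 1 →
      (total D.p (Sum.inr j :: (r s).all) : ℝ) ≤ c (Sum.inr j) := by
    intro s hs j hj
    obtain ⟨hjk, rfl⟩ := slot_iff.1 hj
    refine htot _ _ (List.nodup_cons.2 ⟨fun hm => ?_, (spec _).nodup⟩) List.mem_cons_self ?_
    · obtain ⟨s', h1, h2⟩ := (spec _).inr j hm
      have := (slot_iff.1 h2).2
      omega
    intro b hb
    rcases List.mem_cons.1 hb with rfl | hb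
    · exact ⟨hjk, le_rfl⟩
    refine ⟨job _ hs.le b hb, ?_⟩
    cases b with
    | inl y =>
      obtain ⟨h1, h2⟩ := (spec _).inl y hb
      rw [i_gap j hjk] at h2
      -- A job of `E` completed after `j` would belong to `G j`, but `y` lies below the infimum of
      -- `G j`.
      by_contra hcon
      exact absurd (Nat.sInf_le (show y ∈ G j from .inr ⟨h1, not_le.1 hcon⟩)) (not_le.2 h2)
    | inr j' =>
      obtain ⟨s', h1, h2⟩ := (spec _).inr j' hb
      obtain ⟨h3, rfl⟩ := slot_iff.1 h2
      exact ((a_lt_iff j' h3 j hjk).1 h1).le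
  have dom := sim_dominates (D := D) (E := E) (slot := slot) (cap := fun q => g' (k + q))
    (m := D.n + k) i_lt ?_ ?_ ?_ (D.n + k) le_rfl
  · simp only [← hr] at dom
    obtain ⟨h1, h2, h3, -, -, ⟨u, h6, h6'⟩, U, h7, h8, -⟩ := dom
    have hUc := Multiset.card_le_card h7
    unfold Accepts
    rw [hslot']
    refine ⟨(h2.trans q_end).ge, ?_, ?_⟩
    · have hcount : ((Finset.range D.n).filter (· ∈ E)).card ≤
          (r (D.n + k)).all.countP Sum.isLeft := by
        rw [List.countP_eq_length_filter,
          ← List.toFinset_card_of_nodup ((spec _).nodup.filter _),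
          ← Finset.card_image_of_injective _ (Sum.inl_injective (β := ℕ))]
        refine Finset.card_le_card fun b hb => ?_
        obtain ⟨y, hy, rfl⟩ := Finset.mem_image.1 hb
        simp only [Finset.mem_filter, Finset.mem_range] at hy
        simp only [List.mem_toFinset, List.mem_filter]
        exact ⟨(spec _).mem y hy.2 (by rw [i_end]; exact hy.1), rfl⟩
      have hsplit := Finset.card_filter_add_card_filter_not (s := Finset.range D.n) (· ∈ E)
      have hnot : ((Finset.range D.n).filter fun x => ¬ x ∈ E).card ≤ A₁ := by
        refine le_trans (Finset.card_le_card fun x hx => ?_) hA₁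
        simp only [Finset.mem_filter, Finset.mem_range, hEdef, Set.mem_ofPred_eq, not_and,
          not_le] at hx ⊢
        exact ⟨hx.1, hx.2 hx.1⟩
      rw [Finset.card_range] at hsplit
      rw [Run.all, List.countP_append, countP_isLeft_map_inl] at hcount
      omega
    -- Each job of agent 2 ends in the run no later than in the schedule, by `tot_slot`; the costs
    -- add up slot by slot.
    · have key : ∀ s ≤ D.n + k, (D.weighted (r s).all : ℝ) ≤
          ∑ j ∈ (Finset.range k).filter (fun j => a j < s), (D.w₂ j : ℝ) * c (Sum.inr j) := by
        intro s
        induction s with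
        | zero => intro _; simp [hr, run, Run.all, Data.weighted]
        | succ s ih =>
          intro hs
          have ih' := ih (by omega)
          by_cases hz : slot s ≠ 0
          · obtain ⟨j, hj⟩ : ∃ j, slot s = j + 1 := ⟨slot s - 1, by omega⟩
            obtain ⟨hjk, hjs⟩ := slot_iff.1 hj
            have h1 : (Finset.range k).filter (fun j => a j < s + 1) =
                insert j ((Finset.range k).filter fun j => a j < s) := by
              ext i
              simp only [Finset.mem_filter, Finset.mem_insert, Finset.mem_range]
              constructor
              · rintro ⟨h1, h2⟩
                rcases Nat.lt_succ_iff_lt_or_eq.1 h2 with h | h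
                · exact .inr ⟨h1, h⟩
                · exact .inl (a_inj i h1 j hjk (h.trans hjs.symm))
              · rintro (rfl | h)
                · exact ⟨hjk, by omega⟩
                · exact ⟨h.1, by omega⟩
            have h2 : (r (s + 1)).all = Sum.inr j :: (r s).all := by
              simp [hr, run, hj, Run.all]
            rw [h1, Finset.sum_insert (by simp [hjs]), h2, Data.weighted]
            have h3 := tot_slot s (by omega) j hj
            rw [total_cons, Data.p_inr] at h3
            have h4 := mul_le_mul_of_nonneg_left h3 (Nat.cast_nonneg (α := ℝ) (D.w₂ j))
            push_cast at h4 ih' ⊢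
            linarith
          · have h1 : D.weighted (r (s + 1)).all = D.weighted (r s).all := by
              simp only [hr, run, hz, if_false]
              split_ifs <;> simp [Run.all, Data.weighted]
            rw [h1]
            refine ih'.trans_eq (Finset.sum_congr (Finset.filter_congr fun j hj => ?_)
              fun _ _ => rfl)
            have : a j ≠ s := fun h => hz (by rw [slot_iff.2 ⟨by simpa using hj, h⟩]; omega)
            omega
      have h9 := key _ le_rfl
      rw [Finset.filter_true_of_mem fun j hj => a_lt j (by simpa using hj)] at h9
      have h10 : D.weighted (r (D.n + k)).all ≤ A₂ := by exact_mod_cast h9.trans hA₂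
      rw [Run.all, Data.weighted_map_inl_append] at h10
      exact h3.trans h10
  · intro s hs hz hE
    simp only [← hr] at hE ⊢
    set x := (r s).i with hx
    -- The job `z` is the one completed last among the jobs of `E` up to `x`. Everything processed
    -- up to `x` was completed by then, and `z` is due no later than `x`.
    obtain ⟨z, hz1, hz2⟩ := Finset.exists_max_image ((Finset.range (x + 1)).filter (· ∈ E))
      (fun z => c (Sum.inl z)) ⟨x, by simpa using hE⟩
    simp only [Finset.mem_filter, Finset.mem_range] at hz1 hz2
    have hxn : x < D.n := i_lt s hs hz
    have hmem : ∀ b ∈ Sum.inl x :: (r s).all, IsJob D.n k b ∧ c b ≤ c (Sum.inl z) := by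
      intro b hb
      rcases List.mem_cons.1 hb with rfl | hb
      · exact ⟨hxn, hz2 x ⟨by omega, hE⟩⟩
      refine ⟨job s hs.le b hb, ?_⟩
      cases b with
      | inl y =>
        obtain ⟨h1, h2⟩ := (spec s).inl y hb
        exact hz2 y ⟨by omega, h1⟩
      | inr j =>
        obtain ⟨s', h1, h2⟩ := (spec s).inr j hb
        obtain ⟨h3, rfl⟩ := slot_iff.1 h2
        have h4 := run_i_mono E slot h1.le
        simp only [← hr] at h4
        rw [i_gap j h3] at h4
        rcases gap_mem j with h5 | h5
        · omega
        · exact h5.2.le.trans (hz2 _ ⟨by omega, h5.1⟩)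
    have h1 := htot (Sum.inl x :: (r s).all) (Sum.inl z)
      (List.nodup_cons.2 ⟨fun hm => ((spec s).inl _ hm).2.ne rfl, (spec s).nodup⟩) (by
        rcases Nat.lt_succ_iff_lt_or_eq.1 hz1.1 with hh | hh
        · exact List.mem_cons_of_mem _ ((spec s).mem z hz1.2 hh)
        · rw [hh]; exact List.mem_cons_self) hmem
    have h2 : total D.p (Sum.inl x :: (r s).all) ≤ D.sd z := by
      exact_mod_cast h1.trans hz1.2.2
    rw [total_cons, Data.p_inl] at h2
    exact h2.trans (hmono z x (by omega) hxn)
  · intro s hs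
    simp only [← hr]
    have hqk : (r s).q ≤ k := by
      have := run_q_mono E slot hs
      simp only [← hr] at this
      omega
    rcases hqk.lt_or_eq with hh | hh
    · rw [hcap1 _ hh, hr, run_cur_length]
      refine Finset.card_le_card fun s' hs' => ?_
      simp only [Finset.mem_filter, Finset.mem_range] at hs' ⊢
      exact ⟨by omega, hs'.2⟩
    -- In the last block the cap `n` is no restriction; its number of jobs need not be guessed.
    · rw [hh, hcap2]
      have h1 := run_i_mono E slot hs
      simp only [← hr] at h1
      exact (spec s).cur_le.trans (by omega)
  · intro s hs hz
    simp only [← hr]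
    rw [hcap1 _ (q_lt s hs hz), hr, run_cur_length]
    refine Finset.card_le_card fun s' hs' => ?_
    simp only [Finset.mem_filter, Finset.mem_range] at hs' ⊢
    refine ⟨?_, hs'.2⟩
    -- At a job of agent 2 the block is complete: a later slot has a larger `q`.
    by_contra hcon
    rcases (not_lt.1 hcon).lt_or_eq with hh | hh
    · have h1 := run_q_succ (E := E) hz
      have h2 := run_q_mono E slot (show s + 1 ≤ s' from hh)
      have h3 : (run E slot s').q = (run E slot s).q := hs'.2.2.2
      simp only at h2
      omega
    · exact hz (hh ▸ hs'.2.1)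

/-- The intervals of the jobs are disjoint and lie in `(0, C b]`; compare Lebesgue measures. -/
theorem sum_p_le {I : TwoAgentInstance} (σ : I.Schedule) (F : Finset (Fin I.n ⊕ Fin I.k))
    {b : Fin I.n ⊕ Fin I.k} (h : ∀ a ∈ F, σ.C a ≤ σ.C b) : ∑ a ∈ F, (I.p a : ℝ) ≤ σ.C b := by
  have hb : 0 ≤ σ.C b := by
    have := σ.start_nonneg b
    have h2 : (0 : ℝ) ≤ I.p b := Nat.cast_nonneg _
    linarith
  have h1 : MeasureTheory.volume (⋃ a ∈ F, Set.Ioc (σ.C a - I.p a) (σ.C a)) =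
      ∑ a ∈ F, MeasureTheory.volume (Set.Ioc (σ.C a - I.p a) (σ.C a)) :=
    MeasureTheory.measure_biUnion_finset (fun i _ j _ hij => σ.disjoint i j hij)
      fun a _ => measurableSet_Ioc
  have h2 : (⋃ a ∈ F, Set.Ioc (σ.C a - I.p a) (σ.C a)) ⊆ Set.Ioc 0 (σ.C b) := by
    refine Set.iUnion₂_subset fun a ha => Set.Ioc_subset_Ioc (σ.start_nonneg a) (h a ha)
  have h3 := MeasureTheory.measure_mono (μ := MeasureTheory.volume) h2
  rw [h1] at h3
  simp only [Real.volume_Ioc, sub_sub_cancel, sub_zero] at h3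
  rw [← ENNReal.ofReal_sum_of_nonneg (fun _ _ => Nat.cast_nonneg _)] at h3
  exact (ENNReal.ofReal_le_ofReal_iff hb).1 h3

/-- Processing times are positive, so each interval contains its right end. -/
theorem C_injective {I : TwoAgentInstance} (σ : I.Schedule) : Function.Injective σ.C := by
  intro a b hab
  by_contra hne
  have hp : ∀ j, (0 : ℝ) < I.p j := by
    intro j
    cases j with
    | inl j => exact_mod_cast I.p₁_pos j
    | inr j => exact_mod_cast I.p₂_pos j
  exact Set.disjoint_left.1 (σ.disjoint a b hne) ⟨by have := hp a; linarith, le_rfl⟩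
    ⟨by have := hp b; linarith, hab.le⟩

theorem IsYes.exists_guess {I : TwoAgentInstance} {D : Data} {ρ : Equiv.Perm (Fin I.n)}
    (h : Fits I D ρ) (hI : I.IsYes) : ∃ g : ℕ → ℕ, (∀ p < 2 * I.k, g p < I.n + I.k) ∧
      ∀ g' : ℕ → ℕ, (∀ p < 2 * I.k, g' p = g p) → g' (2 * I.k) = I.n →
        Accepts D I.k I.A₁ I.A₂ g' := by
  classical
  obtain ⟨σ, hσ₁, hσ₂⟩ := hI
  -- The value 0 off the jobs is never used, since all hypotheses to be met concern jobs only.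
  let c : ℕ ⊕ ℕ → ℝ := fun b => if hb : ∃ a, number ρ a = b then σ.C hb.choose else 0
  have hc : ∀ a, c (number ρ a) = σ.C a := fun a => by
    have hb : ∃ a', number ρ a' = number ρ a := ⟨a, rfl⟩
    simp only [c, hb, dif_pos]
    rw [number_injective ρ hb.choose_spec]
  have hjob : ∀ b, IsJob D.n I.k b → ∃ a, number ρ a = b := by
    intro b hb
    cases b with
    | inl x =>
      have hx : x < I.n := h.n_eq ▸ hb
      exact ⟨Sum.inl (ρ ⟨x, hx⟩), by simp [number]⟩
    | inr j => exact ⟨Sum.inr ⟨j, hb⟩, by simp [number]⟩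
  rw [← h.n_eq]
  refine Sched.exists_guess (c := c) h.mono ?_ ?_ ?_ ?_
  · intro a b ha hb hab
    obtain ⟨a, rfl⟩ := hjob a ha
    obtain ⟨b, rfl⟩ := hjob b hb
    rw [hc, hc] at hab
    rw [C_injective σ hab]
  · intro L b hL hb hall
    obtain ⟨b, rfl⟩ := hjob b (hall b hb).1
    rw [hc]
    have h1 : L.toFinset = (Finset.univ.filter fun a => number ρ a ∈ L).image (number ρ) := by
      ext a
      simp only [List.mem_toFinset, Finset.mem_image, Finset.mem_filter, Finset.mem_univ, true_and]
      constructor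
      · intro ha
        obtain ⟨a, rfl⟩ := hjob a (hall a ha).1
        exact ⟨a, ha, rfl⟩
      · rintro ⟨a, ha, rfl⟩
        exact ha
    have h2 : total D.p L = ∑ a ∈ Finset.univ.filter (fun a => number ρ a ∈ L), I.p a := by
      rw [total, ← List.sum_toFinset _ hL, h1, Finset.sum_image (number_injective ρ).injOn]
      exact Finset.sum_congr rfl fun a _ => h.p_number a
    rw [h2]
    push_cast
    refine sum_p_le σ _ fun a ha => ?_
    have := (hall _ (Finset.mem_filter.1 ha).2).2
    rwa [hc, hc] at this
  · refine le_trans ?_ hσ₁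
    have h1 : ∑ j, σ.U₁ j = ∑ j : Fin I.n, if (D.sd j : ℝ) < c (Sum.inl (j : ℕ)) then 1 else 0 := by
      rw [← Equiv.sum_comp ρ]
      refine Finset.sum_congr rfl fun j _ => ?_
      have : c (Sum.inl (j : ℕ)) = σ.C (Sum.inl (ρ j)) := by
        rw [← hc]; simp [number]
      rw [this, h.sd]
      rfl
    rw [h1, Finset.card_filter, h.n_eq, Finset.sum_range]
  · refine le_trans (le_of_eq ?_) hσ₂
    rw [Finset.sum_range]
    refine Finset.sum_congr rfl fun j _ => ?_
    rw [h.w₂, ← hc]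
    rfl

end Sched

/-! ### The tournament tree -/

namespace Sched

prefix:max "◇" => Expr.var

section StoLemmas

variable (σ : Sto) (y : Var) (r : Arr) (a b : ℕ) (f g : ℕ → ℕ)

@[simp] theorem Sto.set_set : (σ.set y a).set y b = σ.set y b := by simp [Sto.set]

@[simp] theorem Sto.setArr_setArr : (σ.setArr r f).setArr r g = σ.setArr r g := by
  simp [Sto.setArr]

@[simp] theorem Sto.setArr_set : (σ.setArr r f).set y a = (σ.set y a).setArr r f := rfl

end StoLemmas

section StepLemmas

variable (a b : Expr) (y : Var) (r : Arr)

@[simp] theorem Expr.steps_two : (2 : Expr).steps = 1 := rfl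
@[simp] theorem Expr.steps_three : (3 : Expr).steps = 1 := rfl
@[simp] theorem Expr.steps_four : (4 : Expr).steps = 1 := rfl
@[simp] theorem Expr.steps_zero : (0 : Expr).steps = 1 := rfl
@[simp] theorem Expr.steps_one : (1 : Expr).steps = 1 := rfl
@[simp] theorem Expr.steps_len : Expr.len.steps = 2 := rfl
@[simp] theorem Expr.steps_var : (Expr.var y).steps = 2 := rfl
@[simp] theorem Expr.steps_add : (a + b).steps = a.steps + (b.steps + 1) := rfl
@[simp] theorem Expr.steps_sub : (a - b).steps = a.steps + (b.steps + 1) := rfl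
@[simp] theorem Expr.steps_mul : (a * b).steps = a.steps + (b.steps + 1) := rfl
@[simp] theorem Expr.steps_div : (a / b).steps = a.steps + (b.steps + 1) := rfl
@[simp] theorem Expr.steps_arr : (Expr.arr r a).steps = a.steps + 6 := rfl

end StepLemmas

namespace Runs

variable {x : List ℕ} {W T T₁ T₂ : ℕ} {c d : Cmd} {σ : Sto} {Q R : Sto → Prop} {e : Expr}

theorem trans (T₁ T₂ : ℕ) (h : Runs x W c σ T₁ R) (h' : ∀ τ, R τ → Runs x W d τ T₂ Q)
    (hT : T₁ + T₂ ≤ T) : Runs x W (c ⨾ d) σ T Q :=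
  (Runs.seq (h.mono le_rfl h')).mono hT fun _ => id

theorem wp_trans (T₂ : ℕ) (h : c.wp x W (fun τ => Runs x W d τ T₂ Q) σ)
    (hT : c.steps + T₂ ≤ T) : Runs x W (c ⨾ d) σ T Q :=
  (Runs.seq (of_wp h)).mono hT fun _ => id

theorem wp_le (h : c.wp x W Q σ) (hT : c.steps ≤ T) : Runs x W c σ T Q :=
  (of_wp h).mono hT fun _ => id

theorem loop_le (I : ℕ → Sto → Prop) (m N : ℕ) (h0 : I 0 σ)
    (hstep : ∀ i σ, I i σ → (e.eval x.length σ = 0 ∧ Q σ) ∨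
      (e.eval x.length σ ≠ 0 ∧ i < m ∧ Runs x W c σ N (I (i + 1))))
    (hT : m * (N + e.steps + 1) + e.steps + 1 ≤ T) : Runs x W (.loop e c) σ T Q :=
  (loop_const I m N h0 hstep).mono hT fun _ => id

end Runs

/-- The internal nodes `1, …, n - 1` hold the maximum of their children; the leaves are the nodes
`n, …, 2 n - 1`. -/
def IsTree (n : ℕ) (f : ℕ → ℕ) : Prop :=
  ∀ v, 1 ≤ v → v < n → f v = max (f (2 * v)) (f (2 * v + 1))

theorem IsTree.le_root {n : ℕ} {f : ℕ → ℕ} (h : IsTree n f) {v : ℕ} (hv : 1 ≤ v)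
    (hvn : v < 2 * n) : f v ≤ f 1 := by
  induction v using Nat.strong_induction_on with
  | _ v ih =>
    rcases hv.eq_or_lt with rfl | h1
    · exact le_rfl
    · refine le_trans ?_ (ih (v / 2) (by omega) (by omega) (by omega))
      rw [h (v / 2) (by omega) (by omega)]
      rcases Nat.mod_two_eq_zero_or_one v with h2 | h2
      · rw [show 2 * (v / 2) = v by omega]; exact le_max_left _ _
      · rw [show 2 * (v / 2) + 1 = v by omega]; exact le_max_right _ _

/-- Put the value `x` at the leaf `v`. -/
def updateLeaf : Cmd :=
  (.store .tree ◇.v ◇.x ⨾ .v ≔ ◇.v / 2) ⨾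
  .loop ◇.v
    (.store .tree ◇.v (.arr .tree (2 * ◇.v) +
        (.arr .tree (2 * ◇.v + 1) - .arr .tree (2 * ◇.v))) ⨾
      .v ≔ ◇.v / 2)

/-- Go to a leaf `v` of maximal value. -/
def findMax : Cmd :=
  .v ≔ 1 ⨾
  .loop (◇.n - ◇.v)
    (.ite (.arr .tree (2 * ◇.v + 1) - .arr .tree (2 * ◇.v)) (.v ≔ 2 * ◇.v + 1) (.v ≔ 2 * ◇.v))

/-- Set all the nodes to zero. -/
def clearTree : Cmd :=
  .u ≔ 0 ⨾ .loop (2 * ◇.n - ◇.u) (.store .tree ◇.u 0 ⨾ .u ≔ ◇.u + 1)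

/-- Changing a leaf invalidates its ancestors only, and these are repaired from the bottom up. For
`n = 1` the leaf is node 1 and nothing has to be repaired. -/
theorem runs_updateLeaf {x : List ℕ} {W n L : ℕ} {σ : Sto} (hL : n < 2 ^ L)
    (ht : IsTree n (σ.arr .tree)) (hv : n ≤ σ.val .v) (hv' : σ.val .v < 2 * n) :
    Runs x W updateLeaf σ (60 * (L + 1)) fun τ => ∃ f, τ = (σ.set .v 0).setArr .tree f ∧
      IsTree n f ∧ ∀ u ≥ n, f u = if u = σ.val .v then σ.val .x else σ.arr .tree u := by
  refine .of_bdd fun hb => ?_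
  have hbv := hb.val .v
  have hbx := hb.val .x
  refine .wp_trans (L * 53 + 10) ?_ (by simp [Cmd.steps]; omega)
  simp only [Cmd.wp, Expr.eval_var, Expr.eval_div, Expr.eval_two, Sto.setArr_set,
    Sto.setArr_val]
  refine ⟨hbx, by omega, ?_⟩
  set f₀ := Function.update (σ.arr .tree) (σ.val .v) (σ.val .x) with hf₀
  -- Among the internal nodes only `v` may differ from the maximum of its children. The bound on `v`
  -- halves in each round, and `v = 0` means that the root has been passed.
  refine .loop_le (fun i τ => ∃ v f, τ = (σ.set .v v).setArr .tree f ∧ v < 2 ^ (L - i) ∧ v < n ∧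
    (∀ u, 1 ≤ u → u < n → u ≠ v → f u = max (f (2 * u)) (f (2 * u + 1))) ∧
    ∀ u ≥ n, f u = f₀ u) L 50 ?_ ?_ (by simp)
  · refine ⟨σ.val .v / 2, f₀, rfl, ?_, by omega, fun u h1 h2 h3 => ?_, fun _ _ => rfl⟩
    · rw [Nat.sub_zero]; omega
    · simp only [hf₀]
      rw [Function.update_of_ne (by omega), Function.update_of_ne (by omega),
        Function.update_of_ne (by omega)]
      exact ht u h1 h2
  · rintro i τ ⟨v, f, rfl, h1, h2, h3, h4⟩
    simp only [Expr.eval_var, Sto.setArr_val, Sto.set_val_self]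
    by_cases hv0 : v = 0
    · subst hv0
      refine .inl ⟨rfl, f, rfl, fun u hu hun => h3 u hu hun (by omega), fun u hu => ?_⟩
      rw [h4 u hu, hf₀, Function.update_apply]
    · have hiL : i < L := by
        by_contra hcon
        rw [show L - i = 0 by omega] at h1
        omega
      refine .inr ⟨hv0, hiL, .of_bdd fun hb' => .wp_le ?_ (by simp [Cmd.steps])⟩
      have hb1 := hb'.arr .tree (2 * v)
      have hb2 := hb'.arr .tree (2 * v + 1)
      simp only [Cmd.wp, Expr.eval_var, Expr.eval_div, Expr.eval_two, Sto.setArr_set,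
        Sto.setArr_val, Expr.eval_add, Expr.eval_arr, Expr.eval_mul, Expr.eval_sub, Expr.eval_one,
        Sto.set_val_self, Sto.setArr_arr_self, Sto.setArr_setArr, Sto.set_set] at hb1 hb2 ⊢
      -- With truncated subtraction, `a + (b - a)` is the maximum.
      have hm : f (2 * v) + (f (2 * v + 1) - f (2 * v)) = max (f (2 * v)) (f (2 * v + 1)) := by
        omega
      refine ⟨by omega, by omega, v / 2, _, rfl, ?_, by omega, fun u hu hun huv => ?_,
        fun u hu => ?_⟩
      · have : 2 ^ (L - i) = 2 * 2 ^ (L - (i + 1)) := by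
          rw [← pow_succ']; congr 1; omega
        omega
      · rw [hm]
        by_cases huv' : u = v
        · subst huv'
          rw [Function.update_self, Function.update_of_ne (by omega),
            Function.update_of_ne (by omega)]
        · rw [Function.update_of_ne huv', Function.update_of_ne (by omega),
            Function.update_of_ne (by omega)]
          exact h3 u hu hun huv'
      · rw [Function.update_of_ne (by omega)]
        exact h4 u hu

theorem runs_findMax {x : List ℕ} {W n L : ℕ} {σ : Sto} (hL : n < 2 ^ L) (hn : 1 ≤ n)
    (hnσ : σ.val .n = n) (hW : 2 * n ≤ W) (ht : IsTree n (σ.arr .tree)) :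
    Runs x W findMax σ (60 * (L + 1)) fun τ => ∃ v, τ = σ.set .v v ∧ n ≤ v ∧ v < 2 * n ∧
      ∀ u ≥ n, u < 2 * n → σ.arr .tree u ≤ σ.arr .tree v := by
  refine .wp_trans (L * 50 + 10) ?_ (by simp [Cmd.steps]; omega)
  refine ⟨by simp; omega, ?_⟩
  -- The descent follows a child with the value of the root; `2 ^ i ≤ v` bounds the number of
  -- rounds.
  refine .loop_le (fun i τ => ∃ v, τ = σ.set .v v ∧ 2 ^ i ≤ v ∧ v < 2 * n ∧
    σ.arr .tree v = σ.arr .tree 1) L 44 ?_ ?_ (by simp)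
  · exact ⟨1, rfl, by simp, by omega, rfl⟩
  · rintro i τ ⟨v, rfl, h1, h2, h3⟩
    have h1' : 1 ≤ v := Nat.one_le_two_pow.trans h1
    simp only [Expr.eval_var, Sto.set_val_self, Expr.eval_sub, Sto.set_val_of_ne, ne_eq,
      reduceCtorEq, not_false_eq_true, hnσ]
    by_cases hvn : n ≤ v
    · refine .inl ⟨by omega, v, rfl, hvn, h2, fun u hu hu' => ?_⟩
      rw [h3]
      exact ht.le_root (by omega) hu'
    · have hiL : i < L := by
        by_contra hcon
        have := Nat.pow_le_pow_right (show 0 < 2 by norm_num) (not_lt.1 hcon)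
        omega
      have hmax := ht v h1' (by omega)
      refine .inr ⟨by omega, hiL, .wp_le ?_ (by simp [Cmd.steps])⟩
      simp only [Cmd.wp, Expr.eval_var, Expr.eval_two, Expr.eval_add, Expr.eval_arr,
        Expr.eval_mul, Expr.eval_sub, Expr.eval_one, Sto.set_val_self, Sto.set_arr, Sto.set_set]
      refine ⟨fun h => ⟨by omega, _, rfl, by rw [pow_succ]; omega, by omega, by omega⟩,
        fun h => ⟨by omega, _, rfl, by rw [pow_succ]; omega, by omega, by omega⟩⟩

theorem runs_clearTree {x : List ℕ} {W n : ℕ} {σ : Sto} (hnσ : σ.val .n = n)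
    (hW : 2 * n + 1 ≤ W) :
    Runs x W clearTree σ (60 * (n + 1)) fun τ => ∃ f, τ = (σ.set .u (2 * n)).setArr .tree f ∧
      ∀ u < 2 * n, f u = 0 := by
  refine .wp_trans (2 * n * 25 + 10) ?_ (by simp [Cmd.steps]; omega)
  refine ⟨by simp, ?_⟩
  refine .loop_le (fun i τ => i ≤ 2 * n ∧ ∃ f, τ = (σ.set .u i).setArr .tree f ∧
    ∀ u < i, f u = 0) (2 * n) 15 ?_ ?_ (by simp; omega)
  · exact ⟨by omega, σ.arr .tree, by simp [Sto.setArr, Sto.set], by simp⟩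
  · rintro i τ ⟨hi, f, rfl, h1⟩
    simp only [Expr.eval_var, Sto.set_val_self, Expr.eval_sub, Sto.set_val_of_ne, ne_eq,
      reduceCtorEq, not_false_eq_true, hnσ, Sto.setArr_val, Expr.eval_mul, Expr.eval_two]
    rcases hi.eq_or_lt with rfl | hlt
    · exact .inl ⟨by omega, f, rfl, h1⟩
    · refine .inr ⟨by omega, hlt, .wp_le ?_ (by simp [Cmd.steps])⟩
      simp only [Cmd.wp, Expr.eval_var, Expr.eval_zero, Expr.eval_add, Expr.eval_one,
        Sto.set_val_self, Sto.setArr_set, Sto.setArr_setArr, Sto.set_set, Sto.setArr_val]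
      refine ⟨by omega, by omega, by omega, _, rfl, fun u hu => ?_⟩
      rw [Function.update_apply]
      split_ifs with h
      · rfl
      · exact h1 u (by omega)

/-! ### The leaves as a multiset; the value 0 marks an empty leaf -/

/-- The positive values at the leaves. -/
def leaves (n : ℕ) (f : ℕ → ℕ) : Multiset ℕ :=
  ((Multiset.range n).map fun i => f (n + i)).filter (0 < ·)

theorem leaves_eq {n i : ℕ} (f : ℕ → ℕ) (hi : i < n) :
    leaves n f = (if 0 < f (n + i) then {f (n + i)} else 0) +
      (((Multiset.range n).erase i).map fun i => f (n + i)).filter (0 < ·) := by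
  rw [leaves]
  conv_lhs => rw [← Multiset.cons_erase (Multiset.mem_range.2 hi)]
  rw [Multiset.map_cons, Multiset.filter_cons]

theorem leaves_congr {n i : ℕ} {f f' : ℕ → ℕ} (h : ∀ u ≥ n, u ≠ n + i → f' u = f u) :
    (((Multiset.range n).erase i).map fun i => f' (n + i)).filter (0 < ·) =
      (((Multiset.range n).erase i).map fun i => f (n + i)).filter (0 < ·) := by
  congr 1
  refine Multiset.map_congr rfl fun j hj => h _ (by omega) fun hji => ?_
  have : j = i := by omega
  subst this
  exact (Multiset.Nodup.notMem_erase (Multiset.nodup_range n)) hj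

theorem leaves_insert {n i : ℕ} {f f' : ℕ → ℕ} (hi : i < n) (h : ∀ u ≥ n, u ≠ n + i → f' u = f u)
    (h0 : f (n + i) = 0) (h1 : 0 < f' (n + i)) : leaves n f' = f' (n + i) ::ₘ leaves n f := by
  rw [leaves_eq f hi, leaves_eq f' hi, leaves_congr h, if_pos h1, if_neg (by omega), zero_add,
    Multiset.singleton_add]

theorem leaves_erase {n i : ℕ} {f f' : ℕ → ℕ} (hi : i < n) (h : ∀ u ≥ n, u ≠ n + i → f' u = f u)
    (h0 : f' (n + i) = 0) (h1 : 0 < f (n + i)) : leaves n f' = (leaves n f).erase (f (n + i)) := by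
  rw [leaves_eq f hi, leaves_eq f' hi, leaves_congr h, if_pos h1, if_neg (by omega), zero_add,
    Multiset.singleton_add, Multiset.erase_cons_head]

theorem leaves_sup {n v : ℕ} {f : ℕ → ℕ} (hv : n ≤ v) (hv' : v < 2 * n)
    (h : ∀ u ≥ n, u < 2 * n → f u ≤ f v) (h0 : leaves n f ≠ 0) :
    (leaves n f).sup = f v ∧ 0 < f v := by
  have hle : ∀ b ∈ leaves n f, 0 < b ∧ b ≤ f v := by
    intro b hb
    obtain ⟨h1, h2⟩ := Multiset.mem_filter.1 hb
    obtain ⟨i, hi, rfl⟩ := Multiset.mem_map.1 h1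
    have := Multiset.mem_range.1 hi
    exact ⟨h2, h _ (by omega) (by omega)⟩
  obtain ⟨b, hb⟩ := Multiset.exists_mem_of_ne_zero h0
  have hpos : 0 < f v := by have := hle b hb; omega
  refine ⟨le_antisymm (Multiset.sup_le.2 fun b hb => (hle b hb).2) (Multiset.le_sup ?_), hpos⟩
  refine Multiset.mem_filter.2 ⟨Multiset.mem_map.2 ⟨v - n, Multiset.mem_range.2 (by omega), ?_⟩,
    hpos⟩
  congr 1
  omega

theorem leaves_zero {n : ℕ} {f : ℕ → ℕ} (h : ∀ u < 2 * n, f u = 0) : leaves n f = 0 := by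
  refine Multiset.filter_eq_nil.2 fun b hb => ?_
  obtain ⟨i, hi, rfl⟩ := Multiset.mem_map.1 hb
  have := Multiset.mem_range.1 hi
  simp [h (n + i) (by omega)]

theorem isTree_zero {n : ℕ} {f : ℕ → ℕ} (h : ∀ u < 2 * n, f u = 0) : IsTree n f := by
  intro v hv hvn
  simp [h v (by omega), h (2 * v) (by omega), h (2 * v + 1) (by omega)]

end Sched

/-! ### Testing a guess -/

namespace Sched

/-- Process the job of agent 2 in the slot. -/
def processJob₂ : Cmd :=
  (.input .x (4 + 2 * ◇.n + (◇.z - 1)) ⨾ .t ≔ ◇.t + ◇.x ⨾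
    .input .x (4 + 2 * ◇.n + ◇.k + (◇.z - 1)) ⨾ .cost ≔ ◇.cost + ◇.x * ◇.t ⨾
    .q ≔ ◇.q + 1 ⨾ .cnt ≔ 0) ⨾
  clearTree

/-- Remove the longest selected job. -/
def removeLongest : Cmd :=
  findMax ⨾
  (.t ≔ ◇.t - .arr .tree ◇.v ⨾ .tot ≔ ◇.tot - 1 ⨾ .cnt ≔ ◇.cnt - 1 ⨾ .x ≔ 0) ⨾
  updateLeaf

/-- Process the next job of agent 1. -/
def processJob₁ : Cmd :=
  (.x ≔ .arr .sp ◇.i ⨾ .v ≔ ◇.n + ◇.i ⨾ .t ≔ ◇.t + ◇.x ⨾ .tot ≔ ◇.tot + 1 ⨾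
    .cnt ≔ ◇.cnt + 1) ⨾
  updateLeaf ⨾
  -- A sum of truncated differences is nonzero exactly if one of the inequalities fails. The new job
  -- is already in the tree here, so it may itself be the one to go.
  .ite ((◇.t - .arr .sd ◇.i) + (◇.cnt - .arr .dig (◇.k + ◇.q))) removeLongest (.x ≔ 0) ⨾
  .i ≔ ◇.i + 1

def processSlot : Cmd :=
  .z ≔ .arr .slot ◇.s ⨾
  .ite ◇.z processJob₂ (.ite (◇.n - ◇.i) processJob₁ (.x ≔ 0)) ⨾
  .s ≔ ◇.s + 1

/-- The slots from `n + k` on are zero throughout, so the array then equals `slotOf g 0`, and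
`fillSlots` follows the recursion of `slotOf`. -/
def clearSlots : Cmd :=
  .i ≔ 0 ⨾ .loop (◇.n + ◇.k - ◇.i) (.store .slot ◇.i 0 ⨾ .i ≔ ◇.i + 1)

def fillSlots : Cmd :=
  .j ≔ 0 ⨾ .loop (◇.k - ◇.j) (.store .slot (.arr .dig ◇.j) (◇.j + 1) ⨾ .j ≔ ◇.j + 1)

def testGuess : Cmd :=
  clearSlots ⨾ fillSlots ⨾ clearTree ⨾
  (.t ≔ 0 ⨾ .cost ≔ 0 ⨾ .tot ≔ 0 ⨾ .q ≔ 0 ⨾ .i ≔ 0 ⨾ .cnt ≔ 0 ⨾ .s ≔ 0) ⨾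
  .loop (◇.n + ◇.k - ◇.s) processSlot ⨾
  .ite ((◇.k - ◇.q) + (◇.n - (◇.tot + ◇.A₁)) + (◇.cost - ◇.A₂)) (.x ≔ 0) (.res ≔ 1)

/-- The data of agent 2 are part of the input, and the numbers are bounded. -/
structure Setting (x : List ℕ) (D : Data) (k M W : ℕ) : Prop where
  len : x.length = 4 + 2 * D.n + 2 * k
  len_le : x.length ≤ M
  p₂ : ∀ j, D.p₂ j = x.getD (4 + 2 * D.n + j) 0
  w₂ : ∀ j, D.w₂ j = x.getD (4 + 2 * D.n + k + j) 0
  input_le : ∀ i, x.getD i 0 ≤ M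
  sp_le : ∀ i < D.n, D.sp i ≤ M
  sp_pos : ∀ i < D.n, 0 < D.sp i
  le_W : M ^ 4 ≤ W

/-- The program has read the instance and the guess is `g`. -/
structure Ready (D : Data) (k A₁ A₂ : ℕ) (g : ℕ → ℕ) (σ : Sto) : Prop where
  n : σ.val .n = D.n
  k : σ.val .k = k
  A₁ : σ.val .A₁ = A₁
  A₂ : σ.val .A₂ = A₂
  sp : σ.arr .sp = D.sp
  sd : σ.arr .sd = D.sd
  dig : σ.arr .dig = g

theorem Ready.of_eq {D : Data} {k A₁ A₂ : ℕ} {g : ℕ → ℕ} {σ τ : Sto} (h : Ready D k A₁ A₂ g σ)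
    (hn : τ.val .n = σ.val .n) (hk : τ.val .k = σ.val .k) (h₁ : τ.val .A₁ = σ.val .A₁)
    (h₂ : τ.val .A₂ = σ.val .A₂) (hsp : τ.arr .sp = σ.arr .sp) (hsd : τ.arr .sd = σ.arr .sd)
    (hdig : τ.arr .dig = σ.arr .dig) : Ready D k A₁ A₂ g τ :=
  ⟨hn.trans h.n, hk.trans h.k, h₁.trans h.A₁, h₂.trans h.A₂, hsp.trans h.sp, hsd.trans h.sd,
    hdig.trans h.dig⟩

/-- The state `σ` represents the state `a` of the greedy algorithm after `s` slots. -/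
structure SimRel (D : Data) (σ₀ : Sto) (s : ℕ) (a : SimState) (σ : Sto) : Prop where
  frame : ∀ y, y ∉ [Var.v, .x, .t, .cost, .tot, .q, .cnt, .s, .z, .u, .i] → σ.val y = σ₀.val y
  arr : ∀ r, r ≠ Arr.tree → σ.arr r = σ₀.arr r
  s : σ.val .s = s
  t : σ.val .t = a.t
  cost : σ.val .cost = a.cost
  tot : σ.val .tot = a.tot
  q : σ.val .q = a.q
  i : σ.val .i = a.i
  cnt : σ.val .cnt = a.S.card
  tree : IsTree D.n (σ.arr .tree)
  leaves : leaves D.n (σ.arr .tree) = a.S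
  zero : ∀ j, a.i ≤ j → j < D.n → σ.arr .tree (D.n + j) = 0

/-- Each of the `s` slots adds at most `M` to the time and at most `M * (s * M)` to the cost; with
`s ≤ M` this stays below `M ^ 4`. -/
structure SimBdd (D : Data) (M s : ℕ) (a : SimState) : Prop where
  t : a.t ≤ s * M
  cost : a.cost ≤ s * (M * (s * M))
  tot : a.tot ≤ s
  q : a.q ≤ s
  i : a.i ≤ D.n
  card : a.S.card ≤ s

theorem sim_bdd {D : Data} {M : ℕ} (hsp : ∀ i < D.n, D.sp i ≤ M) (hp : ∀ j, D.p₂ j ≤ M)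
    (hw : ∀ j, D.w₂ j ≤ M) (slot cap : ℕ → ℕ) (s : ℕ) : SimBdd D M s (sim D slot cap s) := by
  induction s with
  | zero => constructor <;> simp [sim]
  | succ s ih =>
    obtain ⟨h1, h2, h3, h4, h5, h6⟩ := ih
    rw [sim]
    generalize sim D slot cap s = a at *
    have e1 : (s + 1) * M = s * M + M := by ring
    have e2 : s * (M * (s * M)) ≤ s * (M * ((s + 1) * M)) := by gcongr; omega
    have e3 : (s + 1) * (M * ((s + 1) * M)) = s * (M * ((s + 1) * M)) + M * ((s + 1) * M) := by ring
    unfold simStep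
    split_ifs with hz hi hc
    · have e4 : D.w₂ (slot s - 1) * (a.t + D.p₂ (slot s - 1)) ≤ M * ((s + 1) * M) :=
        Nat.mul_le_mul (hw _) (by have := hp (slot s - 1); omega)
      exact ⟨by have := hp (slot s - 1); simp only; omega, by simp only; omega,
        by simp only; omega, by simp only; omega, h5, by simp⟩
    · have := hsp _ hi
      exact ⟨by simp only; omega, by simp only; omega, by simp only; omega, by simp only; omega,
        hi, by simpa using h6⟩
    · have := hsp _ hi
      have hcard := Multiset.card_erase_add_one (sup_mem_cons (D.sp a.i) a.S)
      rw [Multiset.card_cons] at hcard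
      exact ⟨by simp only; omega, by simp only; omega, by simp only; omega, by simp only; omega,
        hi, by simp only; omega⟩
    · exact ⟨by omega, by omega, by omega, by omega, h5, by omega⟩

variable {x : List ℕ} {D : Data} {k A₁ A₂ M W L : ℕ} {g : ℕ → ℕ} {σ₀ σ : Sto}

theorem Runs.ite_le {c d : Cmd} {e : Expr} {Q : Sto → Prop} {T : ℕ} (T₁ : ℕ)
    (h : e.eval x.length σ ≠ 0 → Runs x W c σ T₁ Q)
    (h' : e.eval x.length σ = 0 → Runs x W d σ T₁ Q) (hT : e.steps + (T₁ + 1) ≤ T) :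
    Runs x W (.ite e c d) σ T Q :=
  (Runs.ite h h').mono hT fun _ => id

/-- Since `n + k` is less than the length of the input, `s + 1 ≤ M`. The bounds leave room for one
more job, which is added before a job may be discarded. -/
theorem Setting.bounds (hS : Setting x D k M W) {s : ℕ} (hs : s < D.n + k) {a : SimState}
    (ha : SimBdd D M s a) : a.t + M ≤ W ∧ a.cost + M * (a.t + M) ≤ W ∧ a.tot + 1 ≤ W ∧
      a.q + 1 ≤ W ∧ a.i + 1 ≤ W ∧ a.S.card + 1 ≤ W ∧ 2 * D.n + 1 ≤ W ∧ s + 1 ≤ W := by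
  have h1 := hS.len
  have h2 := hS.len_le
  have h3 := hS.le_W
  have hM : 1 ≤ M := by omega
  have h4 : M * M ≤ M ^ 4 := by
    calc M * M = M ^ 2 := by ring
      _ ≤ M ^ 4 := Nat.pow_le_pow_right hM (by norm_num)
  have h5 : M ≤ M * M := Nat.le_mul_of_pos_left _ hM
  have h6 : (s + 1) * M ≤ M * M := Nat.mul_le_mul_right _ (by omega)
  have h7 : (s + 1) * M = s * M + M := by ring
  have h8 : (s + 1) * (M * ((s + 1) * M)) ≤ M ^ 4 := by
    calc (s + 1) * (M * ((s + 1) * M)) ≤ M * (M * (M * M)) := by gcongr; omega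
      _ = M ^ 4 := by ring
  have h9 : s * (M * (s * M)) + M * (a.t + M) ≤ (s + 1) * (M * ((s + 1) * M)) := by
    calc s * (M * (s * M)) + M * (a.t + M) ≤ s * (M * ((s + 1) * M)) + M * ((s + 1) * M) := by
          gcongr
          · omega
          · have := ha.t; omega
      _ = _ := by ring
  obtain ⟨a1, a2, a3, a4, a5, a6⟩ := ha
  refine ⟨?_, ?_, ?_, ?_, ?_, ?_, ?_, ?_⟩ <;> omega

theorem runs_processJob₂ (hS : Setting x D k M W) (hσ₀ : Ready D k A₁ A₂ g σ₀) {s : ℕ}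
    (hs : s < D.n + k) {a : SimState} (ha : SimBdd D M s a) (hr : SimRel D σ₀ s a σ)
    {z : ℕ} (hz : z ≠ 0) (hzk : z ≤ k) (hσz : σ.val .z = z) (cap : ℕ → ℕ) :
    Runs x W processJob₂ σ (200 * (D.n + 1)) (SimRel D σ₀ s (simStep D cap z a)) := by
  obtain ⟨b1, b2, b3, b4, b5, b6, b7, b8⟩ := hS.bounds hs ha
  have hn : σ.val .n = D.n := (hr.frame .n (by decide)).trans hσ₀.n
  have hk : σ.val .k = k := (hr.frame .k (by decide)).trans hσ₀.k
  have hlen := hS.len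
  have hp := hS.p₂ (z - 1)
  have hw := hS.w₂ (z - 1)
  have hpM := hS.input_le (4 + 2 * D.n + (z - 1))
  have hwM := hS.input_le (4 + 2 * D.n + k + (z - 1))
  rw [← hp] at hpM
  rw [← hw] at hwM
  have hcost : a.cost + D.w₂ (z - 1) * (a.t + D.p₂ (z - 1)) ≤ W :=
    le_trans (by gcongr) b2
  refine .wp_trans (60 * (D.n + 1)) ?_ (by simp [Cmd.steps]; omega)
  simp only [Cmd.wp, Expr.eval_var, Expr.eval_add, Expr.eval_mul, Expr.eval_sub, Expr.eval_one,
    Expr.eval_two, Expr.eval_four, Expr.eval_zero, Sto.set_val_self, Sto.set_val_of_ne, ne_eq,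
    reduceCtorEq, not_false_eq_true, hn, hk, hσz, hr.t, hr.cost, hr.q, ← hp, ← hw]
  refine ⟨by omega, by omega, by omega, hcost, by omega, by omega, ?_⟩
  refine (runs_clearTree (n := D.n) (by simp [hn]) (by omega)).mono le_rfl ?_
  rintro τ ⟨f, rfl, hf⟩
  rw [simStep, if_pos hz]
  refine ⟨fun y hy => ?_, fun r hr' => ?_, ?_, ?_, ?_, ?_, ?_, ?_, ?_, ?_, ?_, ?_⟩
  · simp only [List.mem_cons, not_or] at hy
    rw [← hr.frame y (by simp [hy])]
    simp [hy]
  · simpa [hr'] using hr.arr r hr'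
  all_goals simp [hr.s, hr.tot, hr.i]
  · exact isTree_zero hf
  · exact leaves_zero hf
  · exact fun j _ hj => hf _ (by omega)

theorem runs_processJob₁ (hS : Setting x D k M W) (hσ₀ : Ready D k A₁ A₂ g σ₀)
    (hL : D.n < 2 ^ L) {s : ℕ} (hs : s < D.n + k) {a : SimState} (ha : SimBdd D M s a)
    (hr : SimRel D σ₀ s a σ) (hi : a.i < D.n) :
    Runs x W processJob₁ σ (400 * (L + 1))
      (SimRel D σ₀ s (simStep D (fun q => g (k + q)) 0 a)) := by
  obtain ⟨b1, b2, b3, b4, b5, b6, b7, b8⟩ := hS.bounds hs ha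
  have hn : σ.val .n = D.n := (hr.frame .n (by decide)).trans hσ₀.n
  have hk : σ.val .k = k := (hr.frame .k (by decide)).trans hσ₀.k
  have hsp : σ.arr .sp = D.sp := (hr.arr .sp (by decide)).trans hσ₀.sp
  have hsd : σ.arr .sd = D.sd := (hr.arr .sd (by decide)).trans hσ₀.sd
  have hdig : σ.arr .dig = g := (hr.arr .dig (by decide)).trans hσ₀.dig
  have hspM := hS.sp_le _ hi
  have hpos := hS.sp_pos _ hi
  refine .wp_trans (300 * (L + 1)) ?_ (by simp [Cmd.steps]; omega)
  simp only [Cmd.wp, Expr.eval_var, Expr.eval_add, Expr.eval_arr, Expr.eval_one,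
    Sto.set_val_self, Sto.set_val_of_ne, ne_eq, reduceCtorEq, not_false_eq_true, hn, hr.i, hr.t,
    hr.tot, hr.cnt, hsp]
  refine ⟨by omega, by omega, by omega, by omega, by omega, ?_⟩
  refine .trans (60 * (L + 1)) (220 * (L + 1)) (runs_updateLeaf (n := D.n) hL (by simpa using
    hr.tree) (by simp) (by simp; omega)) ?_ (by omega)
  rintro τ ⟨f, rfl, hf, hfu⟩
  simp only [Sto.set_val_self, Sto.set_val_of_ne, ne_eq, reduceCtorEq, not_false_eq_true,
    Sto.set_arr] at hfu
  have hfi : f (D.n + a.i) = D.sp a.i := by rw [hfu _ (by omega), if_pos rfl]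
  have hlv : leaves D.n f = D.sp a.i ::ₘ a.S := by
    rw [leaves_insert (f := σ.arr .tree) hi (fun u hu hne => by rw [hfu u hu, if_neg hne])
      (hr.zero _ le_rfl hi) (by rw [hfi]; exact hpos), hfi, hr.leaves]
  have hfz : ∀ j, a.i + 1 ≤ j → j < D.n → f (D.n + j) = 0 := fun j hj hjn => by
    rw [hfu _ (by omega), if_neg (by omega), hr.zero j (by omega) hjn]
  refine .trans (205 * (L + 1)) 10 (R := fun τ => τ.val .i = a.i ∧
    SimRel D σ₀ s (simStep D (fun q => g (k + q)) 0 a) (τ.set .i (a.i + 1))) ?_ ?_ (by omega)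
  · refine .ite_le (170 * (L + 1)) ?_ ?_ (by simp; omega)
    all_goals
      simp only [Expr.eval_var, Expr.eval_add, Expr.eval_sub, Expr.eval_arr, Sto.set_val_self,
        Sto.set_val_of_ne, ne_eq, reduceCtorEq, not_false_eq_true, Sto.setArr_val, Sto.set_arr,
        Sto.setArr_arr_of_ne, hk, hr.i, hr.q, hsd, hdig]
      intro hcond
    · have hcond' : ¬ (a.t + D.sp a.i ≤ D.sd a.i ∧ a.S.card + 1 ≤ g (k + a.q)) := by omega
      refine .trans (60 * (L + 1)) (110 * (L + 1)) (runs_findMax (n := D.n) hL (by omega)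
        (by simp [hn]) (by omega) (by simpa using hf)) ?_ (by omega)
      rintro τ ⟨v, rfl, hv1, hv2, hv3⟩
      simp only [Sto.setArr_arr_self] at hv3
      obtain ⟨hsup, hvpos⟩ := leaves_sup hv1 hv2 hv3 (by rw [hlv]; exact Multiset.cons_ne_zero)
      refine .wp_trans (60 * (L + 1)) ?_ (by simp [Cmd.steps]; omega)
      simp only [Cmd.wp, Expr.eval_var, Expr.eval_sub, Expr.eval_arr, Expr.eval_one,
        Expr.eval_zero, Sto.set_val_self, Sto.set_val_of_ne, ne_eq, reduceCtorEq,
        not_false_eq_true, Sto.setArr_val, Sto.setArr_arr_self, Sto.setArr_set]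
      refine ⟨by omega, by omega, by omega, by omega, ?_⟩
      refine (runs_updateLeaf (n := D.n) hL (by simpa using hf) (by simpa using hv1)
        (by simpa using hv2)).mono le_rfl ?_
      rintro τ ⟨f', rfl, hf', hfu'⟩
      simp only [Sto.setArr_val, Sto.set_val_self, Sto.set_val_of_ne, ne_eq, reduceCtorEq,
        not_false_eq_true, Sto.setArr_arr_self] at hfu'
      have hlv' : leaves D.n f' = (D.sp a.i ::ₘ a.S).erase (D.sp a.i ::ₘ a.S).sup := by
        have e : v = D.n + (v - D.n) := by omega
        rw [leaves_erase (f := f) (i := v - D.n) (by omega) (fun u hu hne => ?_) ?_ ?_, ← e,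
          ← hsup, hlv]
        · rw [← e, hfu' v hv1, if_pos rfl]
        · rw [← e]; exact hvpos
        · rw [hfu' u hu, if_neg (by omega)]
      have hcard := Multiset.card_erase_add_one (sup_mem_cons (D.sp a.i) a.S)
      rw [Multiset.card_cons] at hcard
      refine ⟨by simp [hr.i], ?_⟩
      rw [simStep, if_neg (by simp), if_pos hi, if_neg hcond']
      refine ⟨fun y hy => ?_, fun r hr' => ?_, ?_, ?_, ?_, ?_, ?_, ?_, ?_, ?_, ?_, ?_⟩
      · simp only [List.mem_cons, not_or] at hy
        rw [← hr.frame y (by simp [hy])]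
        simp [hy]
      · simpa [hr'] using hr.arr r hr'
      all_goals simp [hr.s, hr.cost, hr.q, -Multiset.sup_cons]
      · rw [← hsup, hlv]
      · omega
      · exact hf'
      · exact hlv'
      · intro j hj hjn
        rw [hfu' _ (by omega)]
        split_ifs
        · rfl
        · exact hfz j hj hjn
    · have hcond' : a.t + D.sp a.i ≤ D.sd a.i ∧ a.S.card + 1 ≤ g (k + a.q) := by omega
      refine .wp_le ?_ (by simp [Cmd.steps]; omega)
      refine ⟨by simp, by simp [hr.i], ?_⟩
      rw [simStep, if_neg (by simp), if_pos hi, if_pos hcond']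
      refine ⟨fun y hy => ?_, fun r hr' => ?_, ?_, ?_, ?_, ?_, ?_, ?_, ?_, ?_, ?_, ?_⟩
      · simp only [List.mem_cons, not_or] at hy
        rw [← hr.frame y (by simp [hy])]
        simp [hy]
      · simpa [hr'] using hr.arr r hr'
      all_goals simp [hr.s, hr.cost, hr.q]
      · exact hf
      · exact hlv
      · exact hfz
  · rintro τ ⟨hτi, hτ⟩
    refine .wp_le ⟨?_, ?_⟩ (by simp [Cmd.steps])
    · simp [hτi]; omega
    · simpa [hτi] using hτ

theorem runs_processSlot (hS : Setting x D k M W) (hσ₀ : Ready D k A₁ A₂ g σ₀)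
    (hslot : σ₀.arr .slot = slotOf g k) (hL : D.n < 2 ^ L) {s : ℕ} (hs : s < D.n + k)
    {a : SimState} (ha : SimBdd D M s a) (hr : SimRel D σ₀ s a σ) :
    Runs x W processSlot σ (450 * (L + 1) + if slotOf g k s ≠ 0 then 200 * (D.n + 1) else 0)
      (SimRel D σ₀ (s + 1) (simStep D (fun q => g (k + q)) (slotOf g k s) a)) := by
  obtain ⟨b1, b2, b3, b4, b5, b6, b7, b8⟩ := hS.bounds hs ha
  have hn : σ.val .n = D.n := (hr.frame .n (by decide)).trans hσ₀.n
  have hslot' : σ.arr .slot = slotOf g k := (hr.arr .slot (by decide)).trans hslot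
  have hlen := hS.len
  have hlen' := hS.len_le
  have hzk : slotOf g k s ≤ k := by
    by_cases h : slotOf g k s = 0
    · omega
    · exact (slotOf_spec h).1
  have hMW : M ≤ W := by omega
  set z := slotOf g k s with hz
  set T := 400 * (L + 1) + if z ≠ 0 then 200 * (D.n + 1) else 0 with hT
  refine .wp_trans (T + 30) ?_ (by
    simp only [Cmd.steps, Expr.steps_var, Expr.steps_arr]; omega)
  refine ⟨by simp [hslot', hr.s, ← hz]; omega, ?_⟩
  simp only [Expr.eval_arr, Expr.eval_var, hslot', hr.s, ← hz]
  have hr' : SimRel D σ₀ s a (σ.set .z z) := by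
    refine ⟨fun y hy => ?_, fun r hr' => by simpa using hr.arr r hr', ?_, ?_, ?_, ?_, ?_, ?_, ?_,
      hr.tree, hr.leaves, hr.zero⟩
    · simp only [List.mem_cons, not_or] at hy
      rw [← hr.frame y (by simp [hy])]
      simp [hy]
    all_goals simp [hr.s, hr.t, hr.cost, hr.tot, hr.q, hr.i, hr.cnt]
  refine .trans (T + 12) 10 (R := SimRel D σ₀ s (simStep D (fun q => g (k + q)) z a)) ?_ ?_
    (by omega)
  · refine .ite_le (T + 8) (fun h => ?_) (fun h => ?_) (by simp; omega)
    all_goals simp only [Expr.eval_var, Sto.set_val_self] at h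
    · refine (runs_processJob₂ hS hσ₀ hs ha hr' h hzk (by simp) _).mono ?_ fun _ => id
      rw [hT, if_pos h]; omega
    · rw [h] at hr' ⊢
      refine .ite_le T (fun h' => ?_) (fun h' => ?_) (by simp; omega)
      all_goals simp [hn, hr.i] at h'
      · exact (runs_processJob₁ hS hσ₀ hL hs ha hr' (by omega)).mono (by omega) fun _ => id
      · refine .wp_le ⟨by simp, ?_⟩ (by simp [Cmd.steps]; omega)
        rw [simStep, if_neg (by simp), if_neg (by omega)]
        refine ⟨fun y hy => ?_, fun r hr'' => by simpa using hr'.arr r hr'', ?_, ?_, ?_, ?_, ?_,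
          ?_, ?_, hr.tree, hr.leaves, hr.zero⟩
        · have hy' := hy
          simp only [List.mem_cons, not_or] at hy
          rw [← hr'.frame y hy']
          simp [hy]
        all_goals simp [hr.s, hr.t, hr.cost, hr.tot, hr.q, hr.i, hr.cnt]
  · intro τ hτ
    refine .wp_le ⟨by simp [hτ.s]; omega, ?_⟩ (by simp [Cmd.steps])
    refine ⟨fun y hy => ?_, fun r hr' => by simpa using hτ.arr r hr', ?_, ?_, ?_, ?_, ?_, ?_, ?_,
      hτ.tree, hτ.leaves, hτ.zero⟩
    · have hy' := hy
      simp only [List.mem_cons, not_or] at hy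
      rw [← hτ.frame y hy']
      simp [hy]
    all_goals simp [hτ.s, hτ.t, hτ.cost, hτ.tot, hτ.q, hτ.i, hτ.cnt]

/-- At most `k` slots lead to the expensive clearing of the tree, so these clearings contribute `k
(n + 1)` and not `(n + k) (n + 1)` to a test. -/
theorem card_slotOf_le (g : ℕ → ℕ) (k m : ℕ) :
    ((Finset.range m).filter fun s => slotOf g k s ≠ 0).card ≤ k := by
  have h := Finset.card_le_card_of_injOn (s := (Finset.range m).filter fun s => slotOf g k s ≠ 0)
    (t := Finset.Icc 1 k) (slotOf g k) (fun s hs => ?_) fun s hs s' _ h =>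
      slotOf_inj (Finset.mem_filter.1 hs).2 h
  · simpa using h
  · have h0 := (Finset.mem_filter.1 hs).2
    simp only [Finset.coe_Icc, Set.mem_Icc]
    exact ⟨by omega, (slotOf_spec h0).1⟩

/-- The number of steps for a test, up to a constant factor. -/
def testCost (n k L : ℕ) : ℕ := (n + k + 1) * (L + 1) + k * (n + 1)

theorem runs_testGuess (hS : Setting x D k M W) (hσ : Ready D k A₁ A₂ g σ) (hL : D.n < 2 ^ L)
    (hg : ∀ j < k, g j < D.n + k) (hslot : ∀ s ≥ D.n + k, σ.arr .slot s = 0) :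
    Runs x W testGuess σ (1000 * testCost D.n k L) fun τ => Ready D k A₁ A₂ g τ ∧
      (∀ s ≥ D.n + k, τ.arr .slot s = 0) ∧ τ.val .more = σ.val .more ∧
      (Accepts D k A₁ A₂ g → τ.val .res = 1) ∧
      (¬ Accepts D k A₁ A₂ g → τ.val .res = σ.val .res) := by
  have hlen := hS.len
  have hlen' := hS.len_le
  have hMW : M ≤ W := (Nat.le_self_pow (by norm_num) M).trans hS.le_W
  have hA : (D.n + k + 1) * (L + 1) ≥ D.n + k + 1 := Nat.le_mul_of_pos_right _ (by omega)
  have hcost : 450 * ((D.n + k) * (L + 1)) + 200 * (k * (D.n + 1)) + 400 * (D.n + k + 1) ≤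
      1000 * testCost D.n k L := by
    rw [testCost]
    have : (D.n + k + 1) * (L + 1) = (D.n + k) * (L + 1) + (L + 1) := by ring
    omega
  set B := 450 * ((D.n + k) * (L + 1)) + 200 * (k * (D.n + 1)) with hB
  clear_value B
  refine .trans (40 * (D.n + k + 1)) (B + 350 * (D.n + k + 1))
    (R := fun τ => ∃ i, τ = (σ.set .i i).setArr .slot fun _ => 0) ?_ ?_ (by linarith)
  · refine .wp_trans ((D.n + k) * 30 + 20) ⟨by simp, ?_⟩ (by simp [Cmd.steps]; omega)
    refine .loop_le (fun i τ => i ≤ D.n + k ∧ ∃ f, τ = (σ.set .i i).setArr .slot f ∧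
      (∀ s < i, f s = 0) ∧ ∀ s ≥ D.n + k, f s = 0) (D.n + k) 15 ?_ ?_ (by simp; omega)
    · exact ⟨by omega, σ.arr .slot, by simp [Sto.setArr, Sto.set], by simp, hslot⟩
    · rintro i τ ⟨hi, f, rfl, h1, h2⟩
      simp only [Expr.eval_sub, Expr.eval_add, Expr.eval_var, Sto.setArr_val, Sto.set_val_self,
        Sto.set_val_of_ne, ne_eq, reduceCtorEq, not_false_eq_true, hσ.n, hσ.k]
      rcases hi.eq_or_lt with rfl | hlt
      · refine .inl ⟨by omega, D.n + k, ?_⟩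
        congr 1
        funext s
        rcases lt_or_ge s (D.n + k) with h | h
        · exact h1 s h
        · exact h2 s h
      · refine .inr ⟨by omega, hlt, .wp_le ?_ (by simp [Cmd.steps])⟩
        simp only [Cmd.wp, Expr.eval_var, Expr.eval_zero, Expr.eval_add, Expr.eval_one,
          Sto.setArr_val, Sto.set_val_self, Sto.setArr_set, Sto.setArr_setArr, Sto.set_set,
          Sto.setArr_arr_self]
        refine ⟨by omega, by omega, by omega, _, rfl, fun s hs => ?_, fun s hs => ?_⟩
        · rw [Function.update_apply]
          split_ifs
          · rfl
          · exact h1 s (by omega)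
        · rw [Function.update_of_ne (by omega)]
          exact h2 s hs
  rintro τ ⟨i₁, rfl⟩
  refine .trans (40 * (D.n + k + 1))
    (B + 310 * (D.n + k + 1))
    (R := fun τ => ∃ i j, τ = ((σ.set .i i).set .j j).setArr .slot (slotOf g k)) ?_ ?_ (by linarith)
  · refine .wp_trans (k * 40 + 20) ⟨by simp, ?_⟩ (by simp [Cmd.steps]; omega)
    refine .loop_le (fun j τ => j ≤ k ∧
      τ = ((σ.set .i i₁).set .j j).setArr .slot (slotOf g j)) k 28 ?_ ?_ (by simp; omega)
    · exact ⟨by omega, by simp [slotOf]⟩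
    · rintro j τ ⟨hj, rfl⟩
      simp only [Expr.eval_sub, Expr.eval_var, Sto.setArr_val, Sto.set_val_self,
        Sto.set_val_of_ne, ne_eq, reduceCtorEq, not_false_eq_true, hσ.k]
      rcases hj.eq_or_lt with rfl | hlt
      · exact .inl ⟨by omega, i₁, j, rfl⟩
      · refine .inr ⟨by omega, hlt, .wp_le ?_ (by simp [Cmd.steps])⟩
        simp only [Cmd.wp, Expr.eval_var, Expr.eval_add, Expr.eval_one, Expr.eval_arr,
          Sto.setArr_val, Sto.set_val_self, Sto.setArr_set, Sto.setArr_setArr, Sto.set_set,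
          Sto.setArr_arr_self, Sto.setArr_arr_of_ne, ne_eq, reduceCtorEq, not_false_eq_true,
          Sto.set_arr, hσ.dig]
        exact ⟨by omega, by omega, by omega, rfl⟩
  rintro τ ⟨i₂, j₂, rfl⟩
  refine .trans (60 * (D.n + 1))
    (B + 250 * (D.n + k + 1))
    (runs_clearTree (n := D.n) (by simp [hσ.n]) (by omega)) ?_ (by linarith)
  rintro τ ⟨f, rfl, hf⟩
  refine .wp_trans
    (B + 200 * (D.n + k + 1)) ?_
    (by simp [Cmd.steps]; omega)
  refine ⟨by simp, by simp, by simp, by simp, by simp, by simp, by simp, ?_⟩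
  set σ₀ := ((((σ.set .i i₂).set .j j₂).setArr .slot (slotOf g k)).set .u (2 * D.n)).setArr
    .tree f with hσ₀
  have hready : Ready D k A₁ A₂ g σ₀ :=
    hσ.of_eq (by simp [hσ₀]) (by simp [hσ₀]) (by simp [hσ₀]) (by simp [hσ₀]) (by simp [hσ₀])
      (by simp [hσ₀]) (by simp [hσ₀])
  have hslot₀ : σ₀.arr .slot = slotOf g k := by simp [hσ₀]
  have hp : ∀ j, D.p₂ j ≤ M := fun j => (hS.p₂ j).le.trans (hS.input_le _)
  have hw : ∀ j, D.w₂ j ≤ M := fun j => (hS.w₂ j).le.trans (hS.input_le _)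
  have hbdd := sim_bdd hS.sp_le hp hw (slotOf g k) (fun q => g (k + q))
  refine .trans (B + 150 * (D.n + k + 1)) 40
    (R := SimRel D σ₀ (D.n + k) (sim D (slotOf g k) (fun q => g (k + q)) (D.n + k))) ?_ ?_
    (by omega)
  · refine (Runs.loop (fun s τ => s ≤ D.n + k ∧
      SimRel D σ₀ s (sim D (slotOf g k) (fun q => g (k + q)) s) τ) (D.n + k)
      (fun s => 450 * (L + 1) + if slotOf g k s ≠ 0 then 200 * (D.n + 1) else 0) ?_ ?_).mono ?_
      fun _ => id
    · refine ⟨by omega, fun y hy => ?_, fun r hr => ?_, ?_, ?_, ?_, ?_, ?_, ?_, ?_, ?_, ?_, ?_⟩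
      · simp only [List.mem_cons, not_or] at hy
        simp [hy]
      · simp
      all_goals simp [sim]
      · simpa [hσ₀] using isTree_zero hf
      · simpa [hσ₀] using leaves_zero hf
      · intro j hj
        simpa [hσ₀] using hf _ (by omega)
    · rintro s τ ⟨hs, hτ⟩
      have e1 : τ.val .n = D.n := (hτ.frame .n (by decide)).trans hready.n
      have e2 : τ.val .k = k := (hτ.frame .k (by decide)).trans hready.k
      simp only [Expr.eval_sub, Expr.eval_add, Expr.eval_var, e1, e2, hτ.s]
      rcases hs.eq_or_lt with rfl | hlt
      · exact .inl ⟨by omega, hτ⟩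
      · exact .inr ⟨by omega, hlt,
          (runs_processSlot hS hready hslot₀ hL hlt (hbdd s) hτ).mono le_rfl
            fun τ' hτ' => ⟨by omega, hτ'⟩⟩
    · have e : ∑ s ∈ Finset.range (D.n + k), (if slotOf g k s ≠ 0 then 200 * (D.n + 1) else 0) ≤
          200 * (k * (D.n + 1)) := by
        rw [← Finset.sum_filter, Finset.sum_const, smul_eq_mul]
        have := Nat.mul_le_mul_right (200 * (D.n + 1)) (card_slotOf_le g k (D.n + k))
        linarith
      simp only [Finset.sum_add_distrib, Finset.sum_const, Finset.card_range, smul_eq_mul,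
        Expr.steps_sub, Expr.steps_add, Expr.steps_var, mul_one]
      have e2 : (D.n + k) * (450 * (L + 1)) = 450 * ((D.n + k) * (L + 1)) := by ring
      omega
  · intro τ hτ
    have hr : Ready D k A₁ A₂ g τ :=
      hready.of_eq (hτ.frame _ (by decide)) (hτ.frame _ (by decide)) (hτ.frame _ (by decide))
        (hτ.frame _ (by decide)) (hτ.arr _ (by decide)) (hτ.arr _ (by decide))
        (hτ.arr _ (by decide))
    -- The entries of a guess are below `n + k`, so the slots beyond stay zero, as the next test
    -- requires.
    have hsl : ∀ s ≥ D.n + k, τ.arr .slot s = 0 := by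
      intro s hs
      rw [hτ.arr _ (by decide), hslot₀]
      by_contra hne
      obtain ⟨h1, h2⟩ := slotOf_spec hne
      have := hg (slotOf g k s - 1) (by omega)
      omega
    have hmore : τ.val .more = σ.val .more := (hτ.frame _ (by decide)).trans (by simp [hσ₀])
    have hres : τ.val .res = σ.val .res := (hτ.frame _ (by decide)).trans (by simp [hσ₀])
    have hacc : Accepts D k A₁ A₂ g ↔ (k - τ.val .q) + (D.n - (τ.val .tot + A₁)) +
        (τ.val .cost - A₂) = 0 := by
      simp only [Accepts, hτ.q, hτ.tot, hτ.cost]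
      omega
    refine .ite_le 5 (fun h => ?_) (fun h => ?_) (by simp)
    all_goals
      simp only [Expr.eval_add, Expr.eval_sub, Expr.eval_var, hr.n, hr.k, hr.A₁, hr.A₂] at h
      refine .wp_le ⟨by simp; try omega, ?_⟩ (by simp [Cmd.steps])
      refine ⟨hr.of_eq (by simp) (by simp) (by simp) (by simp) (by simp) (by simp) (by simp),
        by simpa using hsl, by simpa using hmore, fun h' => ?_, fun h' => ?_⟩
    · exact absurd (hacc.1 h') h
    · simpa using hres
    · simp
    · exact absurd (hacc.2 h) h'

end Sched

/-! ### Enumeration of the guesses -/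

namespace Sched

/-- The guess number `N`: its first `2 k` entries are the digits of `N` in base `n + k`. -/
def digits (n k N p : ℕ) : ℕ :=
  if p < 2 * k then N / (n + k) ^ p % (n + k) else if p = 2 * k then n else 0

theorem exists_digits {n k : ℕ} {g : ℕ → ℕ} (hg : ∀ p < 2 * k, g p < n + k) :
    ∃ N < (n + k) ^ (2 * k), ∀ p < 2 * k, digits n k N p = g p := by
  obtain ⟨N, hN⟩ := finFunctionFinEquiv.symm.surjective
    (fun p : Fin (2 * k) => (⟨g p, hg p p.2⟩ : Fin (n + k)))
  refine ⟨N, N.2, fun p hp => ?_⟩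
  have := congrArg Fin.val (congrFun hN ⟨p, hp⟩)
  rw [digits, if_pos hp]
  simpa using this

/-- Soundness holds for every guess; for completeness it suffices to meet the first `2 k` entries,
which are arbitrary digits in base `n + k`. -/
theorem exists_accepts_iff {I : TwoAgentInstance} {D : Data} {ρ : Equiv.Perm (Fin I.n)}
    (h : Fits I D ρ) : (∃ N < (D.n + I.k) ^ (2 * I.k),
      Accepts D I.k I.A₁ I.A₂ (digits D.n I.k N)) ↔ I.IsYes := by
  refine ⟨fun ⟨N, _, hN⟩ => hN.isYes h, fun hI => ?_⟩
  obtain ⟨g, hg, hacc⟩ := IsYes.exists_guess h hI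
  rw [h.n_eq]
  obtain ⟨N, hN, hNg⟩ := exists_digits hg
  exact ⟨N, hN, hacc _ hNg (by simp [digits])⟩

theorem digits_low {n k N i p : ℕ} (hN : (n + k) ^ i ∣ N + 1) (hp : p < i) (hpk : p < 2 * k) :
    digits n k (N + 1) p = 0 := by
  rw [digits, if_pos hpk]
  apply Nat.mod_eq_zero_of_dvd
  apply Nat.dvd_div_of_mul_dvd
  rw [← pow_succ]
  exact (pow_dvd_pow _ hp).trans hN

/-- The carry passes digit `i` exactly if this digit is the largest one; divisibility of `N + 1`
records how far the carry has come. -/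
theorem pow_dvd_succ_iff {B N i : ℕ} (hB : 0 < B) (hN : B ^ i ∣ N + 1) :
    B ^ (i + 1) ∣ N + 1 ↔ N / B ^ i % B + 1 = B := by
  have h1 : (N + 1) / B ^ i = N / B ^ i + 1 := by rw [Nat.succ_div, if_pos hN]
  have h2 := Nat.mod_lt (N / B ^ i) hB
  rw [pow_succ, ← Nat.dvd_div_iff_mul_dvd hN, h1]
  generalize N / B ^ i = m at *
  have h3 : B ∣ m + 1 ↔ B ∣ m % B + 1 := by
    conv_lhs => rw [← Nat.div_add_mod m B, add_assoc]
    exact Nat.dvd_add_right (Nat.dvd_mul_right B _)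
  rw [h3]
  exact ⟨fun h => le_antisymm h2 (Nat.le_of_dvd (by omega) h), fun h => dvd_of_eq h.symm⟩

theorem digits_self {n k N i : ℕ} (hN : (n + k) ^ i ∣ N + 1) (hi : i < 2 * k)
    (h : digits n k N i + 1 < n + k) : digits n k (N + 1) i = digits n k N i + 1 := by
  rw [digits, if_pos hi] at *
  rw [digits, if_pos hi, Nat.succ_div, if_pos hN, Nat.add_mod, Nat.mod_eq_of_lt (a := 1) (by omega),
    Nat.mod_eq_of_lt h]

theorem digits_high {n k N i p : ℕ} (hN : ¬ (n + k) ^ i ∣ N + 1) (hp : i ≤ p) :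
    digits n k (N + 1) p = digits n k N p := by
  unfold digits
  rw [Nat.succ_div, if_neg fun h => hN ((pow_dvd_pow _ hp).trans h), add_zero]

/-- Go to the next guess, if there is one. -/
def nextGuess : Cmd :=
  (.p ≔ 0 ⨾ .carry ≔ 1) ⨾
  .loop (◇.carry * (2 * ◇.k - ◇.p))
    (.ite (◇.n + ◇.k - (.arr .dig ◇.p + 1))
      (.store .dig ◇.p (.arr .dig ◇.p + 1) ⨾ .carry ≔ 0)
      (.store .dig ◇.p 0 ⨾ .p ≔ ◇.p + 1)) ⨾
  .more ≔ 1 - ◇.carry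

/-- Test all the guesses. -/
def search : Cmd :=
  (.store .dig (2 * ◇.k) ◇.n ⨾ .res ≔ 0 ⨾ .more ≔ 1) ⨾ .loop ◇.more (testGuess ⨾ nextGuess)

variable {x : List ℕ} {D : Data} {k A₁ A₂ M W L : ℕ} {σ : Sto}

theorem runs_nextGuess (hW : D.n + 2 * k + 1 ≤ W) {N : ℕ} (hN : N < (D.n + k) ^ (2 * k))
    (hσ : Ready D k A₁ A₂ (digits D.n k N) σ) :
    Runs x W nextGuess σ (200 * (k + 1)) fun τ => Ready D k A₁ A₂ (digits D.n k (N + 1)) τ ∧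
      τ.arr .slot = σ.arr .slot ∧ τ.val .res = σ.val .res ∧
      (τ.val .more = 0 ↔ N + 1 = (D.n + k) ^ (2 * k)) := by
  refine .wp_trans (200 * k + 100) ⟨by simp, by simp; omega, ?_⟩ (by simp [Cmd.steps]; omega)
  refine .trans (200 * k + 50) 10 (R := fun τ => ∃ p c, c ≤ 1 ∧
    τ = ((σ.set .p p).set .carry c).setArr .dig (digits D.n k (N + 1)) ∧
    (c = 1 ↔ N + 1 = (D.n + k) ^ (2 * k))) ?_ ?_ (by omega)
  -- Either the carry is still moving, with the digits below `i` reset to zero, or it has been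
  -- absorbed and the array holds the next guess.
  · refine .loop_le (fun i τ => (∃ f, τ = ((σ.set .p i).set .carry 1).setArr .dig f ∧ i ≤ 2 * k ∧
        (D.n + k) ^ i ∣ N + 1 ∧ (∀ p < i, f p = 0) ∧ ∀ p ≥ i, f p = digits D.n k N p) ∨
      ∃ p, τ = ((σ.set .p p).set .carry 0).setArr .dig (digits D.n k (N + 1)) ∧
        N + 1 ≠ (D.n + k) ^ (2 * k)) (2 * k) 60 ?_ ?_ (by simp; omega)
    · refine .inl ⟨σ.arr .dig, ?_, by omega, by simp, by simp, fun p _ => by rw [hσ.dig]⟩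
      simp [Sto.setArr, Sto.set]
    · rintro i τ (⟨f, rfl, hi, hd, h1, h2⟩ | ⟨p, rfl, hne⟩)
      · simp only [Expr.eval_mul, Expr.eval_sub, Expr.eval_var, Expr.eval_two, Sto.setArr_val,
          Sto.set_val_self, Sto.set_val_of_ne, ne_eq, reduceCtorEq, not_false_eq_true, hσ.k,
          one_mul]
        rcases hi.eq_or_lt with rfl | hlt
        · refine .inl ⟨by omega, 2 * k, 1, le_rfl, ?_, by
            simpa using Nat.le_antisymm hN (Nat.le_of_dvd (by omega) hd)⟩
          congr 1
          funext p
          rcases Nat.lt_or_ge p (2 * k) with hp | hp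
          · rw [h1 p hp, digits_low hd hp hp]
          · rw [h2 p hp, digits, digits, if_neg (by omega), if_neg (by omega : ¬ p < 2 * k)]
        · have hB : 0 < D.n + k := by omega
          have hdig : digits D.n k N i < D.n + k := by
            rw [digits, if_pos hlt]; exact Nat.mod_lt _ hB
          have hiff := pow_dvd_succ_iff hB hd
          rw [show N / (D.n + k) ^ i % (D.n + k) = digits D.n k N i by rw [digits, if_pos hlt]]
            at hiff
          refine .inr ⟨by omega, hlt, .wp_le ?_ (by simp [Cmd.steps])⟩
          simp only [Cmd.wp, Expr.eval_var, Expr.eval_add, Expr.eval_sub, Expr.eval_arr,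
            Expr.eval_one, Expr.eval_zero, Sto.setArr_val, Sto.set_val_self, Sto.set_val_of_ne,
            ne_eq, reduceCtorEq, not_false_eq_true, hσ.n, hσ.k, Sto.setArr_set,
            Sto.setArr_setArr, Sto.setArr_arr_self, Sto.set_set, h2 i le_rfl]
          refine ⟨fun h => ⟨by omega, by omega, .inr ⟨i, ?_, fun hcon => ?_⟩⟩,
            fun h => ⟨by omega, by omega, .inl ⟨Function.update f i 0, ?_, hlt, ?_, ?_, ?_⟩⟩⟩
          · congr 1
            funext p
            rcases Nat.lt_trichotomy p i with hp | rfl | hp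
            · rw [Function.update_of_ne hp.ne, h1 p hp, digits_low hd hp (by omega)]
            · rw [Function.update_self, digits_self hd hlt (by omega)]
            · rw [Function.update_of_ne hp.ne', h2 p hp.le,
                digits_high (i := i + 1) (fun hdvd => by have := hiff.1 hdvd; omega) hp]
          · have := hiff.1 (hcon ▸ pow_dvd_pow _ hlt)
            omega
          · simp [Sto.setArr, Sto.set]
            funext y
            cases y <;> simp [Function.update]
          · exact hiff.2 (by omega)
          · intro p hp
            rw [Function.update_apply]
            split_ifs
            · rfl
            · exact h1 p (by omega)
          · intro p hp
            rw [Function.update_of_ne (by omega), h2 p (by omega)]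
      · exact .inl ⟨by simp, p, 0, by omega, rfl, by simpa using hne⟩
  · rintro τ ⟨p, c, hc, rfl, hiff⟩
    refine .wp_le ⟨by simp; omega, ⟨by simpa using hσ.n, by simpa using hσ.k,
      by simpa using hσ.A₁, by simpa using hσ.A₂, by simpa using hσ.sp, by simpa using hσ.sd,
      by simp⟩, by simp, by simp, ?_⟩ (by simp [Cmd.steps])
    rw [← hiff]
    simp
    omega

theorem runs_search (hS : Setting x D k M W) (hL : D.n < 2 ^ L)
    (hn : σ.val .n = D.n) (hk : σ.val .k = k) (hA₁ : σ.val .A₁ = A₁) (hA₂ : σ.val .A₂ = A₂)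
    (hsp : σ.arr .sp = D.sp) (hsd : σ.arr .sd = D.sd) (hdig : σ.arr .dig = fun _ => 0)
    (hslot : σ.arr .slot = fun _ => 0) :
    Runs x W search σ (1300 * testCost D.n k L * (D.n + k) ^ (2 * k) + 30) fun τ =>
      τ.val .res ≠ 0 ↔ ∃ N < (D.n + k) ^ (2 * k), Accepts D k A₁ A₂ (digits D.n k N) := by
  have hlen := hS.len
  have hlen' := hS.len_le
  have hMW : M ≤ W := (Nat.le_self_pow (by norm_num) M).trans hS.le_W
  have hA : (D.n + k + 1) * (L + 1) ≥ D.n + k + 1 := Nat.le_mul_of_pos_right _ (by omega)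
  have hcost : 1000 * testCost D.n k L + 200 * (k + 1) ≤ 1200 * testCost D.n k L := by
    rw [testCost]
    omega
  have hcost' : 1 ≤ testCost D.n k L := by
    rw [testCost]
    omega
  -- For `k = 0` there is exactly one guess, even if `n = 0`.
  have hpos : 0 < (D.n + k) ^ (2 * k) := by
    rcases Nat.eq_zero_or_pos k with rfl | h
    · simp
    · exact Nat.pow_pos (by omega)
  refine .wp_trans (1300 * testCost D.n k L * (D.n + k) ^ (2 * k) + 10) ?_ (by
    simp [Cmd.steps]; omega)
  refine ⟨by simp [hn]; omega, by simp, by simp; omega, ?_⟩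
  refine .loop_le (fun N τ => N ≤ (D.n + k) ^ (2 * k) ∧
    Ready D k A₁ A₂ (digits D.n k N) τ ∧ (∀ s ≥ D.n + k, τ.arr .slot s = 0) ∧
    (τ.val .more = 0 ↔ N = (D.n + k) ^ (2 * k)) ∧
    (τ.val .res ≠ 0 ↔ ∃ N' < N, Accepts D k A₁ A₂ (digits D.n k N')))
    ((D.n + k) ^ (2 * k)) (1200 * testCost D.n k L) ?_ ?_ ?_
  · refine ⟨by omega, ⟨by simpa using hn, by simpa using hk, by simpa using hA₁, by simpa using hA₂,
      by simpa using hsp, by simpa using hsd, ?_⟩, by simp [hslot], by simp; omega, by simp⟩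
    funext p
    simp only [Expr.eval_mul, Expr.eval_two, Expr.eval_var, hk, hn, hdig, Sto.setArr_set,
      Sto.setArr_arr_self, Function.update_apply, digits, Nat.zero_div, Nat.zero_mod]
    split_ifs <;> first | rfl | omega
  · rintro N τ ⟨hN, hready, hslot, hmore, hres⟩
    rcases hN.eq_or_lt with rfl | hlt
    · exact .inl ⟨hmore.2 rfl, hres⟩
    · refine .inr ⟨fun h => hlt.ne (hmore.1 h), hlt, ?_⟩
      refine .trans _ _ (runs_testGuess hS hready hL (fun j hj => ?_) hslot) ?_ hcost
      · rw [digits, if_pos (by omega)]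
        exact Nat.mod_lt _ (by omega)
      · rintro τ' ⟨hready', hslot', -, hacc, hnacc⟩
        refine (runs_nextGuess (by omega) hlt hready').mono le_rfl ?_
        rintro τ'' ⟨h1, h2, h3, h4⟩
        refine ⟨hlt, h1, by rwa [h2], h4, ?_⟩
        rw [h3]
        by_cases h : Accepts D k A₁ A₂ (digits D.n k N)
        · simp only [hacc h, ne_eq, one_ne_zero, not_false_eq_true, true_iff]
          exact ⟨N, by omega, h⟩
        · rw [hnacc h, hres]
          refine ⟨fun ⟨N', h1, h2⟩ => ⟨N', by omega, h2⟩, fun ⟨N', h1, h2⟩ => ⟨N', ?_, h2⟩⟩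
          rcases Nat.lt_succ_iff_lt_or_eq.1 h1 with h1 | rfl
          · exact h1
          · exact absurd h2 h
  · simp only [Expr.steps_var]
    generalize (D.n + k) ^ (2 * k) = P at *
    have h1 : P ≤ P * testCost D.n k L := Nat.le_mul_of_pos_right _ hcost'
    have h2 : P * (1200 * testCost D.n k L + 2 + 1) =
      1200 * (P * testCost D.n k L) + 3 * P := by ring
    have h3 : 1300 * testCost D.n k L * P = 1300 * (P * testCost D.n k L) := by ring
    omega

end Sched

/-! ### Sorting by due dates -/

namespace Sched

/-- The jobs `ρ i, …, ρ (n - 1)`, which have the largest due dates, have been sorted, and the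
leaves of the tree `f` hold the due dates of the others. -/
structure Sorted (n : ℕ) (p d : ℕ → ℕ) (i : ℕ) (ρ sp sd f : ℕ → ℕ) : Prop where
  tree : IsTree n f
  lt : ∀ j, i ≤ j → j < n → ρ j < n
  inj : ∀ j j', i ≤ j → j < n → i ≤ j' → j' < n → ρ j = ρ j' → j = j'
  sp_eq : ∀ j, i ≤ j → j < n → sp j = p (ρ j)
  sd_eq : ∀ j, i ≤ j → j < n → sd j = d (ρ j)
  zero : ∀ j, i ≤ j → j < n → f (n + ρ j) = 0
  leaf : ∀ u < n, (∀ j, i ≤ j → j < n → ρ j ≠ u) → f (n + u) = d u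
  le : ∀ j, i ≤ j → j < n → ∀ u < n, f (n + u) ≤ sd j
  mono : ∀ j j', i ≤ j → j ≤ j' → j' < n → sd j ≤ sd j'

variable {n i v : ℕ} {p d ρ sp sd f f' : ℕ → ℕ}

/-- Pigeonhole: before the last removal some job is still in the tree. Its positive due date ensures
that the maximal leaf is not an empty one. -/
theorem exists_notMem_image (ρ : ℕ → ℕ) (hi : i < n) :
    ∃ u < n, ∀ j, i + 1 ≤ j → j < n → ρ j ≠ u := by
  have hc : ((Finset.Ico (i + 1) n).image ρ).card < (Finset.range n).card := by
    refine Finset.card_image_le.trans_lt ?_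
    simp
    omega
  obtain ⟨u, hu, hu'⟩ := Finset.exists_mem_notMem_of_card_lt_card hc
  refine ⟨u, Finset.mem_range.1 hu, fun j hj hjn hju => hu' ?_⟩
  exact Finset.mem_image.2 ⟨j, Finset.mem_Ico.2 ⟨hj, hjn⟩, hju⟩

/-- The maximal leaf is positive, so it belongs to a job not yet taken. Its due date is at most
those taken before, by `le`, and at least those still in the tree. -/
theorem Sorted.step (h : Sorted n p d (i + 1) ρ sp sd f) (hi : i < n) (hd : ∀ u < n, 0 < d u)
    (hv : n ≤ v) (hv' : v < 2 * n) (hmax : ∀ u ≥ n, u < 2 * n → f u ≤ f v) (ht : IsTree n f')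
    (hf' : ∀ u ≥ n, f' u = if u = v then 0 else f u) :
    Sorted n p d i (Function.update ρ i (v - n)) (Function.update sp i (p (v - n)))
      (Function.update sd i (d (v - n))) f' := by
  obtain ⟨w, rfl⟩ : ∃ w, v = n + w := ⟨v - n, by omega⟩
  rw [show n + w - n = w by omega]
  obtain ⟨u, hu, hu'⟩ := exists_notMem_image ρ hi
  have hpos : 0 < f (n + w) := by
    have h1 := hmax (n + u) (by omega) (by omega)
    rw [h.leaf u hu hu'] at h1
    exact (hd u hu).trans_le h1
  have hw : ∀ j, i + 1 ≤ j → j < n → ρ j ≠ w := fun j hj hjn hjw => by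
    have := h.zero j hj hjn
    rw [hjw] at this
    omega
  have hfw : f (n + w) = d w := h.leaf w (by omega) hw
  have hf'le : ∀ u < n, f' (n + u) ≤ f (n + u) := fun u _ => by
    rw [hf' _ (by omega)]
    split_ifs <;> omega
  have hsd : ∀ j, i + 1 ≤ j → j < n → d w ≤ sd j := fun j hj hjn =>
    hfw ▸ h.le j hj hjn w (by omega)
  refine ⟨ht, fun j hj hjn => ?_, fun j j' hj hjn hj' hjn' => ?_, fun j hj hjn => ?_,
    fun j hj hjn => ?_, fun j hj hjn => ?_, fun u hu hne => ?_, fun j hj hjn u hu => ?_,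
    fun j j' hj hjj hjn => ?_⟩
  · rcases hj.eq_or_lt with rfl | hj
    · simp; omega
    · rw [Function.update_of_ne hj.ne']; exact h.lt j hj hjn
  · rcases hj.eq_or_lt with rfl | hj <;> rcases hj'.eq_or_lt with rfl | hj'
    · exact fun _ => rfl
    · rw [Function.update_self, Function.update_of_ne hj'.ne']
      exact fun e => absurd e.symm (hw _ hj' hjn')
    · rw [Function.update_self, Function.update_of_ne hj.ne']
      exact fun e => absurd e (hw _ hj hjn)
    · rw [Function.update_of_ne hj.ne', Function.update_of_ne hj'.ne']
      exact h.inj j j' hj hjn hj' hjn'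
  · rcases hj.eq_or_lt with rfl | hj
    · simp
    · rw [Function.update_of_ne hj.ne', Function.update_of_ne hj.ne']; exact h.sp_eq j hj hjn
  · rcases hj.eq_or_lt with rfl | hj
    · simp
    · rw [Function.update_of_ne hj.ne', Function.update_of_ne hj.ne']; exact h.sd_eq j hj hjn
  · rcases hj.eq_or_lt with rfl | hj
    · rw [Function.update_self, hf' _ (by omega), if_pos rfl]
    · rw [Function.update_of_ne hj.ne']
      have := hf'le _ (h.lt j hj hjn)
      rw [h.zero j hj hjn] at this
      omega
  · have h1 := hne i le_rfl hi
    rw [Function.update_self] at h1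
    rw [hf' _ (by omega), if_neg (by omega)]
    refine h.leaf u hu fun j hj hjn => ?_
    have := hne j (by omega) hjn
    rwa [Function.update_of_ne (by omega)] at this
  · rcases hj.eq_or_lt with rfl | hj
    · rw [Function.update_self, ← hfw]
      exact (hf'le u hu).trans (hmax _ (by omega) (by omega))
    · rw [Function.update_of_ne hj.ne']; exact (hf'le u hu).trans (h.le j hj hjn u hu)
  · rcases hj.eq_or_lt with rfl | hj
    · rw [Function.update_self]
      rcases hjj.eq_or_lt with rfl | hj'
      · simp
      · rw [Function.update_of_ne hj'.ne']; exact hsd j' hj' hjn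
    · rw [Function.update_of_ne hj.ne', Function.update_of_ne (by omega)]
      exact h.mono j j' hj hjj hjn

theorem Sorted.exists_perm (h : Sorted n p d 0 ρ sp sd f) :
    ∃ π : Equiv.Perm (Fin n), ∀ j : Fin n, sp j = p (π j) ∧ sd j = d (π j) := by
  have hinj : Function.Injective fun j : Fin n => (⟨ρ j, h.lt j (by omega) j.2⟩ : Fin n) :=
    fun j j' e => Fin.ext (h.inj j j' (by omega) j.2 (by omega) j'.2 (Fin.mk.inj e))
  exact ⟨Equiv.ofBijective _ (Finite.injective_iff_bijective.1 hinj), fun j =>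
    ⟨h.sp_eq j (by omega) j.2, h.sd_eq j (by omega) j.2⟩⟩

/-- Put the due dates of agent 1 at the leaves of the tree. -/
def buildTree : Cmd :=
  .i ≔ 0 ⨾
  .loop (◇.n - ◇.i)
    ((.input .x (4 + ◇.n + ◇.i) ⨾ .v ≔ ◇.n + ◇.i) ⨾ updateLeaf ⨾ .i ≔ ◇.i + 1)

/-- Take the jobs of agent 1 out of the tree, the one with the largest due date first. -/
def emptyTree : Cmd :=
  .loop ◇.i
    (.i ≔ ◇.i - 1 ⨾ findMax ⨾
      -- Leaf `v` belongs to job `v - n`, whose due date is entry `4 + n + (v - n) = 4 + v`.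
      (.input .x (4 + (◇.v - ◇.n)) ⨾ .store .sp ◇.i ◇.x ⨾ .input .x (4 + ◇.v) ⨾
        .store .sd ◇.i ◇.x ⨾ .x ≔ 0) ⨾
      updateLeaf)

def sortJobs : Cmd := buildTree ⨾ emptyTree

variable {x : List ℕ} {W L : ℕ} {σ : Sto}

theorem runs_buildTree (hn : σ.val .n = n) (hL : n < 2 ^ L) (hx : 4 + 2 * n ≤ x.length)
    (ht : σ.arr .tree = fun _ => 0) :
    Runs x W buildTree σ (100 * ((n + 1) * (L + 1))) fun τ =>
      (∀ y, y ∉ [Var.i, .v, .x] → τ.val y = σ.val y) ∧ (∀ r ≠ Arr.tree, τ.arr r = σ.arr r) ∧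
      τ.val .i = n ∧ IsTree n (τ.arr .tree) ∧
      ∀ u < n, τ.arr .tree (n + u) = x.getD (4 + n + u) 0 := by
  refine .of_bdd fun hb => ?_
  have hlen := hb.len
  refine .wp_trans (100 * ((n + 1) * (L + 1)) - 5) ⟨by simp, ?_⟩ (by
    have : 0 < (n + 1) * (L + 1) := by positivity
    simp [Cmd.steps]; omega)
  refine .loop_le (fun i τ => (∀ y, y ∉ [Var.i, .v, .x] → τ.val y = σ.val y) ∧
    (∀ r ≠ Arr.tree, τ.arr r = σ.arr r) ∧ i ≤ n ∧ τ.val .i = i ∧ IsTree n (τ.arr .tree) ∧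
    (∀ u < i, τ.arr .tree (n + u) = x.getD (4 + n + u) 0)) n (90 * (L + 1)) ?_ ?_ ?_
  · refine ⟨fun y hy => ?_, by simp, by omega, by simp, fun v _ _ => by simp [ht], by simp⟩
    simp only [List.mem_cons, not_or] at hy
    simp [hy]
  · rintro i τ ⟨h1, h2, hi, h3, h4, h5⟩
    have hn' : τ.val .n = n := (h1 _ (by decide)).trans hn
    simp only [Expr.eval_sub, Expr.eval_var, hn', h3]
    rcases hi.eq_or_lt with rfl | hlt
    · exact .inl ⟨by omega, h1, h2, rfl, h4, h5⟩
    · refine .inr ⟨by omega, hlt, ?_⟩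
      refine .wp_trans (70 * (L + 1)) ?_ (by simp [Cmd.steps]; omega)
      simp only [Cmd.wp, Expr.eval_var, Expr.eval_add, Expr.eval_four,
        Sto.set_val_of_ne, ne_eq, reduceCtorEq, not_false_eq_true, hn', h3]
      refine ⟨by omega, by omega, ?_⟩
      refine .trans (60 * (L + 1)) 10 (runs_updateLeaf (n := n) hL (by simpa using h4) (by simp)
        (by simp; omega)) ?_ (by omega)
      rintro τ' ⟨f, rfl, hf, hfu⟩
      simp only [Sto.set_val_self, Sto.set_val_of_ne, ne_eq, reduceCtorEq, not_false_eq_true,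
        Sto.set_arr] at hfu
      refine .wp_le ⟨by simp [h3]; omega, fun y hy => ?_, fun r hr => by simp [hr, h2 r hr],
        hlt, by simp [h3], by simpa using hf, fun u hu => ?_⟩ (by simp [Cmd.steps])
      · have hy' := hy
        simp only [List.mem_cons, not_or] at hy
        rw [← h1 y hy']
        simp [hy]
      · simp only [Sto.setArr_set, Sto.setArr_arr_self]
        rw [hfu _ (by omega)]
        split_ifs with h
        · rw [show u = i by omega]
        · exact h5 u (by omega)
  · simp only [Expr.steps_sub, Expr.steps_var]
    have h1 : (n + 1) * (L + 1) = n * (L + 1) + (L + 1) := by ring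
    have h2 : n * (90 * (L + 1) + (2 + (2 + 1)) + 1) = 90 * (n * (L + 1)) + 6 * n := by ring
    have h3 : n ≤ n * (L + 1) := Nat.le_mul_of_pos_right _ (by omega)
    omega

theorem runs_sortJobs (hn : σ.val .n = n) (hL : n < 2 ^ L) (hx : 4 + 2 * n ≤ x.length)
    (hd : ∀ u < n, 0 < x.getD (4 + n + u) 0) (ht : σ.arr .tree = fun _ => 0) :
    Runs x W sortJobs σ (400 * ((n + 1) * (L + 1))) fun τ =>
      (∀ y, y ∉ [Var.i, .v, .x] → τ.val y = σ.val y) ∧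
      (∀ r, r ∉ [Arr.tree, .sp, .sd] → τ.arr r = σ.arr r) ∧
      ∃ ρ, Sorted n (fun u => x.getD (4 + u) 0) (fun u => x.getD (4 + n + u) 0) 0 ρ
        (τ.arr .sp) (τ.arr .sd) (τ.arr .tree) := by
  refine .of_bdd fun hb => ?_
  have hlen := hb.len
  have hbx := hb.input
  refine .trans _ (300 * ((n + 1) * (L + 1))) (runs_buildTree hn hL hx ht) ?_ (by omega)
  rintro σ₁ ⟨f1, f2, f3, f4, f5⟩
  refine .loop_le (fun r τ => (∀ y, y ∉ [Var.i, .v, .x] → τ.val y = σ.val y) ∧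
    (∀ r, r ∉ [Arr.tree, .sp, .sd] → τ.arr r = σ.arr r) ∧ τ.val .i = n - r ∧
    ∃ ρ, Sorted n (fun u => x.getD (4 + u) 0) (fun u => x.getD (4 + n + u) 0) (n - r) ρ
        (τ.arr .sp) (τ.arr .sd) (τ.arr .tree)) n (200 * (L + 1)) ?_ ?_ ?_
  · refine ⟨f1, fun r hr => f2 r fun h => hr (by simp [h]), by simpa using f3, id, f4, ?_, ?_, ?_,
      ?_, ?_, fun u hu _ => f5 u hu, ?_, ?_⟩
    all_goals intros; omega
  · rintro r τ ⟨h1, h2, h3, ρ, h4⟩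
    have hn' : τ.val .n = n := (h1 _ (by decide)).trans hn
    simp only [Expr.eval_var, h3]
    rcases Nat.lt_or_ge r n with hlt | hge
    · obtain ⟨i, hi⟩ : ∃ i, n - r = i + 1 := ⟨n - r - 1, by omega⟩
      have hi' : n - (r + 1) = i := by omega
      rw [hi] at h4 h3
      rw [hi']
      refine .inr ⟨by omega, hlt, ?_⟩
      refine .wp_trans (190 * (L + 1)) ⟨by simp [h3]; omega, ?_⟩ (by simp [Cmd.steps]; omega)
      refine .trans (60 * (L + 1)) (130 * (L + 1)) (runs_findMax (n := n) hL (by omega)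
        (by simp [hn']) (by omega) (by simpa using h4.tree)) ?_ (by omega)
      rintro τ' ⟨v, rfl, hv, hv', hmax⟩
      simp only [Sto.set_arr] at hmax
      refine .wp_trans (60 * (L + 1)) ?_ (by simp [Cmd.steps]; omega)
      simp only [Cmd.wp, Expr.eval_var, Expr.eval_add, Expr.eval_sub, Expr.eval_four,
        Expr.eval_one, Expr.eval_zero, Sto.set_val_self, Sto.set_val_of_ne, ne_eq, reduceCtorEq,
        not_false_eq_true, hn', h3, Sto.setArr_set, Sto.setArr_val, Sto.set_set]
      refine ⟨by omega, hbx _, by omega, hbx _, by omega, ?_⟩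
      refine (runs_updateLeaf (n := n) hL (by simpa using h4.tree) (by simpa using hv)
        (by simpa using hv')).mono le_rfl ?_
      rintro τ' ⟨f', rfl, hf', hfu⟩
      simp only [Sto.set_val_self, Sto.set_val_of_ne, ne_eq, reduceCtorEq, not_false_eq_true,
        Sto.set_arr, Sto.setArr_val, Sto.setArr_arr_of_ne] at hfu
      refine ⟨fun y hy => ?_, fun r hr => ?_, by simp,
        Function.update ρ i (v - n), ?_⟩
      · have hy' := hy
        simp only [List.mem_cons, not_or] at hy
        rw [← h1 y hy']
        simp [hy]
      · have hr' := hr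
        simp only [List.mem_cons, not_or] at hr
        rw [← h2 r hr']
        simp [hr]
      · have := h4.step (by omega) hd hv hv' hmax hf' hfu
        rw [show 4 + n + (v - n) = 4 + v by omega] at this
        simpa using this
    · refine .inl ⟨by omega, h1, h2, ρ, ?_⟩
      rwa [show n - r = 0 by omega] at h4
  · simp only [Expr.steps_var]
    have h1 : (n + 1) * (L + 1) = n * (L + 1) + (L + 1) := by ring
    have h2 : n * (200 * (L + 1) + 2 + 1) = 200 * (n * (L + 1)) + 3 * n := by ring
    have h3 : n ≤ n * (L + 1) := Nat.le_mul_of_pos_right _ (by omega)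
    omega

end Sched

/-! ### The program -/

namespace Sched

/-- The list is the input for some instance. -/
structure IsValid (x : List ℕ) : Prop where
  le : x.getD 0 0 ≤ x.getD 1 0
  length : x.length = 4 + 2 * x.getD 1 0 + 2 * x.getD 0 0
  pos : ∀ i, 4 ≤ i → i < x.length → 0 < x.getD i 0

section Input

variable (I : TwoAgentInstance)

theorem length_input : I.input.length = 4 + 2 * I.n + 2 * I.k := by
  simp [TwoAgentInstance.input, TwoAgentInstance.encode]
  omega

theorem getD_input_p₁ (j : Fin I.n) : I.input.getD (4 + j) 0 = I.p₁ j := by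
  have h : I.input.drop 4 = List.ofFn I.p₁ ++
    (List.ofFn I.d₁ ++ (List.ofFn I.p₂ ++ List.ofFn I.w₂)) := by
    simp [TwoAgentInstance.input, TwoAgentInstance.encode]
  rw [List.getD_eq_getElem?_getD, ← List.getElem?_drop, h, List.getElem?_append_left (by simp)]
  simp

theorem getD_input_d₁ (j : Fin I.n) : I.input.getD (4 + I.n + j) 0 = I.d₁ j := by
  have h : I.input.drop (4 + I.n) = List.ofFn I.d₁ ++ (List.ofFn I.p₂ ++ List.ofFn I.w₂) := by
    rw [← List.drop_drop]
    simp [TwoAgentInstance.input, TwoAgentInstance.encode]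
  rw [List.getD_eq_getElem?_getD, ← List.getElem?_drop, h, List.getElem?_append_left (by simp)]
  simp

theorem getD_input_p₂ (j : Fin I.k) : I.input.getD (4 + 2 * I.n + j) 0 = I.p₂ j := by
  have h : I.input.drop (4 + 2 * I.n) = List.ofFn I.p₂ ++ List.ofFn I.w₂ := by
    rw [two_mul, ← List.drop_drop, ← List.drop_drop]
    simp [TwoAgentInstance.input, TwoAgentInstance.encode]
  rw [List.getD_eq_getElem?_getD, ← List.getElem?_drop, h, List.getElem?_append_left (by simp)]
  simp

theorem getD_input_w₂ (j : Fin I.k) : I.input.getD (4 + 2 * I.n + I.k + j) 0 = I.w₂ j := by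
  have h : I.input.drop (4 + 2 * I.n + I.k) = List.ofFn I.w₂ := by
    rw [two_mul, ← List.drop_drop, ← List.drop_drop, ← List.drop_drop]
    simp [TwoAgentInstance.input, TwoAgentInstance.encode]
  rw [List.getD_eq_getElem?_getD, ← List.getElem?_drop, h]
  simp

theorem isValid_input : IsValid I.input := by
  have hl := length_input I
  refine ⟨I.k_le_n, hl, fun i hi hil => ?_⟩
  rw [hl] at hil
  rcases Nat.lt_or_ge i (4 + I.n) with h | h
  · obtain ⟨j, rfl⟩ := Nat.exists_eq_add_of_le hi
    exact (getD_input_p₁ I ⟨j, by omega⟩).symm ▸ I.p₁_pos _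
  rcases Nat.lt_or_ge i (4 + 2 * I.n) with h' | h'
  · obtain ⟨j, rfl⟩ := Nat.exists_eq_add_of_le h
    exact (getD_input_d₁ I ⟨j, by omega⟩).symm ▸ I.d₁_pos _
  rcases Nat.lt_or_ge i (4 + 2 * I.n + I.k) with h'' | h''
  · obtain ⟨j, rfl⟩ := Nat.exists_eq_add_of_le h'
    exact (getD_input_p₂ I ⟨j, by omega⟩).symm ▸ I.p₂_pos _
  · obtain ⟨j, rfl⟩ := Nat.exists_eq_add_of_le h''
    exact (getD_input_w₂ I ⟨j, by omega⟩).symm ▸ I.w₂_pos _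

theorem IsValid.exists_input {x : List ℕ} (h : IsValid x) :
    ∃ I : TwoAgentInstance, x = I.input := by
  have hl := h.length
  refine ⟨⟨x.getD 1 0, x.getD 0 0, h.le, fun j => x.getD (4 + j) 0,
    fun j => x.getD (4 + x.getD 1 0 + j) 0, fun j => x.getD (4 + 2 * x.getD 1 0 + j) 0,
    fun j => x.getD (4 + 2 * x.getD 1 0 + x.getD 0 0 + j) 0, x.getD 2 0, x.getD 3 0,
    fun j => h.pos _ (by omega) (by omega), fun j => h.pos _ (by omega) (by omega),
    fun j => h.pos _ (by omega) (by omega), fun j => h.pos _ (by omega) (by omega)⟩, ?_⟩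
  set I : TwoAgentInstance := ⟨x.getD 1 0, x.getD 0 0, h.le, fun j => x.getD (4 + j) 0,
    fun j => x.getD (4 + x.getD 1 0 + j) 0, fun j => x.getD (4 + 2 * x.getD 1 0 + j) 0,
    fun j => x.getD (4 + 2 * x.getD 1 0 + x.getD 0 0 + j) 0, x.getD 2 0, x.getD 3 0,
    fun j => h.pos _ (by omega) (by omega), fun j => h.pos _ (by omega) (by omega),
    fun j => h.pos _ (by omega) (by omega), fun j => h.pos _ (by omega) (by omega)⟩ with hI
  have hl' := length_input I
  have hn : I.n = x.getD 1 0 := rfl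
  have hk : I.k = x.getD 0 0 := rfl
  refine List.ext_getElem (by omega) fun i hi hi' => ?_
  rw [← List.getD_eq_getElem x 0 hi, ← List.getD_eq_getElem _ 0 hi']
  rcases Nat.lt_or_ge i 4 with h4 | h4
  · interval_cases i <;> rfl
  rcases Nat.lt_or_ge i (4 + I.n) with h | h
  · obtain ⟨j, rfl⟩ := Nat.exists_eq_add_of_le h4
    exact (getD_input_p₁ I ⟨j, by omega⟩).symm
  rcases Nat.lt_or_ge i (4 + 2 * I.n) with h' | h'
  · obtain ⟨j, rfl⟩ := Nat.exists_eq_add_of_le h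
    exact (getD_input_d₁ I ⟨j, by omega⟩).symm
  rcases Nat.lt_or_ge i (4 + 2 * I.n + I.k) with h'' | h''
  · obtain ⟨j, rfl⟩ := Nat.exists_eq_add_of_le h'
    exact (getD_input_p₂ I ⟨j, by omega⟩).symm
  · obtain ⟨j, rfl⟩ := Nat.exists_eq_add_of_le h''
    exact (getD_input_w₂ I ⟨j, by omega⟩).symm

end Input

/-! ### Validation of the input and the complete command -/

/-- Check that all the entries from number `4` on are positive. -/
def checkPos : Cmd :=
  (.ok ≔ 1 ⨾ .i ≔ 4) ⨾
  .loop (.len - ◇.i) (.input .x ◇.i ⨾ .ite ◇.x (.x ≔ 0) (.ok ≔ 0) ⨾ .i ≔ ◇.i + 1)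

/-- Check that the input is an instance, and read its first entries. -/
def validate : Cmd :=
  .ite (.len - 3)
    ((.input .k 0 ⨾ .input .n 1 ⨾ .input .A₁ 2 ⨾ .input .A₂ 3) ⨾
      .ite ((◇.k - ◇.n) + (.len - (4 + 2 * ◇.n + 2 * ◇.k)) + ((4 + 2 * ◇.n + 2 * ◇.k) - .len))
        (.ok ≔ 0) checkPos)
    (.ok ≔ 0)

def decideInput : Cmd :=
  validate ⨾ .ite ◇.ok (sortJobs ⨾ search) (.res ≔ 0)

variable {x : List ℕ} {W : ℕ} {σ : Sto}

theorem runs_checkPos (hx : 4 ≤ x.length) : Runs x W checkPos σ (50 * x.length) fun τ =>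
    (∀ y, y ∉ [Var.i, .x, .ok] → τ.val y = σ.val y) ∧ τ.arr = σ.arr ∧
      (τ.val .ok ≠ 0 ↔ ∀ i, 4 ≤ i → i < x.length → 0 < x.getD i 0) := by
  refine .of_bdd fun hb => ?_
  have hlen := hb.len
  refine .wp_trans (50 * x.length - 10) ⟨by simp; omega, by simp; omega, ?_⟩
    (by simp [Cmd.steps]; omega)
  refine .loop_le (fun i τ => (∀ y, y ∉ [Var.i, .x, .ok] → τ.val y = σ.val y) ∧ τ.arr = σ.arr ∧
    4 + i ≤ x.length ∧ τ.val .i = 4 + i ∧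
    (τ.val .ok ≠ 0 ↔ ∀ j, 4 ≤ j → j < 4 + i → 0 < x.getD j 0)) (x.length - 4) 30 ?_ ?_ ?_
  · refine ⟨fun y hy => ?_, by simp, by omega, by simp, ?_⟩
    · simp only [List.mem_cons, not_or] at hy
      simp [hy]
    · simp
      intros
      omega
  · rintro i τ ⟨h1, h2, h3, h4, h5⟩
    simp only [Expr.eval_sub, Expr.eval_len, Expr.eval_var, h4]
    rcases h3.eq_or_lt with heq | hlt
    · refine .inl ⟨by omega, h1, h2, ?_⟩
      rwa [heq] at h5
    · refine .inr ⟨by omega, by omega, .wp_le ?_ (by simp [Cmd.steps])⟩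
      simp only [Cmd.wp, Expr.eval_var, Expr.eval_zero, Expr.eval_one, Expr.eval_add,
        Sto.set_val_self, Sto.set_val_of_ne, ne_eq, reduceCtorEq, not_false_eq_true, h4]
      have hfr : ∀ y, y ∉ [Var.i, .x, .ok] → ∀ a b c, ((τ.set .x a).set .i b).val y = σ.val y ∧
          (((τ.set .x a).set .ok c).set .i b).val y = σ.val y := by
        intro y hy a b c
        have hy' := hy
        simp only [List.mem_cons, not_or] at hy
        rw [← h1 y hy']
        simp [hy]
      refine ⟨hlt, fun h => ⟨by omega, by omega, fun y hy => ?_, by simpa using h2, by omega,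
        by omega, ?_⟩, fun h => ⟨by omega, by omega, fun y hy => (hfr y hy _ _ _).2,
        by simpa using h2, by omega, by omega, ?_⟩⟩
      · rw [Sto.set_set]
        exact (hfr y hy _ _ 0).1
      · rw [← ne_eq, h5]
        refine ⟨fun h' j hj hji => ?_, fun h' j hj hji => h' j hj (by omega)⟩
        rcases Nat.lt_or_ge j (4 + i) with hj' | hj'
        · exact h' j hj hj'
        · rw [show j = 4 + i by omega]
          exact Nat.pos_of_ne_zero h
      · simp only [not_true_eq_false, false_iff]
        intro h'
        exact (h' (4 + i) (by omega) (by omega)).ne' h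
  · simp only [Expr.steps_sub, Expr.steps_len, Expr.steps_var]
    omega

theorem runs_validate : Runs x W validate σ (100 * (x.length + 1)) fun τ =>
    (τ.val .ok ≠ 0 ↔ IsValid x) ∧ τ.arr = σ.arr ∧ (IsValid x → τ.val .n = x.getD 1 0 ∧
      τ.val .k = x.getD 0 0 ∧ τ.val .A₁ = x.getD 2 0 ∧ τ.val .A₂ = x.getD 3 0) := by
  refine .ite_le (100 * x.length + 80) (fun h => ?_) (fun h => ?_) (by simp; omega)
  all_goals simp only [Expr.eval_sub, Expr.eval_len, Expr.eval_three] at h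
  · refine .wp_trans (50 * x.length + 50) ?_ (by simp [Cmd.steps]; omega)
    simp only [Cmd.wp, Expr.eval_zero, Expr.eval_one, Expr.eval_two, Expr.eval_three]
    refine ⟨by omega, by omega, by omega, by omega, ?_⟩
    refine .ite_le (50 * x.length + 3) (fun h' => ?_) (fun h' => ?_) (by simp; omega)
    all_goals
      simp only [Expr.eval_sub, Expr.eval_len, Expr.eval_add, Expr.eval_var, Expr.eval_mul,
        Expr.eval_four, Expr.eval_two, Sto.set_val_self, Sto.set_val_of_ne, ne_eq, reduceCtorEq,
        not_false_eq_true] at h'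
    · have hnot : ¬ IsValid x := fun hv => by
        have := hv.le
        have := hv.length
        omega
      refine .wp_le ⟨by simp, by simpa using hnot, by simp, fun hv => absurd hv hnot⟩
        (by simp [Cmd.steps])
    · refine (runs_checkPos (by omega)).mono (by omega) ?_
      rintro τ ⟨h1, h2, h3⟩
      refine ⟨h3.trans ⟨fun hp => ⟨by omega, by omega, hp⟩, fun hv => hv.pos⟩, by simpa using h2,
        fun _ => ?_⟩
      rw [h1 _ (by decide), h1 _ (by decide), h1 _ (by decide), h1 _ (by decide)]
      simp
  · have hnot : ¬ IsValid x := fun hv => by have := hv.length; omega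
    refine .wp_le ⟨by simp, by simpa using hnot, by simp, fun hv => absurd hv hnot⟩ (by
      simp [Cmd.steps])

/-- The number of steps on an input that is not an instance, and on an instance. -/
def runTime (n k L : ℕ) : ℕ :=
  100 * (2 * n + 2 * k + 5) + 400 * ((n + 1) * (L + 1)) +
    1300 * testCost n k L * (n + k) ^ (2 * k) + 40

theorem runs_decideInput_of_not_isValid (hx : ¬ IsValid x) :
    Runs x W decideInput σ (100 * (x.length + 1) + 6) fun τ => τ.val .res = 0 := by
  refine .trans _ 6 runs_validate ?_ le_rfl
  rintro τ ⟨h1, -, -⟩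
  have h0 : τ.val .ok = 0 := by
    by_contra h
    exact hx (h1.1 h)
  refine .ite_le 3 (fun h => absurd h0 h) (fun _ => ?_) (by simp)
  exact .wp_le ⟨by simp, by simp⟩ (by simp [Cmd.steps])

theorem runs_decideInput {M n k L : ℕ} (hx : IsValid x) (hn : x.getD 1 0 = n)
    (hk : x.getD 0 0 = k) (hL : n < 2 ^ L) (hM : x.length ≤ M) (hM' : ∀ i, x.getD i 0 ≤ M)
    (hW : M ^ 4 ≤ W) (hσ : σ.arr = fun _ _ => 0) :
    Runs x W decideInput σ (runTime n k L) fun τ =>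
      ∀ I : TwoAgentInstance, x = I.input → (τ.val .res ≠ 0 ↔ I.IsYes) := by
  have hlen := hx.length
  rw [hn, hk] at hlen
  refine .trans (100 * (2 * n + 2 * k + 5)) (400 * ((n + 1) * (L + 1)) +
    1300 * testCost n k L * (n + k) ^ (2 * k) + 40) (runs_validate.mono (by omega) fun _ => id) ?_
    (by rw [runTime]; omega)
  rintro τ ⟨h1, h2, h3⟩
  obtain ⟨hτn, hτk, hτA₁, hτA₂⟩ := h3 hx
  rw [hn] at hτn
  rw [hk] at hτk
  refine .ite_le (400 * ((n + 1) * (L + 1)) + 1300 * testCost n k L * (n + k) ^ (2 * k) + 30)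
    (fun _ => ?_) (fun h => absurd h (h1.2 hx)) (by simp; omega)
  refine .trans _ _ (runs_sortJobs hτn hL (by omega) (fun u hu => hx.pos _ (by omega) (by omega))
    (by rw [h2, hσ])) ?_ (by rw [add_assoc])
  rintro τ' ⟨f1, f2, ρ, hs⟩
  set D : Data := ⟨n, τ'.arr .sp, τ'.arr .sd, fun j => x.getD (4 + 2 * n + j) 0,
    fun j => x.getD (4 + 2 * n + k + j) 0⟩ with hD
  have hS : Setting x D k M W := by
    refine ⟨hlen, hM, fun _ => rfl, fun _ => rfl, hM', fun i hi => ?_, fun i hi => ?_, hW⟩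
    · exact (hs.sp_eq i (by omega) hi).le.trans (hM' _)
    · have := hs.lt i (by omega) hi
      exact (hx.pos (4 + ρ i) (by omega) (by omega)).trans_eq (hs.sp_eq i (by omega) hi).symm
  refine (runs_search (D := D) hS hL ((f1 _ (by decide)).trans hτn) ((f1 _ (by decide)).trans hτk)
    ((f1 _ (by decide)).trans hτA₁) ((f1 _ (by decide)).trans hτA₂) rfl rfl
    ((f2 _ (by decide)).trans (by rw [h2, hσ])) ((f2 _ (by decide)).trans (by rw [h2, hσ]))).mono
    le_rfl ?_
  rintro τ'' hres I rfl
  rw [hres]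
  change I.n = n at hn
  change I.k = k at hk
  subst hn hk
  obtain ⟨π, hπ⟩ := hs.exists_perm
  refine exists_accepts_iff (D := D) (ρ := π) ⟨rfl, fun j => ?_, fun j => ?_, getD_input_p₂ I,
    getD_input_w₂ I, fun a b hab hb => hs.mono a b (by omega) hab hb⟩
  · exact (hπ j).1.trans (getD_input_p₁ I _)
  · exact (hπ j).2.trans (getD_input_d₁ I _)

end Sched

/-! ### Running time and word size -/

namespace Sched

open RAM

/-- Acceptance is read from register 0, which holds the length of the input until the result is
copied there. -/
def program : Prog :=
  .seq decideInput.compile (.seq (.const 22 0) (.op .add 0 Var.res.reg 22))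

/-- The words have at most this many times as many bits as the largest number of the input. -/
def wordFactor : ℕ := 5 * decideInput.width + 1

theorem rep_init (x : List ℕ) : Rep x ⟨fun _ => 0, fun _ _ => 0⟩ (init x) := by
  refine ⟨by simp [init], fun y => ?_, fun r i => ?_, fun i _ => rfl⟩
  · simp [init, Function.update_of_ne y.reg_pos.ne']
  · simp only [init]
    exact List.getD_eq_default _ _ (by omega)

theorem size_le_wordFactor_mul {M a : ℕ} (hM : 0 < M)
    (h : a ≤ (M ^ 4 + 2) ^ decideInput.width) : a.size ≤ wordFactor * M.size := by
  have hs : 0 < M.size := Nat.size_pos.2 hM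
  have h1 : M ^ 4 < 2 ^ (4 * M.size) := by
    rw [mul_comm, pow_mul]
    -- Four times the size bounds `M ^ 4`; a fifth one pays for adding 2.
    exact Nat.pow_lt_pow_left M.lt_size_self (by norm_num)
  have h2 : M ^ 4 + 2 ≤ 2 ^ (5 * M.size) := by
    have h3 : 2 ^ (4 * M.size) * 2 ≤ 2 ^ (5 * M.size) := by
      rw [← pow_succ]
      exact Nat.pow_le_pow_right (by norm_num) (by omega)
    have h4 : 2 ^ 1 ≤ 2 ^ (4 * M.size) := Nat.pow_le_pow_right (by norm_num) (by omega)
    omega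
  rw [Nat.size_le]
  calc a ≤ (M ^ 4 + 2) ^ decideInput.width := h
    _ ≤ (2 ^ (5 * M.size)) ^ decideInput.width := Nat.pow_le_pow_left h2 _
    _ = 2 ^ (5 * M.size * decideInput.width) := (pow_mul _ _ _).symm
    _ < 2 ^ (wordFactor * M.size) := by
      refine Nat.pow_lt_pow_right (by norm_num) ?_
      rw [wordFactor, add_mul, one_mul]
      have : 5 * M.size * decideInput.width = 5 * decideInput.width * M.size := by ring
      omega

theorem length_le_maxNumber (x : List ℕ) : x.length ≤ maxNumber x := by
  simp [maxNumber]

theorem le_maxNumber {x : List ℕ} {a : ℕ} (ha : a ∈ x) : a ≤ maxNumber x := by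
  have : ∀ l : List ℕ, a ∈ l → a ≤ l.foldr max 0 := by
    intro l
    induction l with
    | nil => simp
    | cons b l ih =>
      intro h
      rcases List.mem_cons.1 h with rfl | h
      · exact le_max_left _ _
      · exact (ih h).trans (le_max_right _ _)
  exact this _ (List.mem_cons_of_mem _ ha)

theorem getD_le_maxNumber (x : List ℕ) (i : ℕ) : x.getD i 0 ≤ maxNumber x := by
  rcases Nat.lt_or_ge i x.length with h | h
  · rw [List.getD_eq_getElem _ _ h]
    exact le_maxNumber (List.getElem_mem h)
  · rw [List.getD_eq_default _ _ h]
    exact Nat.zero_le _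

theorem exec_program {x : List ℕ} (hx : 0 < x.length) {T : ℕ} {Q : ℕ → Prop}
    (h : Runs x (maxNumber x ^ 4) decideInput ⟨fun _ => 0, fun _ _ => 0⟩ T
      fun τ => Q (τ.val .res)) :
    ∃ c t, Exec program (init x) c t ∧ c.steps ≤ T + 2 ∧
      c.word.size ≤ wordFactor * (maxNumber x).size ∧ Q (t.reg 0) := by
  have hM : ∀ {a}, a ≤ maxNumber x → a ≤ maxNumber x ^ 4 := fun ha =>
    ha.trans (Nat.le_self_pow (by norm_num) _)
  have hb : Bdd x (maxNumber x ^ 4) ⟨fun _ => 0, fun _ _ => 0⟩ :=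
    ⟨hM (length_le_maxNumber x), by simp, by simp, fun i => hM (getD_le_maxNumber x i)⟩
  have hw : decideInput.width ≠ 0 := by
    have := Expr.width_pos ◇.ok
    simp only [decideInput, Cmd.width]
    omega
  have hW : maxNumber x ^ 4 ≤ (maxNumber x ^ 4 + 2) ^ decideInput.width :=
    (Nat.le_add_right _ 2).trans (Nat.le_self_pow hw _)
  have hP : Halts program (init x) (T + (1 + 1))
      ((maxNumber x ^ 4 + 2) ^ decideInput.width) fun t => Q (t.reg 0) := by
    refine .seq ((h hb _ (rep_init x)).mono le_rfl le_rfl ?_)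
    rintro t ⟨τ, hτ, hbτ, hQ⟩
    refine .seq (.const (Nat.zero_le _) (.op ?_ ?_ ?_ ?_))
    all_goals simp [setReg_reg_of_ne t (show Var.res.reg ≠ 22 by decide), hτ.val, Op.eval]
    · exact (hbτ.val _).trans hW
    · exact (hbτ.val _).trans hW
    · exact hQ
  obtain ⟨c, t, h1, h2, h3, h4⟩ := hP
  exact ⟨c, t, h1, h2,
    size_le_wordFactor_mul (hx.trans_le (length_le_maxNumber x)) h3, h4⟩

/-- The quantifier over all `J` with the same input makes a proof that the encoding is injective
unnecessary. -/
theorem decides_input (I : TwoAgentInstance) : ∃ c,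
    (∀ J : TwoAgentInstance, I.input = J.input → Decides program I.input c J.IsYes) ∧
    c.steps ≤ runTime I.n I.k I.n.size + 2 ∧
    c.word.size ≤ wordFactor * (maxNumber I.input).size := by
  obtain ⟨c, t, h1, h2, h3, h4⟩ := exec_program (x := I.input) (by simp [TwoAgentInstance.input])
    (Q := fun r => ∀ J : TwoAgentInstance, I.input = J.input → (r ≠ 0 ↔ J.IsYes))
    (runs_decideInput (isValid_input I) rfl rfl I.n.lt_size_self (length_le_maxNumber _)
      (getD_le_maxNumber _) le_rfl rfl)
  exact ⟨c, fun J hJ => ⟨t, h1, h4 J hJ⟩, h2, h3⟩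

theorem decides_of_not_isValid {x : List ℕ} (hx : ¬ IsValid x) (hx' : 0 < x.length) :
    ∃ c, Decides program x c False ∧ c.steps ≤ 100 * (x.length + 1) + 8 ∧
      c.word.size ≤ wordFactor * (maxNumber x).size := by
  obtain ⟨c, t, h1, h2, h3, h4⟩ := exec_program hx' (Q := fun r => r = 0)
    (runs_decideInput_of_not_isValid hx)
  exact ⟨c, ⟨t, h1, by simpa [State.Accepts] using h4⟩, h2, h3⟩

theorem length_le_inputSize (x : List ℕ) : x.length ≤ inputSize x := by
  induction x with
  | nil => simp
  | cons a x ih => simp only [inputSize, List.map_cons, List.sum_cons, List.length_cons] at *; omega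

theorem size_maxNumber_le (x : List ℕ) : (maxNumber x).size ≤ inputSize x := by
  have hfold : ∀ l : List ℕ, (l.foldr max 0).size ≤ inputSize l := by
    intro l
    induction l with
    | nil => simp
    | cons a l ih =>
      simp only [inputSize, List.map_cons, List.sum_cons, List.foldr_cons] at *
      rcases max_choice a (l.foldr max 0) with h | h <;> rw [h] <;> omega
  rw [maxNumber, List.foldr_cons]
  rcases max_choice x.length (x.foldr max 0) with h | h <;> rw [h]
  · exact (Nat.size_le.2 Nat.lt_two_pow_self).trans (length_le_inputSize x)
  · exact hfold x

theorem size_le_self (n : ℕ) : n.size ≤ n := Nat.size_le.2 Nat.lt_two_pow_self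

theorem runTime_le_pow {n k S : ℕ} (hS : 4 + 2 * n + 2 * k ≤ S) :
    runTime n k n.size + 2 ≤ 4000 * S ^ (2 * k + 2) := by
  have hL := size_le_self n
  have h1 : (n + k) ^ (2 * k) ≤ S ^ (2 * k) := Nat.pow_le_pow_left (by omega) _
  have h2 : 0 < S ^ (2 * k) := Nat.pow_pos (by omega)
  have h3 : testCost n k n.size ≤ 2 * (S * S) := by
    have a1 : (n + k + 1) * (n.size + 1) ≤ S * S := Nat.mul_le_mul (by omega) (by omega)
    have a2 : k * (n + 1) ≤ S * S := Nat.mul_le_mul (by omega) (by omega)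
    rw [testCost]
    omega
  have h4 : (n + 1) * (n.size + 1) ≤ S * S := Nat.mul_le_mul (by omega) (by omega)
  have h5 : S ≤ S * S := Nat.le_mul_of_pos_left _ (by omega)
  have h6 : testCost n k n.size * (n + k) ^ (2 * k) ≤ 2 * (S * S) * S ^ (2 * k) :=
    Nat.mul_le_mul h3 h1
  have h7 : S * S ≤ S * S * S ^ (2 * k) := Nat.le_mul_of_pos_right _ h2
  have h8 : S ^ (2 * k + 2) = S * S * S ^ (2 * k) := by ring
  have h9 : 1300 * testCost n k n.size * (n + k) ^ (2 * k) =
    1300 * (testCost n k n.size * (n + k) ^ (2 * k)) := by ring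
  have h10 : 2 * (S * S) * S ^ (2 * k) = 2 * (S * S * S ^ (2 * k)) := by ring
  rw [runTime, h8, h9]
  omega

theorem inXP_twoAgentProblem : InXP twoAgentProblem := by
  -- One value serves as factor and as exponent, so the constant factor and the exponent `2 * k + 3`
  -- are added.
  refine ⟨program, fun k => 4000 * (1 + 3 * wordFactor) + (2 * k + 3), ?_, fun x k => ?_⟩
  · exact (Primrec.nat_add.comp (Primrec.const _) (Primrec.nat_add.comp
      (Primrec.nat_mul.comp (Primrec.const 2) Primrec.id) (Primrec.const 3))).to_comp
  have hlen := length_le_inputSize (k :: x)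
  have hsize := size_maxNumber_le (k :: x)
  have hpos : 0 < inputSize (k :: x) := lt_of_lt_of_le (by simp) hlen
  have key : ∃ c, Decides program (k :: x) c ((x, k) ∈ twoAgentProblem) ∧
      c.steps ≤ 4000 * inputSize (k :: x) ^ (2 * k + 2) ∧
      c.word.size ≤ wordFactor * (maxNumber (k :: x)).size := by
    by_cases hv : IsValid (k :: x)
    · obtain ⟨I, hI⟩ := hv.exists_input
      obtain ⟨c, h1, h2, h3⟩ := decides_input I
      have hS := (length_input I).symm.le.trans (length_le_inputSize I.input)
      obtain ⟨rfl, rfl⟩ := List.cons.inj hI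
      refine ⟨c, ?_, h2.trans (runTime_le_pow hS), h3⟩
      by_cases hL : (I.encode, I.k) ∈ twoAgentProblem
      · obtain ⟨J, hJ, hJ'⟩ := id hL
        obtain ⟨he, hk⟩ := Prod.mk.inj hJ
        convert h1 J (congrArg₂ List.cons hk he) using 1
        exact iff_of_true hL hJ'
      · convert h1 I rfl using 1
        exact iff_of_false hL fun hI => hL ⟨I, rfl, hI⟩
    · obtain ⟨c, h1, h2, h3⟩ := decides_of_not_isValid hv (by simp)
      refine ⟨c, ?_, h2.trans ?_, h3⟩
      · convert h1
        simp only [iff_false]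
        rintro ⟨I, hI, -⟩
        obtain ⟨rfl, rfl⟩ := Prod.mk.inj hI
        exact hv (isValid_input I)
      · have : inputSize (k :: x) ≤ inputSize (k :: x) ^ (2 * k + 2) :=
          Nat.le_self_pow (by omega) _
        omega
  obtain ⟨c, h1, h2, h3⟩ := key
  refine ⟨c, h1, ?_⟩
  obtain ⟨t, ht, -⟩ := h1
  -- The word size, linear in the input size, raises the exponent from `2 * k + 2` to `2 * k + 3`.
  have h4 := ht.bits_le (h3.trans (Nat.mul_le_mul_left _ hsize))
  generalize inputSize (k :: x) = S at *
  calc c.bits ≤ c.steps * (1 + 3 * (wordFactor * S)) := h4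
    _ ≤ 4000 * S ^ (2 * k + 2) * ((1 + 3 * wordFactor) * S) := by
      refine Nat.mul_le_mul h2 ?_
      rw [add_mul]
      have : 3 * (wordFactor * S) = 3 * wordFactor * S := by ring
      omega
    _ = 4000 * (1 + 3 * wordFactor) * S ^ (2 * k + 3) := by ring
    _ ≤ _ := Nat.mul_le_mul (Nat.le_add_right _ _)
      (Nat.pow_le_pow_right hpos (Nat.le_add_left _ _))

/-- Both `n.size - 1` and 1 are at most the binary logarithm, so `n.size + 1` is at most three times
it, and `3 / log 2 < 6`. -/
theorem size_succ_le_log {n : ℕ} (hn : 2 ≤ n) : ((n.size + 1 : ℕ) : ℝ) ≤ 6 * Real.log n := by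
  have hs : 0 < n.size := Nat.size_pos.2 (by omega)
  have h1 : 2 ^ (n.size - 1) ≤ n := Nat.lt_size.1 (by omega)
  have h2 : ((n.size - 1 : ℕ) : ℝ) * Real.log 2 ≤ Real.log n := by
    rw [← Real.log_pow]
    exact Real.log_le_log (by positivity) (by exact_mod_cast h1)
  have h3 : Real.log 2 ≤ Real.log n := Real.log_le_log (by norm_num) (by exact_mod_cast hn)
  have h4 := Real.log_two_gt_d9
  rw [Nat.cast_sub (by omega)] at h2
  have h5 : (1 : ℝ) ≤ n.size := by exact_mod_cast hs
  push_cast at *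
  nlinarith

/-- The left side is at most `8 ^ k`, and `8 ^ k / k!` is a term of the series of `exp 8`. -/
theorem succ_mul_four_pow_le (k : ℕ) :
    ((k : ℝ) + 1) * 4 ^ k ≤ Real.exp 8 * (k.factorial : ℝ) := by
  have h1 : ((k : ℝ) + 1) ≤ 2 ^ k := by exact_mod_cast Nat.lt_two_pow_self (n := k)
  have h2 := Real.pow_div_factorial_le_exp 8 (by norm_num) k
  rw [div_le_iff₀ (by positivity)] at h2
  refine le_trans ?_ h2
  calc ((k : ℝ) + 1) * 4 ^ k ≤ 2 ^ k * 4 ^ k := by gcongr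
    _ = 8 ^ k := by rw [← mul_pow]; norm_num

/-- As `k ≤ n`, the number of guesses is at most `(2 n) ^ (2 k) = 4 ^ k n ^ (2 k)`, and a test costs
at most `3 (k + 1) n (n.size + 1)`. The factorial absorbs `(k + 1) 4 ^ k`. -/
theorem runTime_le {n k : ℕ} (hk : k ≤ n) (hn : 2 ≤ n) : ((runTime n k n.size + 2 : ℕ) : ℝ) ≤
    60000 * Real.exp 8 * ((k.factorial : ℝ) * (n : ℝ) ^ (2 * k + 1) * Real.log n) := by
  have h1 : testCost n k n.size ≤ 3 * ((k + 1) * (n * (n.size + 1))) := by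
    have a1 : (n + k + 1) * (n.size + 1) ≤ 3 * n * (n.size + 1) := Nat.mul_le_mul_right _ (by omega)
    have a2 : k * (n + 1) ≤ k * (3 * (n * (n.size + 1))) := by
      refine Nat.mul_le_mul_left _ ?_
      have : n ≤ n * (n.size + 1) := Nat.le_mul_of_pos_right _ (by omega)
      omega
    rw [testCost]
    linarith
  have h2 : (n + k) ^ (2 * k) ≤ 4 ^ k * n ^ (2 * k) := by
    calc (n + k) ^ (2 * k) ≤ (2 * n) ^ (2 * k) := Nat.pow_le_pow_left (by omega) _
      _ = 4 ^ k * n ^ (2 * k) := by rw [mul_pow, pow_mul 2 2 k]; norm_num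
  have h3 : testCost n k n.size * (n + k) ^ (2 * k) ≤
      3 * ((k + 1) * 4 ^ k * (n ^ (2 * k + 1) * (n.size + 1))) := by
    refine (Nat.mul_le_mul h1 h2).trans (le_of_eq ?_)
    ring
  have h4 : n * (n.size + 1) ≤ (k + 1) * 4 ^ k * (n ^ (2 * k + 1) * (n.size + 1)) := by
    calc n * (n.size + 1) ≤ n ^ (2 * k + 1) * (n.size + 1) :=
          Nat.mul_le_mul_right _ (Nat.le_self_pow (by omega) _)
      _ ≤ _ := Nat.le_mul_of_pos_left _ (by positivity)
  have h5 : runTime n k n.size + 2 ≤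
      10000 * ((k + 1) * 4 ^ k * (n ^ (2 * k + 1) * (n.size + 1))) := by
    have b1 : n ≤ n * (n.size + 1) := Nat.le_mul_of_pos_right _ (by omega)
    have b2 : (n + 1) * (n.size + 1) ≤ 2 * n * (n.size + 1) := Nat.mul_le_mul_right _ (by omega)
    have b3 : 2 * n * (n.size + 1) = 2 * (n * (n.size + 1)) := by ring
    have b4 : 1300 * testCost n k n.size * (n + k) ^ (2 * k) =
      1300 * (testCost n k n.size * (n + k) ^ (2 * k)) := by ring
    rw [runTime, b4]
    omega
  have h6 : ((runTime n k n.size + 2 : ℕ) : ℝ) ≤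
      10000 * (((k : ℝ) + 1) * 4 ^ k * ((n : ℝ) ^ (2 * k + 1) * ((n.size + 1 : ℕ) : ℝ))) := by
    exact_mod_cast h5
  calc ((runTime n k n.size + 2 : ℕ) : ℝ)
      ≤ 10000 * (((k : ℝ) + 1) * 4 ^ k * ((n : ℝ) ^ (2 * k + 1) * ((n.size + 1 : ℕ) : ℝ))) := h6
    _ ≤ 10000 * (Real.exp 8 * (k.factorial : ℝ) * ((n : ℝ) ^ (2 * k + 1) * (6 * Real.log n))) := by
      have c1 := succ_mul_four_pow_le k
      have c2 := size_succ_le_log hn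
      have c3 : (0 : ℝ) ≤ ((n.size + 1 : ℕ) : ℝ) := Nat.cast_nonneg _
      generalize ((n.size + 1 : ℕ) : ℝ) = l at *
      generalize ((k : ℝ) + 1) * 4 ^ k = a at *
      gcongr
    _ = _ := by ring

end Sched

theorem mainTheorem5 :
    (∃ (P : RAM.Prog) (K : ℝ) (b : ℕ), ∀ I : TwoAgentInstance, ∃ c : RAM.Cost,
      RAM.Decides P I.input c I.IsYes ∧
      (2 ≤ I.n → (c.steps : ℝ) ≤
        K * ((Nat.factorial I.k : ℝ) * (I.n : ℝ) ^ (2 * I.k + 1) * Real.log (I.n : ℝ))) ∧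
      c.word.size ≤ b * (RAM.maxNumber I.input).size) ∧
    InXP twoAgentProblem := by
  refine ⟨⟨Sched.program, 60000 * Real.exp 8, Sched.wordFactor, fun I => ?_⟩,
    Sched.inXP_twoAgentProblem⟩
  obtain ⟨c, h1, h2, h3⟩ := Sched.decides_input I
  exact ⟨c, h1 I rfl, fun hn => le_trans (by exact_mod_cast h2) (Sched.runTime_le I.k_le_n hn), h3⟩
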